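/- All topological spaces are compactly generated (weak Hausdorff $k$-spaces), and products and subspaces are taken in this category. A \emph{flow} $X$ consists of a space $\mathbb{P}X$ (the path space), a discrete space $X^0$ (the $0$-skeleton), continuous maps $s,t:\mathbb{P}X\to X^0$, and a continuous associative map $*:\{(x,y)\in\mathbb{P}X\times\mathbb{P}X : t(x)=s(y)\}\to\mathbb{P}X$ with $s(x*y)=s(x)$ and $t(x*y)=t(y)$. A morphism of flows $f:X\to Y$ is a set map $f^0:X^0\to Y^0$ together with a continuous map $\mathbb{P}f:\mathbb{P}X\to\mathbb{P}Y$ compatible with $s$, $t$ and $*$. For a space $Z$, $\mathrm{Glob}(Z)$ is the flow with $0$-skeleton $\{0,1\}$, path space $Z$, $s=0$ and $t=1$; a set is regarded as a flow with empty path space. Equip the category of flows with its model structure: \begin{itemize} \item the weak equivalences are the morphisms $f$ such that $f^0$ is a bijection and $\mathbb{P}f$ is a weak homotopy equivalence; \item the fibrations are the morphisms with the right lifting property with respect to the maps $\mathrm{Glob}(\mathbf{D}^n)\to\mathrm{Glob}([0,1]\times\mathbf{D}^n)$, $n\ge 0$, induced by $x\mapsto(0,x)$; \item the cofibrations are the morphisms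 with the left lifting property with respect to every morphism that has the right lifting property with respect to the inclusions $\mathrm{Glob}(\mathbf{S}^{n-1})\to\mathrm{Glob}(\mathbf{D}^n)$, $n\ge0$ (with $\mathbf{S}^{-1}=\varnothing$), the map $R:\{0,1\}\to\{0\}$ and the map $C:\varnothing\to\{0\}$. \end{itemize} A flow $X$ is cofibrant if $\varnothing\to X$ is a cofibration. Two morphisms $f,g:X\to Y$ are \emph{left homotopic}, $f\sim_l g$, if the codiagonal $X\sqcup X\to X$ factors as a cofibration $X\sqcup X\to I(X)$ followed by a trivial fibration (a fibration that is a weak equivalence) $I(X)\to X$ such that $f\sqcup g:X\sqcup X\to Y$ is the composite of $X\sqcup X\to I(X)$ with some morphism $I(X)\to Y$. They are \emph{S-homotopic}, $f\sim_S g$, if there is a continuous map $H:[0,1]\times(X^0\sqcup\mathbb{P}X)\to Y^0\sqcup\mathbb{P}Y$ such that $H(u,-)$ is a morphism of flows for every $u\in[0,1]$, $H(0,-)=f$ and $H(1,-)=g$. Two flows $X$ and $Y$ are \emph{left homotopy equivalent} (resp. \emph{S-homotopy equivalent}) if there are morphisms $f:X\to Y$ and $g:Y\to X$ with $f\circ g\sim\mathrm{Id}_Y$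 and $g\circ f\sim\mathrm{Id}_X$, where $\sim$ is $\sim_l$ (resp. $\sim_S$). \textbf{Theorem.} Two cofibrant flows are left homotopy equivalent if and only if they are S-homotopy equivalent. -/

import Mathlib

open CategoryTheory HomotopicalAlgebra Topology

universe u

/-- A space is weak Hausdorff if the image of every continuous map from a compact Hausdorff
space is closed. -/
class WeakHausdorffSpace (X : Type u) [TopologicalSpace X] : Prop where
  isClosed_range : ∀ (K : CompHaus.{u}) (f : C(K, X)), IsClosed (Set.range f)

instance (X : Type u) [TopologicalSpace X] [T2Space X] : WeakHausdorffSpace X where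
  isClosed_range _ f := (isCompact_range f.continuous).isClosed

/-- A flow. All spaces are compactly generated, i.e. weak Hausdorff `k`-spaces, so the space of
composable pairs carries the Kelleyfication of the topology induced by the product. -/
structure DirectedFlow : Type (u + 1) where
  /-- the `0`-skeleton -/
  states : Type u
  [topStates : TopologicalSpace states]
  [discreteStates : DiscreteTopology states]
  /-- the path space -/
  paths : Type u
  [topPaths : TopologicalSpace paths]
  [compactlyGeneratedPaths : CompactlyGeneratedSpace paths]
  [weakHausdorffPaths : WeakHausdorffSpace paths]
  /-- the source map -/
  src : paths → states
  /-- the target map -/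
  tgt : paths → states
  continuous_src : Continuous src
  continuous_tgt : Continuous tgt
  /-- the concatenation of composable paths -/
  concat : ∀ x y : paths, tgt x = src y → paths
  continuous_concat :
    Continuous[TopologicalSpace.compactlyGenerated.{u} {p : paths × paths // tgt p.1 = src p.2},
      topPaths] (fun p => concat p.1.1 p.1.2 p.2)
  src_concat : ∀ x y h, src (concat x y h) = src x
  tgt_concat : ∀ x y h, tgt (concat x y h) = tgt y
  concat_assoc : ∀ (x y z : paths) (hxy : tgt x = src y) (hyz : tgt y = src z),
    concat (concat x y hxy) z ((tgt_concat x y hxy).trans hyz) =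
      concat x (concat y z hyz) (hxy.trans (src_concat y z hyz).symm)

namespace DirectedFlow

attribute [instance] topStates discreteStates topPaths compactlyGeneratedPaths weakHausdorffPaths

/-- Morphisms of flows. -/
@[ext]
structure Hom (X Y : DirectedFlow.{u}) : Type u where
  onStates : X.states → Y.states
  onPaths : C(X.paths, Y.paths)
  src_onPaths : ∀ x, Y.src (onPaths x) = onStates (X.src x)
  tgt_onPaths : ∀ x, Y.tgt (onPaths x) = onStates (X.tgt x)
  map_concat : ∀ (x y : X.paths) (h : X.tgt x = X.src y),
    onPaths (X.concat x y h) =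
      Y.concat (onPaths x) (onPaths y)
        ((tgt_onPaths x).trans ((congrArg onStates h).trans (src_onPaths y).symm))

instance : Category.{u} DirectedFlow.{u} where
  Hom := Hom
  id X :=
    { onStates := id
      onPaths := ContinuousMap.id _
      src_onPaths := fun _ => rfl
      tgt_onPaths := fun _ => rfl
      map_concat := fun _ _ _ => rfl }
  comp f g :=
    { onStates := g.onStates ∘ f.onStates
      onPaths := g.onPaths.comp f.onPaths
      src_onPaths := fun x => by simp [g.src_onPaths, f.src_onPaths]
      tgt_onPaths := fun x => by simp [g.tgt_onPaths, f.tgt_onPaths]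
      map_concat := fun x y h => by simp [f.map_concat, g.map_concat] }

@[ext]
theorem hom_ext {X Y : DirectedFlow.{u}} {f g : X ⟶ Y} (h₀ : ∀ x, f.onStates x = g.onStates x)
    (h₁ : ∀ x, f.onPaths x = g.onPaths x) : f = g :=
  Hom.ext (funext h₀) (ContinuousMap.ext h₁)

/-! ### Globes, discrete flows, generating morphisms -/

/-- The globe of a compactly generated space. -/
def glob (Z : Type u) [TopologicalSpace Z] [CompactlyGeneratedSpace Z] [WeakHausdorffSpace Z] :
    DirectedFlow.{u} where
  states := ULift.{u} (Fin 2)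
  paths := Z
  src _ := ⟨0⟩
  tgt _ := ⟨1⟩
  continuous_src := continuous_const
  continuous_tgt := continuous_const
  concat _ _ h := absurd (congrArg ULift.down h) (by decide)
  continuous_concat := by
    have : IsEmpty {_p : Z × Z // (⟨1⟩ : ULift.{u} (Fin 2)) = ⟨0⟩} :=
      ⟨fun p => absurd (congrArg ULift.down p.2) (by decide)⟩
    exact continuous_from_compactlyGenerated _ fun S g =>
      have : IsEmpty S := ⟨fun s => this.false (g s)⟩
      continuous_of_const fun x => (this.false x).elim
  src_concat _ _ h := absurd (congrArg ULift.down h) (by decide)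
  tgt_concat _ _ h := absurd (congrArg ULift.down h) (by decide)
  concat_assoc _ _ _ h := absurd (congrArg ULift.down h) (by decide)

/-- The morphism of globes induced by a continuous map. -/
def globMap {Z W : Type u} [TopologicalSpace Z] [CompactlyGeneratedSpace Z] [WeakHausdorffSpace Z]
    [TopologicalSpace W] [CompactlyGeneratedSpace W] [WeakHausdorffSpace W] (f : C(Z, W)) :
    glob Z ⟶ glob W where
  onStates := id
  onPaths := f
  src_onPaths _ := rfl
  tgt_onPaths _ := rfl
  map_concat _ _ h := absurd (congrArg ULift.down h) (by change ¬ ((1 : Fin 2) = 0); decide)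

/-- The flow with `0`-skeleton `S` and empty path space. -/
def discrete (S : Type u) [TopologicalSpace S] [DiscreteTopology S] : DirectedFlow.{u} where
  states := S
  paths := PEmpty
  src := PEmpty.elim
  tgt := PEmpty.elim
  continuous_src := continuous_of_const fun x => x.elim
  continuous_tgt := continuous_of_const fun x => x.elim
  concat x := x.elim
  continuous_concat := continuous_from_compactlyGenerated _ fun _ g =>
    continuous_of_const fun x => (g x).1.1.elim
  src_concat x := x.elim
  tgt_concat x := x.elim
  concat_assoc x := x.elim

/-- Morphisms out of a flow without paths are maps on the `0`-skeleton. -/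
def discreteDesc {S : Type u} [TopologicalSpace S] [DiscreteTopology S] {X : DirectedFlow.{u}}
    (f : S → X.states) : discrete S ⟶ X where
  onStates := f
  onPaths := ⟨PEmpty.elim, continuous_of_const fun x => x.elim⟩
  src_onPaths x := x.elim
  tgt_onPaths x := x.elim
  map_concat x := x.elim

instance (n : ℕ) : T2Space (TopCat.disk.{u} n) :=
  inferInstanceAs (T2Space (ULift (Metric.closedBall (0 : EuclideanSpace ℝ (Fin n)) 1)))

instance (n : ℕ) : T2Space (TopCat.diskBoundary.{u} n) :=
  inferInstanceAs (T2Space (ULift (Metric.sphere (0 : EuclideanSpace ℝ (Fin n)) 1)))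

/-- `Glob(S^{n-1}) ⟶ Glob(D^n)`, with `S^{-1}` empty. -/
noncomputable def globBoundaryInclusion (n : ℕ) :
    glob (TopCat.diskBoundary.{u} n) ⟶ glob (TopCat.disk.{u} n) :=
  globMap (TopCat.diskBoundaryInclusion.{u} n).hom

/-- `Glob(D^n) ⟶ Glob([0,1] × D^n)`, induced by `x ↦ (0, x)`. -/
noncomputable def globCylinderInclusion (n : ℕ) :
    glob (TopCat.disk.{u} n) ⟶ glob (unitInterval × TopCat.disk.{u} n) :=
  globMap ⟨fun x => (0, x), by fun_prop⟩

/-- `R : {0,1} ⟶ {0}` -/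
def mapR : discrete (ULift.{u} (Fin 2)) ⟶ discrete PUnit.{u + 1} :=
  discreteDesc fun _ => (PUnit.unit : PUnit.{u + 1})

/-- `C : ∅ ⟶ {0}` -/
def mapC : discrete PEmpty.{u + 1} ⟶ discrete PUnit.{u + 1} :=
  discreteDesc PEmpty.elim

/-- The generating cofibrations. -/
def generatingCofibrations : MorphismProperty DirectedFlow.{u} :=
  .ofHoms globBoundaryInclusion.{u} ⊔ .single mapR.{u} ⊔ .single mapC.{u}

/-- The generating trivial cofibrations. -/
def generatingTrivialCofibrations : MorphismProperty DirectedFlow.{u} :=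
  .ofHoms globCylinderInclusion.{u}

/-! ### Weak S-homotopy equivalences -/

/-- The map induced on path components. -/
def mapZerothHomotopy {A B : Type u} [TopologicalSpace A] [TopologicalSpace B] (f : C(A, B)) :
    ZerothHomotopy A → ZerothHomotopy B :=
  Quotient.map f fun _ _ h => h.map f.continuous

/-- The map induced on the `n`-th homotopy group. -/
def mapHomotopyGroup {A B : Type u} [TopologicalSpace A] [TopologicalSpace B] (f : C(A, B))
    (n : ℕ) (a : A) : HomotopyGroup.Pi n A a → HomotopyGroup.Pi n B (f a) :=
  Quotient.map (fun p => ⟨f.comp p.1, fun y hy => congrArg f (p.2 y hy)⟩)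
    fun _ _ h => ContinuousMap.HomotopicRel.comp_continuousMap h f

/-- `f` is a weak homotopy equivalence: it induces a bijection on path components and
isomorphisms on all homotopy groups at all base points. -/
def IsWeakHomotopyEquivalence {A B : Type u} [TopologicalSpace A] [TopologicalSpace B]
    (f : C(A, B)) : Prop :=
  Function.Bijective (mapZerothHomotopy f) ∧
    ∀ n : ℕ, 1 ≤ n → ∀ a : A, Function.Bijective (mapHomotopyGroup f n a)

/-- A morphism of flows is synchronized if it is bijective on `0`-skeletons. -/
def IsSynchronized {X Y : DirectedFlow.{u}} (f : X ⟶ Y) : Prop :=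
  Function.Bijective f.onStates

/-- Weak S-homotopy equivalences. -/
def IsWeakSHomotopyEquivalence {X Y : DirectedFlow.{u}} (f : X ⟶ Y) : Prop :=
  IsSynchronized f ∧ IsWeakHomotopyEquivalence f.onPaths

/-! ### The classes of morphisms of the model structure -/

instance : CategoryWithWeakEquivalences DirectedFlow.{u} where
  weakEquivalences := fun _ _ f => IsWeakSHomotopyEquivalence f

instance : CategoryWithFibrations DirectedFlow.{u} where
  fibrations := generatingTrivialCofibrations.rlp

instance : CategoryWithCofibrations DirectedFlow.{u} where
  cofibrations := generatingCofibrations.rlp.llp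

/-! ### The initial flow and binary coproducts -/

instance : Limits.HasInitial DirectedFlow.{u} :=
  (Limits.IsInitial.ofUniqueHom (X := discrete PEmpty.{u + 1})
    (fun _ => discreteDesc PEmpty.elim)
    (fun _ _ => hom_ext (fun x => x.elim) (fun x => x.elim))).hasInitial

/-- Concatenation in a disjoint union. -/
def sumConcat (X Y : DirectedFlow.{u}) : ∀ x y : X.paths ⊕ Y.paths,
    Sum.map X.tgt Y.tgt x = Sum.map X.src Y.src y → X.paths ⊕ Y.paths
  | .inl x, .inl y, h => .inl (X.concat x y (Sum.inl_injective h))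
  | .inr x, .inr y, h => .inr (Y.concat x y (Sum.inr_injective h))
  | .inl _, .inr _, h => absurd h (by simp)
  | .inr _, .inl _, h => absurd h (by simp)

theorem continuous_concat_comp (X : DirectedFlow.{u}) {K : Type u} [TopologicalSpace K]
    [CompactSpace K] [T2Space K] {a b : K → X.paths} (ha : Continuous a) (hb : Continuous b)
    (h : ∀ k, X.tgt (a k) = X.src (b k)) :
    Continuous fun k => X.concat (a k) (b k) (h k) := by
  let g : C(CompHaus.of K, {p : X.paths × X.paths // X.tgt p.1 = X.src p.2}) :=
    ⟨fun k => ⟨(a k, b k), h k⟩, (ha.prodMk hb).subtype_mk _⟩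
  have h1 := X.continuous_concat
  rw [TopologicalSpace.compactlyGenerated, continuous_coinduced_dom] at h1
  exact (continuous_sigma_iff.1 h1) ⟨CompHaus.of K, g⟩

theorem exists_lift_inl {A B K : Type u} [TopologicalSpace A] [TopologicalSpace B]
    [TopologicalSpace K] {f : K → A ⊕ B} (hf : Continuous f) (h : ∀ k, (f k).isLeft) :
    ∃ g : K → A, Continuous g ∧ ∀ k, f k = Sum.inl (g k) := by
  refine ⟨fun k => (f k).getLeft (h k), ?_, fun k => (Sum.inl_getLeft _ _).symm⟩
  refine (Topology.IsEmbedding.inl (X := A) (Y := B)).continuous_iff.2 ?_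
  exact hf.congr fun k => (Sum.inl_getLeft _ _).symm

theorem exists_lift_inr {A B K : Type u} [TopologicalSpace A] [TopologicalSpace B]
    [TopologicalSpace K] {f : K → A ⊕ B} (hf : Continuous f) (h : ∀ k, (f k).isRight) :
    ∃ g : K → B, Continuous g ∧ ∀ k, f k = Sum.inr (g k) := by
  refine ⟨fun k => (f k).getRight (h k), ?_, fun k => (Sum.inr_getRight _ _).symm⟩
  refine (Topology.IsEmbedding.inr (X := A) (Y := B)).continuous_iff.2 ?_
  exact hf.congr fun k => (Sum.inr_getRight _ _).symm

theorem isClopen_isLeft {A B K : Type u} [TopologicalSpace A] [TopologicalSpace B]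
    [TopologicalSpace K] {f : K → A ⊕ B} (hf : Continuous f) : IsClopen {k | (f k).isLeft} := by
  have h : Continuous fun x : A ⊕ B => x.isLeft :=
    continuous_sum_dom.2 ⟨continuous_const, continuous_const⟩
  exact (isClopen_discrete {true}).preimage (h.comp hf)

theorem isClopen_isRight {A B K : Type u} [TopologicalSpace A] [TopologicalSpace B]
    [TopologicalSpace K] {f : K → A ⊕ B} (hf : Continuous f) : IsClopen {k | (f k).isRight} := by
  have h : Continuous fun x : A ⊕ B => x.isRight :=
    continuous_sum_dom.2 ⟨continuous_const, continuous_const⟩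
  exact (isClopen_discrete {true}).preimage (h.comp hf)

instance (A B : Type u) [TopologicalSpace A] [TopologicalSpace B] [WeakHausdorffSpace A]
    [WeakHausdorffSpace B] : WeakHausdorffSpace (A ⊕ B) where
  isClosed_range K f := by
    refine isClosed_sum_iff.2 ⟨?_, ?_⟩
    · have : CompactSpace {k | (f k).isLeft} :=
        isCompact_iff_compactSpace.1 (isClopen_isLeft f.continuous).isClosed.isCompact
      obtain ⟨g, hg, hfg⟩ := exists_lift_inl (K := {k | (f k).isLeft})
        (f.continuous.comp continuous_subtype_val) (fun k => k.2)
      convert! WeakHausdorffSpace.isClosed_range (CompHaus.of {k | (f k).isLeft}) ⟨g, hg⟩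
      ext x
      refine ⟨fun ⟨k, hk⟩ => ⟨⟨k, by simp [hk]⟩, ?_⟩, fun ⟨k, hk⟩ => ⟨k.1, ?_⟩⟩
      · exact Sum.inl_injective ((hfg _).symm.trans hk)
      · exact (hfg k).trans (congrArg Sum.inl hk)
    · have : CompactSpace {k | (f k).isRight} :=
        isCompact_iff_compactSpace.1 (isClopen_isRight f.continuous).isClosed.isCompact
      obtain ⟨g, hg, hfg⟩ := exists_lift_inr (K := {k | (f k).isRight})
        (f.continuous.comp continuous_subtype_val) (fun k => k.2)
      convert! WeakHausdorffSpace.isClosed_range (CompHaus.of {k | (f k).isRight}) ⟨g, hg⟩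
      ext x
      refine ⟨fun ⟨k, hk⟩ => ⟨⟨k, by simp [hk]⟩, ?_⟩, fun ⟨k, hk⟩ => ⟨k.1, ?_⟩⟩
      · exact Sum.inr_injective ((hfg _).symm.trans hk)
      · exact (hfg k).trans (congrArg Sum.inr hk)

theorem continuous_sumConcat (X Y : DirectedFlow.{u}) {K : Type u} [TopologicalSpace K]
    [CompactSpace K] [T2Space K] {a b : K → X.paths ⊕ Y.paths} (ha : Continuous a)
    (hb : Continuous b) (h : ∀ k, Sum.map X.tgt Y.tgt (a k) = Sum.map X.src Y.src (b k)) :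
    Continuous fun k => sumConcat X Y (a k) (b k) (h k) := by
  rw [continuous_iff_continuousAt]
  intro k₀
  cases ha₀ : a k₀ with
  | inl x₀ =>
    have hU := isClopen_isLeft ha
    have hk : k₀ ∈ {k | (a k).isLeft} := by simp [ha₀]
    have : CompactSpace {k | (a k).isLeft} :=
      isCompact_iff_compactSpace.1 hU.isClosed.isCompact
    obtain ⟨a', ha', haa⟩ := exists_lift_inl (K := {k | (a k).isLeft})
      (ha.comp continuous_subtype_val) (fun k => k.2)
    obtain ⟨b', hb', hbb⟩ := exists_lift_inl (K := {k | (a k).isLeft})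
      (hb.comp continuous_subtype_val) (fun k => by
        have := h k.1
        have h2 := haa k
        simp only [Function.comp_apply] at h2 ⊢
        rw [h2] at this
        cases hb₀ : b k.1 with
        | inl y => rfl
        | inr y => simp [hb₀] at this)
    simp only [Function.comp_apply] at haa hbb
    have hc : ∀ k, X.tgt (a' k) = X.src (b' k) := fun k => by
      have := h k.1
      rw [haa, hbb] at this
      exact Sum.inl_injective this
    have key : ContinuousOn (fun k => sumConcat X Y (a k) (b k) (h k)) {k | (a k).isLeft} := by
      rw [continuousOn_iff_continuous_domRestrict]
      refine (continuous_inl.comp (X.continuous_concat_comp ha' hb' hc)).congr fun k => ?_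
      simp only [Function.comp_apply, Set.domRestrict_apply]
      have e : ∀ (x y) (hx : a k.1 = x) (hy : b k.1 = y)
          (h' : Sum.map X.tgt Y.tgt x = Sum.map X.src Y.src y),
          sumConcat X Y x y h' = sumConcat X Y (a k.1) (b k.1) (h k.1) := by
        rintro x y rfl rfl _; rfl
      exact e _ _ (haa k) (hbb k) (congrArg Sum.inl (hc k))
    exact key.continuousAt (hU.isOpen.mem_nhds hk)
  | inr x₀ =>
    have hU := isClopen_isRight ha
    have hk : k₀ ∈ {k | (a k).isRight} := by simp [ha₀]
    have : CompactSpace {k | (a k).isRight} :=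
      isCompact_iff_compactSpace.1 hU.isClosed.isCompact
    obtain ⟨a', ha', haa⟩ := exists_lift_inr (K := {k | (a k).isRight})
      (ha.comp continuous_subtype_val) (fun k => k.2)
    obtain ⟨b', hb', hbb⟩ := exists_lift_inr (K := {k | (a k).isRight})
      (hb.comp continuous_subtype_val) (fun k => by
        have := h k.1
        have h2 := haa k
        simp only [Function.comp_apply] at h2 ⊢
        rw [h2] at this
        cases hb₀ : b k.1 with
        | inr y => rfl
        | inl y => simp [hb₀] at this)
    simp only [Function.comp_apply] at haa hbb
    have hc : ∀ k, Y.tgt (a' k) = Y.src (b' k) := fun k => by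
      have := h k.1
      rw [haa, hbb] at this
      exact Sum.inr_injective this
    have key : ContinuousOn (fun k => sumConcat X Y (a k) (b k) (h k)) {k | (a k).isRight} := by
      rw [continuousOn_iff_continuous_domRestrict]
      refine (continuous_inr.comp (Y.continuous_concat_comp ha' hb' hc)).congr fun k => ?_
      simp only [Function.comp_apply, Set.domRestrict_apply]
      have e : ∀ (x y) (hx : a k.1 = x) (hy : b k.1 = y)
          (h' : Sum.map X.tgt Y.tgt x = Sum.map X.src Y.src y),
          sumConcat X Y x y h' = sumConcat X Y (a k.1) (b k.1) (h k.1) := by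
        rintro x y rfl rfl _; rfl
      exact e _ _ (haa k) (hbb k) (congrArg Sum.inr (hc k))
    exact key.continuousAt (hU.isOpen.mem_nhds hk)

/-- The disjoint union of two flows. -/
def sum (X Y : DirectedFlow.{u}) : DirectedFlow.{u} where
  states := X.states ⊕ Y.states
  paths := X.paths ⊕ Y.paths
  src := Sum.map X.src Y.src
  tgt := Sum.map X.tgt Y.tgt
  continuous_src := X.continuous_src.sumMap Y.continuous_src
  continuous_tgt := X.continuous_tgt.sumMap Y.continuous_tgt
  concat := sumConcat X Y
  continuous_concat := continuous_from_compactlyGenerated _ fun _ g =>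
    continuous_sumConcat X Y (continuous_fst.comp (continuous_subtype_val.comp g.continuous))
      (continuous_snd.comp (continuous_subtype_val.comp g.continuous)) fun k => (g k).2
  src_concat := by
    rintro (x | x) (y | y) h
    · simp [sumConcat, X.src_concat]
    · simp at h
    · simp at h
    · simp [sumConcat, Y.src_concat]
  tgt_concat := by
    rintro (x | x) (y | y) h
    · simp [sumConcat, X.tgt_concat]
    · simp at h
    · simp at h
    · simp [sumConcat, Y.tgt_concat]
  concat_assoc := by
    rintro (x | x) (y | y) (z | z) h h'
    · exact congrArg Sum.inl (X.concat_assoc x y z _ _)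
    · simp at h'
    · simp at h
    · simp at h
    · simp at h
    · simp at h
    · simp at h'
    · exact congrArg Sum.inr (Y.concat_assoc x y z _ _)

/-- The first inclusion. -/
def sumInl (X Y : DirectedFlow.{u}) : X ⟶ sum X Y where
  onStates := Sum.inl
  onPaths := ⟨Sum.inl, continuous_inl⟩
  src_onPaths _ := rfl
  tgt_onPaths _ := rfl
  map_concat _ _ _ := rfl

/-- The second inclusion. -/
def sumInr (X Y : DirectedFlow.{u}) : Y ⟶ sum X Y where
  onStates := Sum.inr
  onPaths := ⟨Sum.inr, continuous_inr⟩
  src_onPaths _ := rfl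
  tgt_onPaths _ := rfl
  map_concat _ _ _ := rfl

/-- The morphism out of a disjoint union given by two morphisms. -/
def sumDesc {X Y Z : DirectedFlow.{u}} (f : X ⟶ Z) (g : Y ⟶ Z) : sum X Y ⟶ Z where
  onStates := Sum.elim f.onStates g.onStates
  onPaths := ⟨Sum.elim f.onPaths g.onPaths, f.onPaths.continuous.sumElim g.onPaths.continuous⟩
  src_onPaths := by
    rintro (x | x)
    · exact f.src_onPaths x
    · exact g.src_onPaths x
  tgt_onPaths := by
    rintro (x | x)
    · exact f.tgt_onPaths x
    · exact g.tgt_onPaths x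
  map_concat := by
    rintro (x | x) (y | y) h
    · exact f.map_concat x y _
    · exact absurd h (by simp [sum])
    · exact absurd h (by simp [sum])
    · exact g.map_concat x y _

/-- The disjoint union is the coproduct. -/
def sumIsColimit (X Y : DirectedFlow.{u}) :
    Limits.IsColimit (Limits.BinaryCofan.mk (sumInl X Y) (sumInr X Y)) :=
  Limits.BinaryCofan.isColimitMk (fun s => sumDesc s.inl s.inr) (fun _ => rfl) (fun _ => rfl)
    (fun s m h₁ h₂ => by
      refine hom_ext ?_ ?_
      · rintro (x | x)
        · exact congrFun (congrArg Hom.onStates h₁) x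
        · exact congrFun (congrArg Hom.onStates h₂) x
      · rintro (x | x)
        · exact DFunLike.congr_fun (congrArg Hom.onPaths h₁) x
        · exact DFunLike.congr_fun (congrArg Hom.onPaths h₂) x)

instance : Limits.HasBinaryCoproducts DirectedFlow.{u} :=
  have (X Y : DirectedFlow.{u}) : Limits.HasColimit (Limits.pair X Y) := ⟨_, sumIsColimit X Y⟩
  Limits.hasBinaryCoproducts_of_hasColimit_pair _

/-! ### Left homotopy and S-homotopy -/

/-- `f ∼ₗ g`: the map `(f, g) : X ⨿ X ⟶ Y` extends to some `I`, where `X ⨿ X ⟶ I ⟶ X` is a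
factorization of the codiagonal as a cofibration followed by a trivial fibration. -/
def LeftHomotopic {X Y : DirectedFlow.{u}} (f g : X ⟶ Y) : Prop :=
  ∃ P : Cylinder X, P.IsVeryGood ∧ Nonempty (P.LeftHomotopy f g)

/-- Left homotopy equivalent flows. -/
def LeftHomotopyEquivalent (X Y : DirectedFlow.{u}) : Prop :=
  ∃ (f : X ⟶ Y) (g : Y ⟶ X), LeftHomotopic (g ≫ f) (𝟙 Y) ∧ LeftHomotopic (f ≫ g) (𝟙 X)

/-- The underlying space of a flow. -/
abbrev Space (X : DirectedFlow.{u}) : Type u := X.states ⊕ X.paths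

/-- The underlying map of a morphism of flows. -/
def toMap {X Y : DirectedFlow.{u}} (f : X ⟶ Y) : X.Space → Y.Space := Sum.map f.onStates f.onPaths

/-- `f` and `g` are S-homotopic: there is a continuous `H : [0,1] × X → Y` such that every
`H(u, -)` is a morphism of flows, `H(0, -) = f` and `H(1, -) = g`. As `[0,1]` is compact
Hausdorff, the product topology is already compactly generated. -/
def SHomotopic {X Y : DirectedFlow.{u}} (f g : X ⟶ Y) : Prop :=
  ∃ H : C(unitInterval × X.Space, Y.Space),
    (∀ t : unitInterval, ∃ h : X ⟶ Y, ∀ x, H (t, x) = toMap h x) ∧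
      (∀ x, H (0, x) = toMap f x) ∧ ∀ x, H (1, x) = toMap g x

/-- S-homotopy equivalent flows. -/
def SHomotopyEquivalent (X Y : DirectedFlow.{u}) : Prop :=
  ∃ (f : X ⟶ Y) (g : Y ⟶ X), SHomotopic (g ≫ f) (𝟙 Y) ∧ SHomotopic (f ≫ g) (𝟙 X)

end DirectedFlow

/-!
For a trivial fibration `π`, the paths `[0,1] → ℙY` that stay in a fibre of `ℙπ` form the path space
of a flow, and restriction to the endpoints is a trivial fibration from it to the flow of pairs of
paths with the same image. Hence two morphisms from a cofibrant flow that agree after composition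
with `π` are S-homotopic. Applied to the two inclusions `X ⟶ I(X)` and the projection
`I(X) ⟶ X`, this turns a left homotopy into an S-homotopy.

Conversely, an S-homotopy from `X` to `Y` is a morphism from `X` to the flow of paths in `ℙY`, and
evaluation at `0` is a trivial fibration from that flow to `Y`. Lifting against the cofibration
`X ⊔ X ⟶ I(X)` of a cylinder, with the constant homotopy on the first copy of `X` and the given one
on the second, and evaluating at `1` gives a left homotopy.

The cylinder is constructed by the small object argument: glue two copies of `X` along their states,
then attach cells along all lifting problems, repeatedly. Disks in the colimit factor through a
finite stage because attaching cells is a closed embedding on path spaces. To see this, replace the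
path spaces of the old flow `E` by their cones. The cone flow is trivially fibred over a codiscrete
flow, so the inclusion of `E` as the base of its cone, which is a closed embedding, extends along
the attachment of cells.
-/

/-! ### Relative lifting properties -/

theorem exists_continuousMap_glue {X Y : Type*} [TopologicalSpace X] [TopologicalSpace Y]
    {A B : Set X} (hA : IsClosed A) (hB : IsClosed B) (hAB : ∀ x, x ∈ A ∨ x ∈ B)
    (f : C(A, Y)) (g : C(B, Y)) (h : ∀ x (ha : x ∈ A) (hb : x ∈ B), f ⟨x, ha⟩ = g ⟨x, hb⟩) :
    ∃ k : C(X, Y), (∀ a : A, k a = f a) ∧ ∀ b : B, k b = g b := by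
  classical
  let k : X → Y := fun x => if ha : x ∈ A then f ⟨x, ha⟩ else g ⟨x, (hAB x).resolve_left ha⟩
  have hkA : ∀ a : A, k a = f a := fun a => by simp [k]
  have hkB : ∀ b : B, k b = g b := fun b => by
    by_cases hb : (b : X) ∈ A
    · simp [k, hb, h b hb b.2]
    · simp [k, hb]
  refine ⟨⟨k, ?_⟩, hkA, hkB⟩
  rw [← continuousOn_univ, ← Set.eq_univ_of_forall hAB]
  refine ContinuousOn.union_of_isClosed ?_ ?_ hA hB
  · exact continuousOn_iff_continuous_domRestrict.2 (f.continuous.congr fun a => (hkA a).symm)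
  · exact continuousOn_iff_continuous_domRestrict.2 (g.continuous.congr fun b => (hkB b).symm)

section HasRelLift

variable {K K' E B : Type*} [TopologicalSpace K] [TopologicalSpace K'] [TopologicalSpace E]
  [TopologicalSpace B]

/-- The inclusion `A ⊆ K` has the left lifting property with respect to `p`: every map `K → B`
with a prescribed lift to `E` over `A` has a lift extending the prescribed one. -/
def HasRelLift (A : Set K) (p : C(E, B)) : Prop :=
  ∀ (a : C(A, E)) (b : C(K, B)), (∀ x : A, p (a x) = b x) →
    ∃ l : C(K, E), (∀ x : A, l x = a x) ∧ ∀ x, p (l x) = b x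

/-- The subspace `{0} × K ∪ [0,1] × A` of the cylinder `[0,1] × K`. -/
def box (A : Set K) : Set (unitInterval × K) := {x | x.1 = 0 ∨ x.2 ∈ A}

/-- The subspace `{0,1} × K ∪ [0,1] × A` of the cylinder `[0,1] × K`. -/
def cylinderBoundary (A : Set K) : Set (unitInterval × K) := {x | x.1 = 0 ∨ x.1 = 1 ∨ x.2 ∈ A}

variable {A : Set K} {A' : Set K'} {p : C(E, B)}

theorem isClosed_box (hA : IsClosed A) : IsClosed (box A) :=
  (isClosed_eq continuous_fst continuous_const).union (hA.preimage continuous_snd)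

theorem HasRelLift.of_retract (h : HasRelLift A' p) (s : C(K, K')) (r : C(K', K))
    (hs : Set.MapsTo s A A') (hr : Set.MapsTo r A' A) (hrs : Function.LeftInverse r s) :
    HasRelLift A p := by
  intro a b hab
  obtain ⟨l, hla, hlb⟩ := h (a.comp ⟨hr.restrict, r.continuous.restrict hr⟩) (b.comp r)
    fun x => hab _
  refine ⟨l.comp s, fun x => (hla ⟨s x, hs x.2⟩).trans (congrArg a (Subtype.ext (hrs x))),
    fun x => (hlb (s x)).trans (congrArg b (hrs x))⟩

theorem HasRelLift.of_homeomorph (h : HasRelLift A' p) (e : K ≃ₜ K') (he : ∀ x, e x ∈ A' ↔ x ∈ A) :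
    HasRelLift A p :=
  h.of_retract e e.symm (fun x hx => (he x).2 hx)
    (fun y hy => (he _).1 ((e.apply_symm_apply y).symm ▸ hy)) e.symm_apply_apply

theorem HasRelLift.exists_homotopy_lift (h : HasRelLift (box A) p) (hA : IsClosed A)
    (a : C(unitInterval × A, E)) (b : C(unitInterval × K, B))
    (hab : ∀ t (x : A), p (a (t, x)) = b (t, x)) (l : C(K, E)) (hla : ∀ x : A, l x = a (0, x))
    (hlb : ∀ x, p (l x) = b (0, x)) :
    ∃ L : C(unitInterval × K, E), (∀ x, L (0, x) = l x) ∧ (∀ t (x : A), L (t, x) = a (t, x)) ∧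
      ∀ x, p (L x) = b x := by
  obtain ⟨f, hf₀, hfA⟩ := exists_continuousMap_glue (X := box A)
    (A := {x | x.1.1 = 0}) (B := {x | x.1.2 ∈ A})
    (isClosed_eq (by fun_prop) continuous_const) (hA.preimage (by fun_prop)) (fun x => x.2)
    ⟨fun x => l x.1.1.2, by fun_prop⟩ ⟨fun x => a (x.1.1.1, ⟨x.1.1.2, x.2⟩), by fun_prop⟩
    (by
      rintro ⟨⟨t, x⟩, -⟩ (rfl : t = 0) hx
      exact hla ⟨x, hx⟩)
  obtain ⟨L, hLf, hLb⟩ := h f b <| by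
    rintro ⟨⟨t, x⟩, ht | hx⟩
    · obtain rfl : t = 0 := ht
      rw [hf₀ ⟨_, rfl⟩]
      exact hlb x
    · rw [hfA ⟨_, hx⟩]
      exact hab t ⟨x, hx⟩
  exact ⟨L, fun x => (hLf ⟨(0, x), Or.inl rfl⟩).trans (hf₀ ⟨_, rfl⟩),
    fun t x => (hLf ⟨(t, x), Or.inr x.2⟩).trans (hfA ⟨_, x.2⟩), hLb⟩

theorem exists_continuousMap_cylinderBoundary {T : Type*} [TopologicalSpace T] (hA : IsClosed A)
    (f : C(T × (unitInterval × K), E)) (g : C(T × K, E))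
    (hfg : ∀ u, ∀ x ∈ A, f (u, (1, x)) = g (u, x)) :
    ∃ a : C(T × cylinderBoundary A, E), (∀ u (x : cylinderBoundary A), x.1 ∈ box A →
      a (u, x) = f (u, x)) ∧ ∀ u (x : cylinderBoundary A), x.1.1 = 1 → a (u, x) = g (u, x.1.2) := by
  obtain ⟨a, haf, hag⟩ := exists_continuousMap_glue (X := T × cylinderBoundary A)
    (A := {x | x.2.1 ∈ box A}) (B := {x | x.2.1.1 = 1}) ((isClosed_box hA).preimage (by fun_prop))
    (isClosed_eq (by fun_prop) continuous_const)
    (fun x => by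
      rcases x.2.2 with hx | hx | hx
      exacts [Or.inl (Or.inl hx), Or.inr hx, Or.inl (Or.inr hx)])
    ⟨fun x => f (x.1.1, x.1.2), by fun_prop⟩ ⟨fun x => g (x.1.1, x.1.2.1.2), by fun_prop⟩
    (by
      rintro ⟨u, ⟨t, x⟩, -⟩ ht (rfl : t = 1)
      exact hfg u x (ht.resolve_left one_ne_zero))
  exact ⟨a, fun u x hx => haf ⟨(u, x), hx⟩, fun u x hx => hag ⟨(u, x), hx⟩⟩

theorem HasRelLift.homotopicRel (h : HasRelLift (cylinderBoundary A) p) (hA : IsClosed A)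
    {f g : C(K, E)} (hfg : Set.EqOn f g A) (hpfg : (p.comp f).HomotopicRel (p.comp g) A) :
    f.HomotopicRel g A := by
  obtain ⟨H⟩ := hpfg
  obtain ⟨a, haf, hag⟩ := exists_continuousMap_cylinderBoundary (T := Unit) hA
    ⟨fun x => f x.2.2, by fun_prop⟩ ⟨fun x => g x.2, by fun_prop⟩ fun _ _ hx => hfg hx
  obtain ⟨L, hLa, -⟩ := h (a.comp ⟨fun x => ((), x), by fun_prop⟩) H.toContinuousMap <| by
    rintro ⟨⟨t, x⟩, ht | ht | hx⟩
    · obtain rfl : t = 0 := ht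
      exact (congrArg p (haf _ _ (Or.inl rfl))).trans (H.apply_zero x).symm
    · obtain rfl : t = 1 := ht
      exact (congrArg p (hag _ _ rfl)).trans (H.apply_one x).symm
    · exact (congrArg p (haf _ _ (Or.inr hx))).trans (H.eq_fst t hx).symm
  exact ⟨⟨⟨L, fun x => (hLa ⟨(0, x), Or.inl rfl⟩).trans (haf _ _ (Or.inl rfl)),
    fun x => (hLa ⟨(1, x), Or.inr (Or.inl rfl)⟩).trans (hag _ _ rfl)⟩,
    fun t x hx => (hLa ⟨(t, x), Or.inr (Or.inr hx)⟩).trans (haf _ _ (Or.inr hx))⟩⟩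

end HasRelLift

/-! ### Disks and cubes -/

/-- The closed unit ball of a normed space. -/
abbrev Disk (V : Type*) [NormedAddCommGroup V] : Type _ := Metric.closedBall (0 : V) 1

namespace Disk

section NormedAddCommGroup

variable {V : Type*} [NormedAddCommGroup V]

/-- The boundary sphere of the closed unit ball. -/
def bdry (V : Type*) [NormedAddCommGroup V] : Set (Disk V) := {x | ‖(x : V)‖ = 1}

theorem norm_le (x : Disk V) : ‖(x : V)‖ ≤ 1 := mem_closedBall_zero_iff.1 x.2

theorem isClosed_bdry : IsClosed (bdry V) :=
  isClosed_eq (continuous_norm.comp continuous_subtype_val) continuous_const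

theorem bdry_eq_empty [Subsingleton V] : bdry V = ∅ :=
  Set.eq_empty_of_forall_notMem fun x hx => by
    have : ‖(x : V)‖ = 1 := hx
    simp [Subsingleton.elim (x : V) 0] at this

/-- The unit ball of the sup norm on `ℝ × V` is a cylinder on the unit ball of `V`. -/
noncomputable def prodHomeomorph : Disk (ℝ × V) ≃ₜ unitInterval × Disk V where
  toFun x := (⟨((x : ℝ × V).1 + 1) / 2,
      have h := abs_le.1 (norm_prod_le_iff.1 (norm_le x)).1
      ⟨by linarith [h.1], by linarith [h.2]⟩⟩,
    ⟨(x : ℝ × V).2, mem_closedBall_zero_iff.2 (norm_prod_le_iff.1 (norm_le x)).2⟩)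
  invFun x := ⟨(2 * (x.1 : ℝ) - 1, (x.2 : V)), mem_closedBall_zero_iff.2 (norm_prod_le_iff.2
    ⟨abs_le.2 ⟨by linarith [x.1.2.1], by linarith [x.1.2.2]⟩, norm_le x.2⟩)⟩
  left_inv x := Subtype.ext (Prod.ext (by change 2 * (_ / 2) - 1 = _; ring) rfl)
  right_inv x := Prod.ext (Subtype.ext (by change (2 * _ - 1 + 1) / 2 = _; ring)) rfl
  continuous_toFun := Continuous.prodMk (Continuous.subtype_mk (by fun_prop) _)
    (Continuous.subtype_mk (by fun_prop) _)
  continuous_invFun := Continuous.subtype_mk (by fun_prop) _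

theorem prodHomeomorph_symm_mem_bdry (x : unitInterval × Disk V) :
    prodHomeomorph.symm x ∈ bdry (ℝ × V) ↔ x ∈ cylinderBoundary (bdry V) := by
  obtain ⟨t, y⟩ := x
  have ht : |2 * (t : ℝ) - 1| = 1 ↔ t = 0 ∨ t = 1 := by
    rw [abs_eq zero_le_one, or_comm, Subtype.ext_iff, Subtype.ext_iff]
    exact or_congr ⟨fun h => by simp only [Set.Icc.coe_zero]; linarith, fun h => by simp [h]⟩
      ⟨fun h => by simp only [Set.Icc.coe_one]; linarith, fun h => by simp [h]; norm_num⟩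
  have ht' : |2 * (t : ℝ) - 1| ≤ 1 := abs_le.2 ⟨by linarith [t.2.1], by linarith [t.2.2]⟩
  change max |2 * (t : ℝ) - 1| ‖(y : V)‖ = 1 ↔ t = 0 ∨ t = 1 ∨ ‖(y : V)‖ = 1
  rw [← or_assoc, ← ht, max_eq_iff]
  have := norm_le y
  constructor
  · rintro (h | h)
    exacts [Or.inl h.1, Or.inr h.1]
  · rintro (h | h)
    exacts [Or.inl ⟨h, h.symm ▸ this⟩, Or.inr ⟨h, h.symm ▸ ht'⟩]

/-- How far a point of the cylinder on a disk is from the box on its boundary sphere. -/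
noncomputable def boxHeight (x : unitInterval × Disk V) : unitInterval :=
  ⟨min (x.1 : ℝ) (2 * (1 - ‖(x.2 : V)‖)), le_min x.1.2.1 (by linarith [norm_le x.2]),
    (min_le_left _ _).trans x.1.2.2⟩

@[fun_prop]
theorem continuous_boxHeight : Continuous (boxHeight (V := V)) :=
  Continuous.subtype_mk (by fun_prop) _

theorem boxHeight_of_mem_box {x : unitInterval × Disk V} (h : x ∈ box (bdry V)) :
    boxHeight x = 0 := by
  refine Subtype.ext ?_
  rcases h with h | h
  · simpa [boxHeight, h] using norm_le x.2
  · have h' : ‖(x.2 : V)‖ = 1 := h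
    simpa [boxHeight, h'] using x.1.2.1

end NormedAddCommGroup

section Cube

variable {N : Type*} [Fintype N]

/-- The unit ball of the sup norm on `ℝ^N` is a cube. -/
noncomputable def cubeHomeomorph (N : Type*) [Fintype N] :
    Disk (N → ℝ) ≃ₜ (N → unitInterval) where
  toFun x i := ⟨(x.1 i + 1) / 2, by
    have := abs_le.1 ((norm_le_pi_norm x.1 i).trans (norm_le x))
    constructor <;> linarith [this.1, this.2]⟩
  invFun y := ⟨fun i => 2 * y i - 1, mem_closedBall_zero_iff.2
    ((pi_norm_le_iff_of_nonneg zero_le_one).2 fun i =>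
      abs_le.2 ⟨by linarith [(y i).2.1], by linarith [(y i).2.2]⟩)⟩
  left_inv x := Subtype.ext (funext fun i => by simp only; ring)
  right_inv y := funext fun i => Subtype.ext (by simp only; ring)
  continuous_toFun := continuous_pi fun i => Continuous.subtype_mk
    ((((continuous_apply i).comp continuous_subtype_val).add continuous_const).div_const 2) _
  continuous_invFun := Continuous.subtype_mk (by fun_prop) _

theorem cubeHomeomorph_mem_boundary (x : Disk (N → ℝ)) :
    cubeHomeomorph N x ∈ Cube.boundary N ↔ x ∈ bdry (N → ℝ) := by
  have hx (i : N) : cubeHomeomorph N x i = 0 ∨ cubeHomeomorph N x i = 1 ↔ ‖x.1 i‖ = 1 := by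
    rw [Real.norm_eq_abs, abs_eq zero_le_one, or_comm, Subtype.ext_iff, Subtype.ext_iff]
    change (x.1 i + 1) / 2 = (1 : ℝ) ∨ (x.1 i + 1) / 2 = (0 : ℝ) ↔ _
    exact or_congr ⟨fun h => by linarith, fun h => by linarith⟩
      ⟨fun h => by linarith, fun h => by linarith⟩
  refine (exists_congr hx).trans ⟨fun ⟨i, hi⟩ => ?_, fun h => ?_⟩
  · exact le_antisymm (norm_le x) (hi.symm.le.trans (norm_le_pi_norm x.1 i))
  · by_contra! hlt
    exact ((pi_norm_lt_iff zero_lt_one).2 fun i =>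
      ((norm_le_pi_norm x.1 i).trans (norm_le x)).lt_of_ne (hlt i)).ne h

end Cube

section NormedSpace

variable {V : Type*} [NormedAddCommGroup V] [NormedSpace ℝ V]

instance (V : Type*) [NormedAddCommGroup V] [NormedSpace ℝ V] : ContractibleSpace (Disk V) :=
  (convex_closedBall 0 1).contractibleSpace ⟨0, by simp⟩

theorem exists_homeomorph (V W : Type*) [NormedAddCommGroup V] [NormedSpace ℝ V]
    [FiniteDimensional ℝ V] [NormedAddCommGroup W] [NormedSpace ℝ W] [FiniteDimensional ℝ W]
    (h : Module.finrank ℝ V = Module.finrank ℝ W) :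
    ∃ e : Disk V ≃ₜ Disk W, ∀ x, e x ∈ bdry W ↔ x ∈ bdry V := by
  let e := (ContinuousLinearEquiv.ofFinrankEq h : V ≃L[ℝ] W)
  have hopen : IsOpen (e '' Metric.ball (0 : V) 1) :=
    e.toHomeomorph.isOpenMap _ Metric.isOpen_ball
  obtain ⟨k, -, hball, hsphere⟩ := exists_homeomorph_image_interior_closure_frontier_eq_unitBall
    (s := e '' Metric.ball (0 : V) 1)
    ((convex_ball (0 : V) 1).linear_image (e : V →ₗ[ℝ] W))
    (by rw [hopen.interior_eq]; exact ⟨0, 0, by simp, by simp⟩)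
    (e.toContinuousLinearMap.lipschitz.isBounded_image Metric.isBounded_ball)
  have hclosure : closure (e '' Metric.ball (0 : V) 1) = e '' Metric.closedBall 0 1 := by
    rw [← closure_ball (0 : V) one_ne_zero]
    exact (e.toHomeomorph.image_closure _).symm
  have hfrontier : frontier (e '' Metric.ball (0 : V) 1) = e '' Metric.sphere 0 1 := by
    rw [← frontier_ball (0 : V) one_ne_zero]
    exact (e.toHomeomorph.image_frontier _).symm
  rw [hclosure, Set.image_image] at hball
  rw [hfrontier, Set.image_image] at hsphere
  let m : V ≃ₜ W := e.toHomeomorph.trans k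
  have hm_ball (x : V) : x ∈ Metric.closedBall (0 : V) 1 ↔ m x ∈ Metric.closedBall (0 : W) 1 := by
    rw [← hball]
    exact (m.injective.mem_set_image (s := Metric.closedBall (0 : V) 1)).symm
  have hm_sphere (x : V) : m x ∈ Metric.sphere (0 : W) 1 ↔ x ∈ Metric.sphere (0 : V) 1 := by
    rw [← hsphere]
    exact m.injective.mem_set_image (s := Metric.sphere (0 : V) 1)
  exact ⟨m.subtype hm_ball, fun x => by simpa [bdry] using hm_sphere x⟩

/-- The radial retraction of a normed space onto its closed unit ball. -/
noncomputable def clip (v : V) : Disk V :=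
  ⟨(max ‖v‖ 1)⁻¹ • v, by
    have h : 0 < max ‖v‖ 1 := lt_max_of_lt_right one_pos
    rw [mem_closedBall_zero_iff, norm_smul, norm_inv, Real.norm_of_nonneg h.le,
      inv_mul_le_iff₀ h, mul_one]
    exact le_max_left _ _⟩

@[fun_prop]
theorem continuous_clip : Continuous (clip (V := V)) :=
  Continuous.subtype_mk (Continuous.smul (Continuous.inv₀ (by fun_prop)
    fun v => (lt_max_of_lt_right one_pos).ne') continuous_id) _

theorem coe_clip {v : V} (h : ‖v‖ ≤ 1) : (clip v : V) = v := by
  simp [clip, max_eq_right h]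

theorem clip_coe (x : Disk V) : clip (x : V) = x := Subtype.ext (coe_clip (norm_le x))

theorem clip_mem_bdry {v : V} (h : 1 ≤ ‖v‖) : clip v ∈ bdry V := by
  have : ‖v‖ ≠ 0 := by linarith
  simp [bdry, clip, max_eq_left h, norm_smul, this]

theorem clip_smul_of_mem_bdry {c : ℝ} (hc : 1 ≤ c) {x : Disk V} (hx : x ∈ bdry V) :
    clip (c • (x : V)) = x := by
  have hx' : ‖(x : V)‖ = 1 := hx
  have : 0 < c := one_pos.trans_le hc
  refine Subtype.ext ?_
  simp [clip, norm_smul, hx', abs_of_pos this, max_eq_left hc, smul_smul, this.ne']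

/-- The part of the central projection of `[0,1] × D` from `(2, 0)` onto the box that begins at
height `v`: points of height at most `v` do not move. -/
noncomputable def boxFlow (v : unitInterval) (x : unitInterval × Disk V) : unitInterval × Disk V :=
  (Set.projIcc 0 1 zero_le_one (2 + (1 + max 0 ((boxHeight x : ℝ) - v)) * (x.1 - 2)),
    clip ((1 + max 0 ((boxHeight x : ℝ) - v)) • (x.2 : V)))

theorem continuous_boxFlow :
    Continuous fun x : unitInterval × (unitInterval × Disk V) => boxFlow x.1 x.2 :=
  (continuous_projIcc.comp (by fun_prop)).prodMk (continuous_clip.comp (by fun_prop))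

theorem boxFlow_boxHeight (x : unitInterval × Disk V) : boxFlow (boxHeight x) x = x := by
  simp [boxFlow, clip_coe]

theorem boxFlow_zero_mem_box (x : unitInterval × Disk V) : boxFlow 0 x ∈ box (bdry V) := by
  have hflow : boxFlow 0 x = (Set.projIcc 0 1 zero_le_one (2 + (1 + (boxHeight x : ℝ)) * (x.1 - 2)),
      clip ((1 + (boxHeight x : ℝ)) • (x.2 : V))) := by
    simp [boxFlow, (boxHeight x).2.1]
  have ht₀ := x.1.2.1
  have ht₁ := x.1.2.2
  rw [hflow]
  rcases le_total (x.1 : ℝ) (2 * (1 - ‖(x.2 : V)‖)) with h | h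
  · refine Or.inl (Set.projIcc_of_le_left zero_le_one ?_)
    simp only [boxHeight, min_eq_left h]
    nlinarith
  · refine Or.inr (clip_mem_bdry ?_)
    rw [norm_smul, Real.norm_of_nonneg (by linarith [(boxHeight x).2.1])]
    simp only [boxHeight, min_eq_right h]
    nlinarith [norm_le x.2]

end NormedSpace

end Disk

/-- `A` is the boundary sphere of the `n`-dimensional disk `K`, up to homeomorphism. -/
def IsDiskBoundary {K : Type*} [TopologicalSpace K] (n : ℕ) (A : Set K) : Prop :=
  ∃ e : K ≃ₜ Disk (EuclideanSpace ℝ (Fin n)), ∀ x, e x ∈ Disk.bdry _ ↔ x ∈ A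

theorem Disk.isDiskBoundary_bdry (V : Type*) [NormedAddCommGroup V] [NormedSpace ℝ V]
    [FiniteDimensional ℝ V] : IsDiskBoundary (Module.finrank ℝ V) (Disk.bdry V) :=
  Disk.exists_homeomorph _ _ (by simp)

namespace IsDiskBoundary

variable {K K' : Type*} [TopologicalSpace K] [TopologicalSpace K'] {n : ℕ} {A : Set K}
  {A' : Set K'}

theorem of_homeomorph (hA : IsDiskBoundary n A) (e : K' ≃ₜ K) (he : ∀ x, e x ∈ A ↔ x ∈ A') :
    IsDiskBoundary n A' :=
  have ⟨d, hd⟩ := hA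
  ⟨e.trans d, fun x => (hd (e x)).trans (he x)⟩

theorem isClosed (hA : IsDiskBoundary n A) : IsClosed A := by
  obtain ⟨e, he⟩ := hA
  rw [← Set.ext he]
  exact Disk.isClosed_bdry.preimage e.continuous

theorem contractibleSpace (hA : IsDiskBoundary n A) : ContractibleSpace K :=
  have ⟨e, _⟩ := hA
  e.contractibleSpace

theorem eq_empty {A : Set K} (hA : IsDiskBoundary 0 A) : A = ∅ := by
  obtain ⟨e, he⟩ := hA
  exact (Set.ext he).symm.trans (by rw [Disk.bdry_eq_empty]; rfl)

theorem cylinderBoundary (hA : IsDiskBoundary n A) :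
    IsDiskBoundary (n + 1) (cylinderBoundary A) := by
  obtain ⟨e, he⟩ := hA
  have h := Disk.isDiskBoundary_bdry (ℝ × EuclideanSpace ℝ (Fin n))
  rw [Module.finrank_prod, Module.finrank_self, finrank_euclideanSpace_fin, add_comm] at h
  refine h.of_homeomorph
    (((Homeomorph.refl _).prodCongr e).trans Disk.prodHomeomorph.symm) fun x => ?_
  exact (Disk.prodHomeomorph_symm_mem_bdry _).trans
    (or_congr Iff.rfl (or_congr Iff.rfl (he x.2)))

theorem cube (n : ℕ) : IsDiskBoundary n (Cube.boundary (Fin n)) := by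
  have h := Disk.isDiskBoundary_bdry (Fin n → ℝ)
  rw [Module.finrank_fin_fun] at h
  refine h.of_homeomorph (Disk.cubeHomeomorph (Fin n)).symm fun x => ?_
  rw [← Disk.cubeHomeomorph_mem_boundary, Homeomorph.apply_symm_apply]

theorem exists_homeomorph (hA : IsDiskBoundary n A) (hA' : IsDiskBoundary n A') :
    ∃ e : K ≃ₜ K', ∀ x, e x ∈ A' ↔ x ∈ A := by
  obtain ⟨e, he⟩ := hA
  obtain ⟨e', he'⟩ := hA'
  exact ⟨e.trans e'.symm, fun x => by rw [← he, ← he']; simp⟩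

end IsDiskBoundary

/-! ### Serre fibrations and weak homotopy equivalences -/

section Serre

variable {E B : Type*} [TopologicalSpace E] [TopologicalSpace B]

/-- Serre fibrations: the continuous maps with the homotopy lifting property for disks. -/
def IsSerreFibration (p : C(E, B)) : Prop :=
  ∀ n : ℕ, HasRelLift {x : unitInterval × Disk (EuclideanSpace ℝ (Fin n)) | x.1 = 0} p

/-- Trivial Serre fibrations: the continuous maps with the right lifting property with respect to
the inclusions of spheres into disks. -/
def IsTrivialSerreFibration (p : C(E, B)) : Prop :=
  ∀ n : ℕ, HasRelLift (Disk.bdry (EuclideanSpace ℝ (Fin n))) p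

variable {K : Type*} [TopologicalSpace K] {n : ℕ} {A : Set K} {p : C(E, B)}

theorem IsTrivialSerreFibration.hasRelLift (hp : IsTrivialSerreFibration p)
    (hA : IsDiskBoundary n A) : HasRelLift A p :=
  have ⟨e, he⟩ := hA
  (hp n).of_homeomorph e he

theorem IsSerreFibration.hasRelLift_zero (hp : IsSerreFibration p) (V : Type*)
    [NormedAddCommGroup V] [NormedSpace ℝ V] [FiniteDimensional ℝ V] :
    HasRelLift {x : unitInterval × Disk V | x.1 = 0} p := by
  obtain ⟨e, -⟩ := Disk.isDiskBoundary_bdry V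
  exact (hp _).of_homeomorph ((Homeomorph.refl _).prodCongr e) fun _ => Iff.rfl

theorem IsSerreFibration.hasRelLift_box (hp : IsSerreFibration p) (hA : IsDiskBoundary n A) :
    HasRelLift (box A) p := by
  obtain ⟨e, he⟩ := hA
  have hcyl : HasRelLift
      {x : unitInterval × (unitInterval × Disk (EuclideanSpace ℝ (Fin n))) | x.1 = 0} p :=
    (hp.hasRelLift_zero (ℝ × EuclideanSpace ℝ (Fin n))).of_homeomorph
      ((Homeomorph.refl _).prodCongr Disk.prodHomeomorph.symm) fun _ => Iff.rfl
  have hbox : HasRelLift (box (Disk.bdry (EuclideanSpace ℝ (Fin n)))) p :=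
    hcyl.of_retract ⟨fun x => (Disk.boxHeight x, x), by fun_prop⟩
      ⟨fun x => Disk.boxFlow x.1 x.2, Disk.continuous_boxFlow⟩
      (fun x hx => Disk.boxHeight_of_mem_box hx)
      (by rintro ⟨_, x⟩ rfl; exact Disk.boxFlow_zero_mem_box x) Disk.boxFlow_boxHeight
  exact hbox.of_homeomorph ((Homeomorph.refl _).prodCongr e)
    fun x => or_congr Iff.rfl (he x.2)

theorem isSerreFibration_of_discreteTopology [DiscreteTopology B] (p : C(E, B)) :
    IsSerreFibration p := fun _ a b hab =>
  ⟨a.comp ⟨fun x => ⟨(0, x.2), rfl⟩, by fun_prop⟩,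
    fun x => congrArg a (Subtype.ext (Prod.ext x.2.symm rfl)),
    fun _ => (hab _).trans (PreconnectedSpace.constant inferInstance b.continuous)⟩

theorem IsSerreFibration.exists_lift_of_homotopy (hp : IsSerreFibration p)
    (hA : IsDiskBoundary n A) (a : C(unitInterval × A, E)) (b : C(unitInterval × K, B))
    (hab : ∀ t (x : A), p (a (t, x)) = b (t, x)) (l : C(K, E)) (hla : ∀ x : A, l x = a (0, x))
    (hlb : ∀ x, p (l x) = b (0, x)) :
    ∃ l' : C(K, E), (∀ x : A, l' x = a (1, x)) ∧ ∀ x, p (l' x) = b (1, x) :=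
  have ⟨L, _, hLa, hLb⟩ :=
    (hp.hasRelLift_box hA).exists_homotopy_lift hA.isClosed a b hab l hla hlb
  ⟨L.comp ⟨fun x => (1, x), by fun_prop⟩, hLa 1, fun x => hLb (1, x)⟩

theorem IsDiskBoundary.exists_homotopy_extension (hA : IsDiskBoundary n A)
    (a : C(unitInterval × A, E)) (f : C(K, E)) (hfa : ∀ x : A, f x = a (0, x)) :
    ∃ F : C(unitInterval × K, E), (∀ x, F (0, x) = f x) ∧ ∀ t (x : A), F (t, x) = a (t, x) :=
  have ⟨F, hF₀, hFa, _⟩ := ((isSerreFibration_of_discreteTopology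
    (ContinuousMap.const E ())).hasRelLift_box hA).exists_homotopy_lift
    hA.isClosed a (ContinuousMap.const _ ()) (fun _ _ => rfl) f hfa fun _ => rfl
  ⟨F, hF₀, hFa⟩

theorem IsDiskBoundary.exists_extension_of_homotopy (hA : IsDiskBoundary n A)
    (a : C(unitInterval × A, E)) (f : C(K, E)) (hfa : ∀ x : A, f x = a (0, x)) :
    ∃ f' : C(K, E), ∀ x : A, f' x = a (1, x) :=
  have ⟨F, _, hFa⟩ := hA.exists_homotopy_extension a f hfa
  ⟨F.comp ⟨fun x => (1, x), by fun_prop⟩, hFa 1⟩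

theorem IsDiskBoundary.homotopicRel_of_homotopy (hA : IsDiskBoundary n A)
    (F G : C(unitInterval × K, E)) (hFG : ∀ t, ∀ x ∈ A, F (t, x) = G (t, x))
    (h₀ : (F.comp ⟨fun x => (0, x), by fun_prop⟩).HomotopicRel
      (G.comp ⟨fun x => (0, x), by fun_prop⟩) A) :
    (F.comp ⟨fun x => (1, x), by fun_prop⟩).HomotopicRel
      (G.comp ⟨fun x => (1, x), by fun_prop⟩) A := by
  obtain ⟨H⟩ := h₀
  obtain ⟨a, haF, haG⟩ := exists_continuousMap_cylinderBoundary hA.isClosed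
    (F.comp ⟨fun x : unitInterval × (unitInterval × K) => (x.1, x.2.2), by fun_prop⟩) G hFG
  obtain ⟨L, hL⟩ := hA.cylinderBoundary.exists_extension_of_homotopy a H.toContinuousMap <| by
    rintro ⟨⟨t, x⟩, ht | ht | hx⟩
    · obtain rfl : t = 0 := ht
      exact (H.apply_zero x).trans (haF 0 ⟨(0, x), Or.inl rfl⟩ (Or.inl rfl)).symm
    · obtain rfl : t = 1 := ht
      exact (H.apply_one x).trans (haG 0 ⟨(1, x), Or.inr (Or.inl rfl)⟩ rfl).symm
    · exact (H.eq_fst t hx).trans (haF 0 ⟨(t, x), Or.inr (Or.inr hx)⟩ (Or.inr hx)).symm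
  exact ⟨⟨⟨L, fun x => (hL ⟨(0, x), Or.inl rfl⟩).trans (haF _ _ (Or.inl rfl)),
    fun x => (hL ⟨(1, x), Or.inr (Or.inl rfl)⟩).trans (haG _ _ rfl)⟩,
    fun t x hx => (hL ⟨(t, x), Or.inr (Or.inr hx)⟩).trans (haF _ _ (Or.inr hx))⟩⟩

theorem exists_contraction (K : Type*) [TopologicalSpace K] [ContractibleSpace K] :
    ∃ (x₀ : K) (c : C(unitInterval × K, K)), (∀ x, c (0, x) = x₀) ∧ ∀ x, c (1, x) = x := by
  obtain ⟨x₀, ⟨c⟩⟩ := id_nullhomotopic K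
  exact ⟨x₀, c.symm.toContinuousMap, c.symm.apply_zero, c.symm.apply_one⟩

theorem Disk.exists_retract_cylinderBoundary (V : Type*) [NormedAddCommGroup V]
    [NormedSpace ℝ V] :
    ∃ i r : C(unitInterval × Disk V, unitInterval × Disk V),
      Set.MapsTo i {x | x.1 = 0} (cylinderBoundary (Disk.bdry V)) ∧
        Set.MapsTo r (cylinderBoundary (Disk.bdry V)) {x | x.1 = 0} ∧ Function.LeftInverse r i := by
  refine ⟨⟨fun x => (⟨(x.1 : ℝ) / 2, by linarith [x.1.2.1], by linarith [x.1.2.2]⟩,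
      Disk.clip ((1 / 2 : ℝ) • (x.2 : V))), by fun_prop⟩,
    ⟨fun x => (Set.projIcc 0 1 zero_le_one ((1 - |2 * (x.1 : ℝ) - 1|) *
        min 1 (2 * (1 - ‖(x.2 : V)‖))), Disk.clip ((2 : ℝ) • (x.2 : V))),
      (continuous_projIcc.comp (by fun_prop)).prodMk (by fun_prop)⟩, ?_, ?_, ?_⟩
  · rintro ⟨t, x⟩ (rfl : t = 0)
    exact Or.inl (Subtype.ext (zero_div _))
  · rintro ⟨t, x⟩ hx
    refine Set.projIcc_of_le_left zero_le_one (le_of_eq ?_)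
    rcases hx with hx | hx | hx
    · obtain rfl : t = 0 := hx
      simp
    · obtain rfl : t = 1 := hx
      norm_num
    · have hx' : ‖(x : V)‖ = 1 := hx
      simp [hx']
  · rintro ⟨t, x⟩
    have hx := Disk.norm_le x
    have hhalf : ‖(1 / 2 : ℝ) • (x : V)‖ ≤ 1 / 2 := by
      rw [norm_smul, Real.norm_of_nonneg (by norm_num)]
      linarith
    have hclip : (Disk.clip ((1 / 2 : ℝ) • (x : V)) : V) = (1 / 2 : ℝ) • (x : V) :=
      Disk.coe_clip (by linarith)
    have ht : 1 - |2 * ((t : ℝ) / 2) - 1| = t := by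
      rw [abs_of_nonpos (by linarith [t.2.2])]
      ring
    simp only [ContinuousMap.coe_mk, hclip, ht]
    rw [min_eq_left (by linarith), mul_one, Set.projIcc_val, smul_smul,
      show (2 : ℝ) * (1 / 2) = 1 by norm_num, one_smul, Disk.clip_coe]

theorem IsTrivialSerreFibration.isSerreFibration (hp : IsTrivialSerreFibration p) :
    IsSerreFibration p := fun n =>
  have ⟨i, r, hi, hr, hri⟩ := Disk.exists_retract_cylinderBoundary (EuclideanSpace ℝ (Fin n))
  (hp.hasRelLift (Disk.isDiskBoundary_bdry _).cylinderBoundary).of_retract i r hi hr hri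

end Serre

section WeakHomotopyEquivalence

open DirectedFlow

variable {E B : Type u} [TopologicalSpace E] [TopologicalSpace B] {p : C(E, B)}

theorem IsTrivialSerreFibration.joined (hp : IsTrivialSerreFibration p) {x y : E}
    (h : Joined (p x) (p y)) : Joined x y := by
  have hxy := (hp.hasRelLift (IsDiskBoundary.cube 0).cylinderBoundary).homotopicRel
    (IsDiskBoundary.cube 0).isClosed (f := .const _ x) (g := .const _ y)
    (by rw [(IsDiskBoundary.cube 0).eq_empty]; exact Set.eqOn_empty _ _)
    (by
      rw [(IsDiskBoundary.cube 0).eq_empty, ContinuousMap.homotopicRel_empty]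
      exact ContinuousMap.homotopic_const_iff.2 h)
  exact ContinuousMap.homotopic_const_iff.1 hxy.homotopic

theorem IsTrivialSerreFibration.surjective (hp : IsTrivialSerreFibration p) :
    Function.Surjective p := by
  intro b
  have h := IsDiskBoundary.cube 0
  obtain ⟨l, -, hl⟩ := hp.hasRelLift h ⟨fun x => (h.eq_empty.le x.2).elim, continuous_of_const
    fun x => (h.eq_empty.le x.2).elim⟩ (.const _ b) fun x => (h.eq_empty.le x.2).elim
  exact ⟨l default, hl _⟩

theorem IsTrivialSerreFibration.isWeakHomotopyEquivalence (hp : IsTrivialSerreFibration p) :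
    IsWeakHomotopyEquivalence p := by
  refine ⟨⟨?_, ?_⟩, fun n _ e => ⟨?_, ?_⟩⟩
  · rintro ⟨x⟩ ⟨y⟩ h
    exact Quotient.sound (hp.joined (Quotient.exact h))
  · rintro ⟨b⟩
    obtain ⟨x, rfl⟩ := hp.surjective b
    exact ⟨⟦x⟧, rfl⟩
  · rintro ⟨γ⟩ ⟨δ⟩ h
    exact Quotient.sound ((hp.hasRelLift (IsDiskBoundary.cube n).cylinderBoundary).homotopicRel
      (IsDiskBoundary.cube n).isClosed (fun x hx => (γ.2 x hx).trans (δ.2 x hx).symm)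
      (Quotient.exact h))
  · rintro ⟨β⟩
    obtain ⟨l, hl, hlβ⟩ := hp.hasRelLift (IsDiskBoundary.cube n) (.const _ e) β.1
      fun x => (β.2 x x.2).symm
    exact ⟨⟦⟨l, fun x hx => hl ⟨x, hx⟩⟩⟧,
      congrArg (Quotient.mk _) (Subtype.ext (ContinuousMap.ext hlβ))⟩

namespace DirectedFlow.IsWeakHomotopyEquivalence

theorem joined (hw : IsWeakHomotopyEquivalence p) {x y : E} (h : Joined (p x) (p y)) :
    Joined x y :=
  Quotient.exact (hw.1.1 (a₁ := ⟦x⟧) (a₂ := ⟦y⟧) (Quotient.sound h))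

theorem exists_joined (hw : IsWeakHomotopyEquivalence p) (b : B) : ∃ x, Joined (p x) b := by
  obtain ⟨⟨x⟩, hx⟩ := hw.1.2 ⟦b⟧
  exact ⟨x, Quotient.exact hx⟩

theorem homotopicRel_const (hw : IsWeakHomotopyEquivalence p) (n : ℕ)
    {γ : C(Fin n → unitInterval, E)} {e : E} (hγ : ∀ x ∈ Cube.boundary (Fin n), γ x = e)
    (hpγ : ∀ x, p (γ x) = p e) :
    γ.HomotopicRel (.const _ e) (Cube.boundary (Fin n)) := by
  obtain rfl | hn := Nat.eq_zero_or_pos n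
  · rw [(IsDiskBoundary.cube 0).eq_empty, ContinuousMap.homotopicRel_empty]
    have hγ' : γ = .const _ (γ default) :=
      ContinuousMap.ext fun x => congrArg γ (Subsingleton.elim _ _)
    rw [hγ', ContinuousMap.homotopic_const_iff]
    exact hw.joined (hpγ _ ▸ Joined.refl _)
  · have h : mapHomotopyGroup p n e ⟦⟨γ, hγ⟩⟧ =
        mapHomotopyGroup p n e ⟦⟨.const _ e, fun _ _ => rfl⟩⟧ :=
      congrArg (Quotient.mk _) (Subtype.ext (ContinuousMap.ext hpγ))
    exact Quotient.exact ((hw.2 n hn e).1 h)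

theorem exists_homotopicRel (hw : IsWeakHomotopyEquivalence p) {n : ℕ} (hn : 1 ≤ n) (e : E)
    {β : C(Fin n → unitInterval, B)} (hβ : ∀ x ∈ Cube.boundary (Fin n), β x = p e) :
    ∃ γ : C(Fin n → unitInterval, E), (∀ x ∈ Cube.boundary (Fin n), γ x = e) ∧
      (p.comp γ).HomotopicRel β (Cube.boundary (Fin n)) := by
  obtain ⟨⟨γ⟩, hγ⟩ := (hw.2 n hn e).2 ⟦⟨β, hβ⟩⟧
  exact ⟨γ.1, γ.2, Quotient.exact hγ⟩

end DirectedFlow.IsWeakHomotopyEquivalence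

namespace IsSerreFibration

variable {K : Type*} [TopologicalSpace K] {n : ℕ} {A : Set K}

theorem homotopicRel_of_comp_eq (hp : IsSerreFibration p) (hw : IsWeakHomotopyEquivalence p)
    (n : ℕ) {f g : C(Fin n → unitInterval, E)} (hfg : Set.EqOn f g (Cube.boundary (Fin n)))
    (hpfg : ∀ x, p (f x) = p (g x)) : f.HomotopicRel g (Cube.boundary (Fin n)) := by
  have hA := IsDiskBoundary.cube n
  have := hA.contractibleSpace
  obtain ⟨x₀, c, hc₀, hc₁⟩ := exists_contraction (Fin n → unitInterval)
  let F : C(unitInterval × (Fin n → unitInterval), E) := f.comp c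
  let σ : C(unitInterval × (Fin n → unitInterval), unitInterval × (Fin n → unitInterval)) :=
    ⟨fun x => (unitInterval.symm x.1, x.2), by fun_prop⟩
  obtain ⟨G, hG₀, hGA, hpG⟩ := (hp.hasRelLift_box hA).exists_homotopy_lift hA.isClosed
    ((F.comp σ).comp ⟨fun x => (x.1, x.2), by fun_prop⟩) (p.comp (F.comp σ)) (fun _ _ => rfl) g
    (fun x => by simp [F, σ, hc₁, hfg x.2]) (fun x => by simp [F, σ, hc₁, hpfg])
  have hFG : ∀ t, ∀ x ∈ Cube.boundary (Fin n), F (t, x) = (G.comp σ) (t, x) := fun t x hx => by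
    simpa [σ] using (hGA (unitInterval.symm t) ⟨x, hx⟩).symm
  have hF₁ : F.comp ⟨fun x => (1, x), by fun_prop⟩ = f := by
    ext x
    exact congrArg f (hc₁ x)
  have hG₁ : (G.comp σ).comp ⟨fun x => (1, x), by fun_prop⟩ = g := by
    ext x
    simpa [σ] using hG₀ x
  have hF₀ : F.comp ⟨fun x => (0, x), by fun_prop⟩ = .const _ (f x₀) := by
    ext x
    exact congrArg f (hc₀ x)
  have h := hA.homotopicRel_of_homotopy F (G.comp σ) hFG <| by
    rw [hF₀]
    refine (hw.homotopicRel_const n (fun x hx => ?_) fun x => ?_).symm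
    · exact (hFG 0 x hx).symm.trans (congrArg f (hc₀ x))
    · simpa [σ, F, hc₀] using hpG (1, x)
  rwa [hF₁, hG₁] at h

theorem exists_extension_cylinderBoundary (hp : IsSerreFibration p)
    (hw : IsWeakHomotopyEquivalence p) (a : C(cylinderBoundary (Cube.boundary (Fin n)), E))
    (b : C(unitInterval × (Fin n → unitInterval), B)) (hab : ∀ x, p (a x) = b x) :
    ∃ f : C(unitInterval × (Fin n → unitInterval), E), ∀ x, f x.1 = a x := by
  have hA := IsDiskBoundary.cube n
  have hbox : box (Cube.boundary (Fin n)) ⊆ cylinderBoundary _ := fun x hx => hx.imp_right Or.inr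
  obtain ⟨l, hla, hlb⟩ := hp.hasRelLift_box hA
    (a.comp ⟨Set.inclusion hbox, continuous_inclusion hbox⟩) b fun _ => hab _
  let top : C(Fin n → unitInterval, cylinderBoundary (Cube.boundary (Fin n))) :=
    ⟨fun x => ⟨(1, x), Or.inr (Or.inl rfl)⟩, by fun_prop⟩
  obtain ⟨H⟩ := hp.homotopicRel_of_comp_eq hw n
    (f := l.comp ⟨fun x => (1, x), by fun_prop⟩) (g := a.comp top)
    (fun x hx => hla ⟨(1, x), Or.inr hx⟩) fun x => (hlb _).trans (hab (top x)).symm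
  obtain ⟨α, hαl, hαH⟩ := exists_continuousMap_cylinderBoundary hA.isClosed
    (l.comp ⟨fun x : unitInterval × (unitInterval × (Fin n → unitInterval)) => x.2, by fun_prop⟩)
    H.toContinuousMap fun t x hx => (H.eq_fst t hx).symm
  obtain ⟨f, hf⟩ := hA.cylinderBoundary.exists_extension_of_homotopy α l <| by
    rintro ⟨⟨t, x⟩, ht | ht | hx⟩
    · exact (hαl 0 ⟨(t, x), _⟩ (Or.inl ht)).symm
    · obtain rfl : t = 1 := ht
      exact ((hαH 0 ⟨(1, x), _⟩ rfl).trans (H.apply_zero x)).symm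
    · exact (hαl 0 ⟨(t, x), _⟩ (Or.inr hx)).symm
  refine ⟨f, ?_⟩
  rintro ⟨⟨t, x⟩, ht | ht | hx⟩
  · exact (hf _).trans ((hαl 1 _ (Or.inl ht)).trans (hla ⟨(t, x), Or.inl ht⟩))
  · obtain rfl : t = 1 := ht
    exact (hf _).trans ((hαH 1 _ rfl).trans (H.apply_one x))
  · exact (hf _).trans ((hαl 1 _ (Or.inr hx)).trans (hla ⟨(t, x), Or.inr hx⟩))

theorem exists_extension (hp : IsSerreFibration p) (hw : IsWeakHomotopyEquivalence p)
    (hA : IsDiskBoundary (n + 1) A) (a : C(A, E)) (b : C(K, B)) (hab : ∀ x : A, p (a x) = b x) :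
    ∃ f : C(K, E), ∀ x : A, f x = a x := by
  obtain ⟨e, he⟩ := hA.exists_homeomorph (IsDiskBoundary.cube n).cylinderBoundary
  have hmaps : Set.MapsTo e.symm (cylinderBoundary (Cube.boundary (Fin n))) A :=
    fun x hx => (he _).1 (by rwa [e.apply_symm_apply])
  obtain ⟨f, hf⟩ := hp.exists_extension_cylinderBoundary hw
    (a.comp ⟨hmaps.restrict, e.symm.continuous.restrict hmaps⟩) (b.comp e.symm) fun _ => hab _
  exact ⟨f.comp e, fun x => (hf ⟨e x, (he x).2 x.2⟩).trans
    (congrArg a (Subtype.ext (e.symm_apply_apply x)))⟩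

theorem exists_lift_of_const (hp : IsSerreFibration p) (hw : IsWeakHomotopyEquivalence p)
    (hn : 1 ≤ n) (hA : IsDiskBoundary n A) (e : E) (b : C(K, B)) (hb : ∀ x ∈ A, b x = p e) :
    ∃ l : C(K, E), (∀ x ∈ A, l x = e) ∧ ∀ x, p (l x) = b x := by
  obtain ⟨d, hd⟩ := hA.exists_homeomorph (IsDiskBoundary.cube n)
  obtain ⟨γ, hγ, ⟨H⟩⟩ := hw.exists_homotopicRel hn e (β := b.comp d.symm)
    fun x hx => hb _ ((hd _).1 ((d.apply_symm_apply x).symm ▸ hx))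
  obtain ⟨l, hle, hlb⟩ := hp.exists_lift_of_homotopy (IsDiskBoundary.cube n) (.const _ e)
    H.toContinuousMap (fun t x => ((H.eq_fst t x.2).trans (congrArg p (hγ x x.2))).symm) γ
    (fun x => hγ x x.2) fun x => (H.apply_zero x).symm
  refine ⟨l.comp d, fun x hx => hle ⟨d x, (hd x).2 hx⟩, fun x => ?_⟩
  exact (hlb (d x)).trans ((H.apply_one _).trans (congrArg b (d.symm_apply_apply x)))

theorem exists_lift_of_extension (hp : IsSerreFibration p) (hw : IsWeakHomotopyEquivalence p)
    (hn : 1 ≤ n) (hA : IsDiskBoundary n A) (f : C(K, E)) (b : C(K, B))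
    (hfb : ∀ x ∈ A, p (f x) = b x) :
    ∃ l : C(K, E), (∀ x ∈ A, l x = f x) ∧ ∀ x, p (l x) = b x := by
  have := hA.contractibleSpace
  obtain ⟨x₀, c, hc₀, hc₁⟩ := exists_contraction K
  let F : C(unitInterval × A, E) := f.comp (c.comp ⟨fun x => (x.1, x.2), by fun_prop⟩)
  let σ {Z : Type _} [TopologicalSpace Z] : C(unitInterval × Z, unitInterval × Z) :=
    ⟨fun x => (unitInterval.symm x.1, x.2), by fun_prop⟩
  obtain ⟨b', hb'₀, hb'A⟩ := hA.exists_homotopy_extension (p.comp (F.comp σ)) b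
    fun x => by simp [F, σ, hc₁, hfb x x.2]
  have hF₀ (x : A) : F (0, x) = f x₀ := congrArg f (hc₀ x)
  obtain ⟨l₀, hl₀, hpl₀⟩ := hp.exists_lift_of_const hw hn hA (f x₀)
    (b'.comp ⟨fun x => (1, x), by fun_prop⟩)
    fun x hx => by simpa [σ, hF₀] using hb'A 1 ⟨x, hx⟩
  obtain ⟨l, hlF, hlb⟩ := hp.exists_lift_of_homotopy hA F (b'.comp σ)
    (fun t x => by simpa [σ] using (hb'A (unitInterval.symm t) x).symm) l₀
    (fun x => (hl₀ x x.2).trans (hF₀ x).symm) fun x => by simpa [σ] using hpl₀ x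
  refine ⟨l, fun x hx => (hlF ⟨x, hx⟩).trans (congrArg f (hc₁ x)), fun x => ?_⟩
  exact (hlb x).trans (by simpa [σ] using hb'₀ x)

theorem exists_lift_of_contractible (hp : IsSerreFibration p) (hw : IsWeakHomotopyEquivalence p)
    (hA : IsDiskBoundary 0 A) (b : C(K, B)) : ∃ l : C(K, E), ∀ x, p (l x) = b x := by
  have := hA.contractibleSpace
  obtain ⟨x₀, c, hc₀, hc₁⟩ := exists_contraction K
  obtain ⟨e, he⟩ := hw.exists_joined (b x₀)
  have hconst : (ContinuousMap.const K (p e)).Homotopic b :=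
    (ContinuousMap.homotopic_const_iff.2 he).trans
      ⟨⟨b.comp c, fun x => congrArg b (hc₀ x), fun x => congrArg b (hc₁ x)⟩⟩
  obtain ⟨H⟩ := hconst
  obtain ⟨l, -, hl⟩ := hp.exists_lift_of_homotopy hA
    ((ContinuousMap.const K e).comp ⟨fun x => x.2.1, by fun_prop⟩) H.toContinuousMap
    (fun _ x => (hA.eq_empty.le x.2).elim) (.const K e) (fun _ => rfl)
    fun x => (H.apply_zero x).symm
  exact ⟨l, fun x => (hl x).trans (H.apply_one x)⟩

theorem isTrivialSerreFibration (hp : IsSerreFibration p) (hw : IsWeakHomotopyEquivalence p) :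
    IsTrivialSerreFibration p := by
  rintro (_ | n) a b hab
  · have h : IsDiskBoundary 0 (Disk.bdry (EuclideanSpace ℝ (Fin 0))) :=
      ⟨.refl _, fun _ => Iff.rfl⟩
    obtain ⟨l, hl⟩ := hp.exists_lift_of_contractible hw h b
    exact ⟨l, fun x => (h.eq_empty.le x.2).elim, hl⟩
  · have h : IsDiskBoundary (n + 1) (Disk.bdry (EuclideanSpace ℝ (Fin (n + 1)))) :=
      ⟨.refl _, fun _ => Iff.rfl⟩
    obtain ⟨f, hf⟩ := hp.exists_extension hw h a b hab
    obtain ⟨l, hl, hlb⟩ := hp.exists_lift_of_extension hw n.succ_pos h f b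
      fun x hx => (congrArg p (hf ⟨x, hx⟩)).trans (hab _)
    exact ⟨l, fun x => (hl x x.2).trans (hf x), hlb⟩

end IsSerreFibration

theorem isTrivialSerreFibration_iff :
    IsTrivialSerreFibration p ↔ IsSerreFibration p ∧ IsWeakHomotopyEquivalence p :=
  ⟨fun hp => ⟨hp.isSerreFibration, hp.isWeakHomotopyEquivalence⟩,
    fun h => h.1.isTrivialSerreFibration h.2⟩

end WeakHomotopyEquivalence

/-! ### Fibrations and trivial fibrations of flows -/

theorem hasLiftingProperty_iff_hasRelLift {Z W E B : Type u} [TopologicalSpace Z]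
    [TopologicalSpace W] [TopologicalSpace E] [TopologicalSpace B] {K : Type*}
    [TopologicalSpace K] {A : Set K} (j : C(Z, W)) (p : C(E, B)) (e₀ : Z ≃ₜ A) (e : W ≃ₜ K)
    (h : ∀ z, e (j z) = e₀ z) :
    HasLiftingProperty (TopCat.ofHom j) (TopCat.ofHom p) ↔ HasRelLift A p := by
  refine ⟨fun hj a b hab => ?_, fun hp => ⟨fun {a b} sq => ?_⟩⟩
  · have sq : CommSq (TopCat.ofHom (a.comp (e₀ : C(Z, A)))) (TopCat.ofHom j) (TopCat.ofHom p)
        (TopCat.ofHom (b.comp (e : C(W, K)))) :=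
      ⟨TopCat.ext fun z => (hab (e₀ z)).trans (congrArg b (h z)).symm⟩
    refine ⟨sq.lift.hom.comp (e.symm : C(K, W)), fun x => ?_, fun x => ?_⟩
    · obtain ⟨z, rfl⟩ := e₀.surjective x
      rw [← h z]
      exact (congrArg sq.lift (e.symm_apply_apply (j z))).trans
        (ConcreteCategory.congr_hom sq.fac_left z)
    · exact (ConcreteCategory.congr_hom sq.fac_right (e.symm x)).trans
        (congrArg b (e.apply_symm_apply x))
  · obtain ⟨l, hla, hlb⟩ := hp (a.hom.comp (e₀.symm : C(A, Z))) (b.hom.comp (e.symm : C(K, W)))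
      fun x => (ConcreteCategory.congr_hom sq.w (e₀.symm x)).trans <| congrArg b <|
        e.injective <| (h _).trans <| (congrArg Subtype.val (e₀.apply_symm_apply x)).trans
          (e.apply_symm_apply _).symm
    refine ⟨⟨⟨TopCat.ofHom (l.comp (e : C(W, K))), TopCat.ext fun z => ?_,
      TopCat.ext fun w => ?_⟩⟩⟩
    · exact (congrArg l (h z)).trans ((hla (e₀ z)).trans (congrArg a (e₀.symm_apply_apply z)))
    · exact (hlb (e w)).trans (congrArg b (e.symm_apply_apply w))

namespace DirectedFlow

section Glob

variable {X Y : DirectedFlow.{u}}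

theorem onStates_congr {f g : X ⟶ Y} (h : f = g) (x : X.states) : f.onStates x = g.onStates x := by
  rw [h]

theorem onPaths_congr {f g : X ⟶ Y} (h : f = g) (x : X.paths) : f.onPaths x = g.onPaths x := by
  rw [h]

theorem src_apply_eq (X : DirectedFlow.{u}) {Z : Type*} [TopologicalSpace Z] [PreconnectedSpace Z]
    (f : C(Z, X.paths)) (z z' : Z) : X.src (f z) = X.src (f z') :=
  PreconnectedSpace.constant inferInstance (X.continuous_src.comp f.continuous)

theorem tgt_apply_eq (X : DirectedFlow.{u}) {Z : Type*} [TopologicalSpace Z] [PreconnectedSpace Z]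
    (f : C(Z, X.paths)) (z z' : Z) : X.tgt (f z) = X.tgt (f z') :=
  PreconnectedSpace.constant inferInstance (X.continuous_tgt.comp f.continuous)

variable {Z W : Type u} [TopologicalSpace Z] [CompactlyGeneratedSpace Z] [WeakHausdorffSpace Z]
  [TopologicalSpace W] [CompactlyGeneratedSpace W] [WeakHausdorffSpace W]

/-- The morphism out of a globe determined by a family of paths with source `a` and target `b`. -/
def globDesc (a b : X.states) (f : C(Z, X.paths)) (ha : ∀ z, X.src (f z) = a)
    (hb : ∀ z, X.tgt (f z) = b) : glob Z ⟶ X where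
  onStates i := if i.down = 0 then a else b
  onPaths := f
  src_onPaths z := (ha z).trans (if_pos rfl).symm
  tgt_onPaths z := (hb z).trans (if_neg (Fin.zero_ne_one.symm)).symm
  map_concat _ _ h := absurd (congrArg ULift.down h) Fin.zero_ne_one.symm

theorem glob_hom_ext {f g : glob Z ⟶ X} (h₀ : f.onStates ⟨0⟩ = g.onStates ⟨0⟩)
    (h₁ : f.onStates ⟨1⟩ = g.onStates ⟨1⟩) (h : ∀ z : Z, f.onPaths z = g.onPaths z) : f = g := by
  refine hom_ext ?_ h
  rintro ⟨i⟩
  fin_cases i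
  · exact h₀
  · exact h₁

variable {p : X ⟶ Y}

theorem hasLiftingProperty_globMap_of_injective (j : C(Z, W)) (hp : Function.Injective p.onStates)
    (hj : HasLiftingProperty (TopCat.ofHom j) (TopCat.ofHom p.onPaths)) :
    HasLiftingProperty (globMap j) p where
  sq_hasLift {t b} sq := by
    have sq' : CommSq (TopCat.ofHom (X := Z) t.onPaths) (TopCat.ofHom j) (TopCat.ofHom p.onPaths)
        (TopCat.ofHom (X := W) b.onPaths) := ⟨TopCat.ext fun z => onPaths_congr sq.w z⟩
    have hfac : ∀ w, p.onPaths (sq'.lift.hom w) = b.onPaths w :=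
      fun w => ConcreteCategory.congr_hom sq'.fac_right w
    have h₀ : p.onStates (t.onStates ⟨0⟩) = b.onStates ⟨0⟩ := onStates_congr sq.w ⟨0⟩
    have h₁ : p.onStates (t.onStates ⟨1⟩) = b.onStates ⟨1⟩ := onStates_congr sq.w ⟨1⟩
    refine ⟨⟨⟨globDesc (t.onStates ⟨0⟩) (t.onStates ⟨1⟩) sq'.lift.hom (fun w => hp ?_)
      (fun w => hp ?_), glob_hom_ext rfl rfl (ConcreteCategory.congr_hom sq'.fac_left),
      glob_hom_ext h₀ h₁ hfac⟩⟩⟩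
    · rw [← p.src_onPaths, hfac, h₀]
      exact b.src_onPaths w
    · rw [← p.tgt_onPaths, hfac, h₁]
      exact b.tgt_onPaths w

theorem hasLiftingProperty_of_globMap [ConnectedSpace W] (j : C(Z, W))
    (hp : Function.Bijective p.onStates) (hj : HasLiftingProperty (globMap j) p) :
    HasLiftingProperty (TopCat.ofHom j) (TopCat.ofHom p.onPaths) where
  sq_hasLift {t b} sq := by
    have w₀ : W := Classical.arbitrary W
    obtain ⟨a, ha⟩ := hp.surjective (Y.src (b w₀))
    obtain ⟨a', ha'⟩ := hp.surjective (Y.tgt (b w₀))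
    have hsrc : ∀ w, Y.src (b w) = p.onStates a :=
      fun w => (Y.src_apply_eq b.hom w w₀).trans ha.symm
    have htgt : ∀ w, Y.tgt (b w) = p.onStates a' :=
      fun w => (Y.tgt_apply_eq b.hom w w₀).trans ha'.symm
    have hw : ∀ z, p.onPaths (t z) = b (j z) := ConcreteCategory.congr_hom sq.w
    have sq' : CommSq (globDesc a a' t.hom
        (fun z => hp.injective (by rw [← p.src_onPaths, ← hsrc (j z), ← hw]))
        (fun z => hp.injective (by rw [← p.tgt_onPaths, ← htgt (j z), ← hw])))
        (globMap j) p (globDesc _ _ b.hom hsrc htgt) := ⟨glob_hom_ext rfl rfl hw⟩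
    exact ⟨⟨⟨TopCat.ofHom sq'.lift.onPaths, TopCat.ext fun z => onPaths_congr sq'.fac_left z,
      TopCat.ext fun w => onPaths_congr sq'.fac_right w⟩⟩⟩

theorem hasLiftingProperty_globMap_iff [ConnectedSpace W] (j : C(Z, W))
    (hp : Function.Bijective p.onStates) :
    HasLiftingProperty (globMap j) p ↔
      HasLiftingProperty (TopCat.ofHom j) (TopCat.ofHom p.onPaths) :=
  ⟨hasLiftingProperty_of_globMap j hp, hasLiftingProperty_globMap_of_injective j hp.injective⟩

end Glob

instance (n : ℕ) : ConnectedSpace (TopCat.disk.{u} n) :=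
  have : ConnectedSpace (Disk (EuclideanSpace ℝ (Fin n))) := inferInstance
  Homeomorph.ulift.symm.surjective.connectedSpace Homeomorph.ulift.symm.continuous

variable {X Y : DirectedFlow.{u}} {p : X ⟶ Y}

theorem hasLiftingProperty_globBoundaryInclusion_iff (hp : Function.Bijective p.onStates) (n : ℕ) :
    HasLiftingProperty (globBoundaryInclusion n) p ↔
      HasRelLift (Disk.bdry (EuclideanSpace ℝ (Fin n))) p.onPaths := by
  refine (hasLiftingProperty_globMap_iff _ hp).trans
    (hasLiftingProperty_iff_hasRelLift _ _ (Homeomorph.ulift.trans ?_) Homeomorph.ulift ?_)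
  · exact
      { toFun := fun z =>
          ⟨⟨z.1, Metric.sphere_subset_closedBall z.2⟩, mem_sphere_zero_iff_norm.1 z.2⟩
        invFun := fun z => ⟨z.1.1, mem_sphere_zero_iff_norm.2 z.2⟩
        left_inv := fun _ => rfl
        right_inv := fun _ => rfl }
  · exact fun _ => rfl

theorem hasLiftingProperty_globCylinderInclusion_iff (hp : Function.Bijective p.onStates) (n : ℕ) :
    HasLiftingProperty (globCylinderInclusion n) p ↔
      HasRelLift {x : unitInterval × Disk (EuclideanSpace ℝ (Fin n)) | x.1 = 0} p.onPaths := by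
  refine (hasLiftingProperty_globMap_iff _ hp).trans
    (hasLiftingProperty_iff_hasRelLift _ _ (Homeomorph.ulift.trans ?_)
      ((Homeomorph.refl _).prodCongr Homeomorph.ulift) ?_)
  · exact
      { toFun := fun z => ⟨(0, z), rfl⟩
        invFun := fun z => z.1.2
        left_inv := fun _ => rfl
        right_inv := fun z => Subtype.ext (Prod.ext z.2.symm rfl) }
  · exact fun _ => rfl

theorem hasLiftingProperty_mapR_iff :
    HasLiftingProperty mapR p ↔ Function.Injective p.onStates := by
  refine ⟨fun h a b hab => ?_, fun hp => ⟨fun {t b} sq => ?_⟩⟩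
  · have sq : CommSq (discreteDesc fun i : ULift.{u} (Fin 2) => if i.down = 0 then a else b) mapR p
        (discreteDesc fun _ : PUnit.{u + 1} => p.onStates a) := ⟨by
      refine hom_ext ?_ fun x => x.elim
      rintro ⟨i⟩
      fin_cases i
      · rfl
      · exact hab.symm⟩
    exact (onStates_congr sq.fac_left ⟨0⟩).symm.trans (onStates_congr sq.fac_left ⟨1⟩)
  · have h : ∀ i, p.onStates (t.onStates i) = b.onStates PUnit.unit := onStates_congr sq.w
    exact ⟨⟨⟨discreteDesc fun _ => t.onStates ⟨0⟩,
      hom_ext (fun i => hp ((h ⟨0⟩).trans (h i).symm)) fun x => x.elim,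
      hom_ext (fun _ => h ⟨0⟩) fun x => x.elim⟩⟩⟩

theorem hasLiftingProperty_mapC_iff :
    HasLiftingProperty mapC p ↔ Function.Surjective p.onStates := by
  refine ⟨fun h b => ?_, fun hp => ⟨fun {t b} sq => ?_⟩⟩
  · have sq : CommSq (discreteDesc PEmpty.elim) mapC p (discreteDesc fun _ : PUnit.{u + 1} => b) :=
      ⟨hom_ext (fun x => x.elim) fun x => x.elim⟩
    exact ⟨sq.lift.onStates PUnit.unit, onStates_congr sq.fac_right PUnit.unit⟩
  · obtain ⟨a, ha⟩ := hp (b.onStates PUnit.unit)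
    exact ⟨⟨⟨discreteDesc fun _ => a, hom_ext (fun x => x.elim) fun x => x.elim,
      hom_ext (fun _ => ha) fun x => x.elim⟩⟩⟩

/-- The morphisms of flows that are bijective on `0`-skeletons and trivial Serre fibrations on path
spaces, i.e. the trivial fibrations of the model structure (`isTrivialFibration_iff`). -/
def IsTrivialFibration (p : X ⟶ Y) : Prop :=
  Function.Bijective p.onStates ∧ IsTrivialSerreFibration p.onPaths

theorem isTrivialFibration_iff_rlp : IsTrivialFibration p ↔ generatingCofibrations.rlp p := by
  refine ⟨fun ⟨hp, h⟩ => ?_, fun h => ?_⟩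
  · rintro _ _ _ ((⟨⟨n⟩⟩ | ⟨⟨⟩⟩) | ⟨⟨⟩⟩)
    · exact (hasLiftingProperty_globBoundaryInclusion_iff hp n).2 (h n)
    · exact hasLiftingProperty_mapR_iff.2 hp.injective
    · exact hasLiftingProperty_mapC_iff.2 hp.surjective
  · have hp : Function.Bijective p.onStates :=
      ⟨hasLiftingProperty_mapR_iff.1 (h mapR (Or.inl (Or.inr ⟨⟨⟩⟩))),
        hasLiftingProperty_mapC_iff.1 (h mapC (Or.inr ⟨⟨⟩⟩))⟩
    exact ⟨hp, fun n => (hasLiftingProperty_globBoundaryInclusion_iff hp n).1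
      (h _ (Or.inl (Or.inl ⟨n⟩)))⟩

theorem fibration_iff_isSerreFibration (hp : Function.Bijective p.onStates) :
    Fibration p ↔ IsSerreFibration p.onPaths := by
  rw [fibration_iff]
  refine ⟨fun h n => (hasLiftingProperty_globCylinderInclusion_iff hp n).1 (h _ ⟨n⟩), fun h => ?_⟩
  rintro _ _ _ ⟨n⟩
  exact (hasLiftingProperty_globCylinderInclusion_iff hp n).2 (h n)

theorem isTrivialFibration_iff : IsTrivialFibration p ↔ Fibration p ∧ WeakEquivalence p := by
  rw [weakEquivalence_iff]
  constructor
  · rintro ⟨hp, h⟩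
    have ⟨hs, hw⟩ := isTrivialSerreFibration_iff.1 h
    exact ⟨(fibration_iff_isSerreFibration hp).2 hs, hp, hw⟩
  · rintro ⟨hf, hp, hw⟩
    exact ⟨hp, isTrivialSerreFibration_iff.2 ⟨(fibration_iff_isSerreFibration hp).1 hf, hw⟩⟩

end DirectedFlow

/-! ### Kelleyfication -/

/-- The `k`-Hausdorff separation property: maps from compact Hausdorff spaces have closed
coincidence sets. Among compactly generated spaces this is the weak Hausdorff property, but unlike
the latter it makes sense before Kelleyfication and survives it. -/
class KHausdorffSpace (X : Type u) [TopologicalSpace X] : Prop where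
  isClosed_eq : ∀ (K : CompHaus.{u}) (f g : C(K, X)), IsClosed {k | f k = g k}

/-- A space with the finest topology that has the same maps from compact Hausdorff spaces. -/
abbrev Kelleyfication (X : Type u) [TopologicalSpace X] : Type u :=
  WithGeneratedByTopology (fun K : CompHaus.{u} => K) X

section Separation

variable {X : Type u} [TopologicalSpace X]

namespace WeakHausdorffSpace

variable [WeakHausdorffSpace X]

theorem isClosed_image {K : Type u} [TopologicalSpace K] [CompactSpace K] [T2Space K]
    {f : K → X} (hf : Continuous f) {V : Set K} (hV : IsClosed V) : IsClosed (f '' V) := by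
  have : CompactSpace V := isCompact_iff_compactSpace.1 hV.isCompact
  rw [Set.image_eq_range]
  exact isClosed_range (CompHaus.of V) ⟨fun v => f v, hf.comp continuous_subtype_val⟩

instance : T1Space X where
  t1 x := by
    simpa using isClosed_image (f := fun _ : PUnit.{u + 1} => x) continuous_const isClosed_univ

instance : KHausdorffSpace X where
  isClosed_eq K f g := by
    rw [← isOpen_compl_iff, isOpen_iff_mem_nhds]
    intro k hk
    have hU : f ⁻¹' {g k}ᶜ ∈ 𝓝 k :=
      f.continuous.continuousAt.preimage_mem_nhds (isOpen_compl_singleton.mem_nhds hk)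
    obtain ⟨V, hV, hVc, hVU⟩ := exists_mem_nhds_isClosed_subset hU
    have hW : g ⁻¹' (f '' V)ᶜ ∈ 𝓝 k := g.continuous.continuousAt.preimage_mem_nhds
      ((isClosed_image f.continuous hVc).isOpen_compl.mem_nhds fun ⟨v, hv, h⟩ => hVU hv h)
    filter_upwards [hV, hW] with x hxV hxW h
    exact hxW ⟨x, hxV, h⟩

end WeakHausdorffSpace

namespace KHausdorffSpace

variable [KHausdorffSpace X]

theorem isClosed_eq_of_continuous {Z : Type u} [TopologicalSpace Z] [CompactlyGeneratedSpace Z]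
    {f g : Z → X} (hf : Continuous f) (hg : Continuous g) : IsClosed {z | f z = g z} :=
  CompactlyGeneratedSpace.isClosed' fun K _ _ _ φ hφ =>
    isClosed_eq (CompHaus.of K) ⟨f ∘ φ, hf.comp hφ⟩ ⟨g ∘ φ, hg.comp hφ⟩

theorem weakHausdorffSpace [CompactlyGeneratedSpace X] : WeakHausdorffSpace X where
  isClosed_range K f := by
    refine CompactlyGeneratedSpace.isClosed' fun L _ _ _ g hg => ?_
    have hc : IsClosed {x : K × L | f x.1 = g x.2} :=
      isClosed_eq_of_continuous (by fun_prop) (by fun_prop)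
    convert! (hc.isCompact.image continuous_snd).isClosed
    ext l
    exact ⟨fun ⟨k, hk⟩ => ⟨(k, l), hk, rfl⟩, fun ⟨x, hx, hl⟩ => ⟨x.1, hx.trans (congrArg g hl)⟩⟩

theorem of_injective {Y : Type u} [TopologicalSpace Y] {m : Y → X} (hm : Continuous m)
    (hinj : Function.Injective m) : KHausdorffSpace Y where
  isClosed_eq K f g := by
    simpa only [Function.comp_apply, hinj.eq_iff] using
      isClosed_eq_of_continuous (hm.comp f.continuous) (hm.comp g.continuous)

end KHausdorffSpace

namespace Kelleyfication

/-- The continuous bijection to the original space. -/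
def val : C(Kelleyfication X, X) :=
  ⟨WithGeneratedByTopology.equiv, WithGeneratedByTopology.continuous_equiv⟩

/-- The inverse of `Kelleyfication.val`, which need not be continuous. -/
def of (x : X) : Kelleyfication X := WithGeneratedByTopology.equiv.symm x

theorem ext {x y : Kelleyfication X} (h : val x = val y) : x = y :=
  WithGeneratedByTopology.equiv.injective h

theorem continuous_of_comp {Z : Type*} [TopologicalSpace Z] [UCompactlyGeneratedSpace.{u} Z]
    {f : Z → X} (hf : Continuous f) : Continuous fun z => of (f z) :=
  continuous_from_uCompactlyGeneratedSpace _ fun _ g =>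
    (IsGeneratedBy.equiv_symm_comp_continuous_iff (X := fun K : CompHaus.{u} => K) (f ∘ g)).2
      (hf.comp g.continuous)

instance : CompactlyGeneratedSpace (Kelleyfication X) :=
  uCompactlyGeneratedSpace_of_continuous_maps fun f hf =>
    (IsGeneratedBy.continuous_iff (X := fun K : CompHaus.{u} => K) f).2 fun _ g => hf _ g

instance [KHausdorffSpace X] : WeakHausdorffSpace (Kelleyfication X) :=
  have : KHausdorffSpace (Kelleyfication X) := .of_injective (map_continuous val) fun _ _ => ext
  KHausdorffSpace.weakHausdorffSpace

end Kelleyfication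

end Separation

namespace DirectedFlow

theorem continuous_concat_of_continuous (X : DirectedFlow.{u}) {Z : Type*} [TopologicalSpace Z]
    [UCompactlyGeneratedSpace.{u} Z] {a b : Z → X.paths} (ha : Continuous a) (hb : Continuous b)
    (h : ∀ z, X.tgt (a z) = X.src (b z)) : Continuous fun z => X.concat (a z) (b z) (h z) :=
  continuous_from_uCompactlyGeneratedSpace _ fun K g =>
    X.continuous_concat_comp (K := K) (ha.comp g.continuous) (hb.comp g.continuous) fun k => h (g k)

theorem concat_congr (X : DirectedFlow.{u}) {x x' y y' : X.paths} (hx : x = x') (hy : y = y')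
    (h : X.tgt x = X.src y) : X.concat x y h = X.concat x' y' (by rw [← hx, ← hy, h]) := by
  subst hx hy; rfl

/-- A flow whose path space need not be compactly generated. It becomes a flow by Kelleyfication,
so its concatenation has to be continuous on compact Hausdorff probes only. -/
structure PreFlow : Type (u + 1) where
  states : Type u
  [topStates : TopologicalSpace states]
  [discreteStates : DiscreteTopology states]
  paths : Type u
  [topPaths : TopologicalSpace paths]
  [kHausdorffPaths : KHausdorffSpace paths]
  src : paths → states
  tgt : paths → states
  continuous_src : Continuous src
  continuous_tgt : Continuous tgt
  concat : ∀ x y : paths, tgt x = src y → paths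
  continuous_concat : ∀ (K : CompHaus.{u}) (a b : C(K, paths)) (h : ∀ k, tgt (a k) = src (b k)),
    Continuous fun k => concat (a k) (b k) (h k)
  src_concat : ∀ x y h, src (concat x y h) = src x
  tgt_concat : ∀ x y h, tgt (concat x y h) = tgt y
  concat_assoc : ∀ (x y z : paths) (hxy : tgt x = src y) (hyz : tgt y = src z),
    concat (concat x y hxy) z ((tgt_concat x y hxy).trans hyz) =
      concat x (concat y z hyz) (hxy.trans (src_concat y z hyz).symm)

namespace PreFlow

attribute [instance] topStates discreteStates topPaths kHausdorffPaths

/-- The flow obtained by Kelleyfication of the path space. -/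
def toFlow (X : PreFlow.{u}) : DirectedFlow.{u} where
  states := X.states
  paths := Kelleyfication X.paths
  src x := X.src (Kelleyfication.val x)
  tgt x := X.tgt (Kelleyfication.val x)
  continuous_src := X.continuous_src.comp (map_continuous _)
  continuous_tgt := X.continuous_tgt.comp (map_continuous _)
  concat x y h := Kelleyfication.of (X.concat (Kelleyfication.val x) (Kelleyfication.val y) h)
  continuous_concat := continuous_from_compactlyGenerated _ fun K g =>
    Kelleyfication.continuous_of_comp (X.continuous_concat K
      ⟨fun k => Kelleyfication.val (g k).1.1, by fun_prop⟩
      ⟨fun k => Kelleyfication.val (g k).1.2, by fun_prop⟩ fun k => (g k).2)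
  src_concat _ _ _ := X.src_concat _ _ _
  tgt_concat _ _ _ := X.tgt_concat _ _ _
  concat_assoc _ _ _ _ _ := Kelleyfication.ext (X.concat_assoc _ _ _ _ _)

end PreFlow

/-! ### Flows of fibrewise maps and S-homotopy -/

/-- The flow with exactly one path between any two states. -/
def codiscrete (S : Type u) [TopologicalSpace S] [DiscreteTopology S] : DirectedFlow.{u} where
  states := S
  paths := S × S
  src := Prod.fst
  tgt := Prod.snd
  continuous_src := continuous_fst
  continuous_tgt := continuous_snd
  concat x y _ := (x.1, y.2)
  continuous_concat := continuous_from_compactlyGenerated _ fun _ _ => by fun_prop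
  src_concat _ _ _ := rfl
  tgt_concat _ _ _ := rfl
  concat_assoc _ _ _ _ _ := rfl

/-- The morphism that is the identity on states. -/
def toCodiscrete (X : DirectedFlow.{u}) : X ⟶ codiscrete X.states where
  onStates := id
  onPaths := ⟨fun x => (X.src x, X.tgt x), X.continuous_src.prodMk X.continuous_tgt⟩
  src_onPaths _ := rfl
  tgt_onPaths _ := rfl
  map_concat x y h := Prod.ext (X.src_concat x y h) (X.tgt_concat x y h)

theorem injective_onStates_toCodiscrete (X : DirectedFlow.{u}) :
    Function.Injective X.toCodiscrete.onStates := Function.injective_id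

section FiberwiseMap

variable {X Y B : DirectedFlow.{u}} (K : Type) [TopologicalSpace K] (π : Y ⟶ B)

/-- The maps from `K` to the space of paths of `Y` that stay in a fibre of `π`. -/
def FiberwiseMap : Type u := {γ : C(K, Y.paths) // ∀ k k', π.onPaths (γ k) = π.onPaths (γ k')}

instance : TopologicalSpace (FiberwiseMap K π) := instTopologicalSpaceSubtype

namespace FiberwiseMap

variable {K π}

instance : CoeFun (FiberwiseMap K π) fun _ => K → Y.paths := ⟨fun γ => γ.1⟩

@[fun_prop]
theorem continuous_apply (γ : FiberwiseMap K π) : Continuous γ := γ.1.continuous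

@[ext]
theorem ext {γ δ : FiberwiseMap K π} (h : ∀ k, γ k = δ k) : γ = δ :=
  Subtype.ext (ContinuousMap.ext h)

@[fun_prop]
theorem continuous_eval [LocallyCompactSpace K] {Z : Type*} [TopologicalSpace Z]
    {f : Z → FiberwiseMap K π} {k : Z → K} (hf : Continuous f) (hk : Continuous k) :
    Continuous fun z => f z (k z) :=
  ContinuousEval.continuous_eval.comp ((continuous_subtype_val.comp hf).prodMk hk)

theorem continuous_of_uncurry {Z : Type*} [TopologicalSpace Z] {f : Z → FiberwiseMap K π}
    (hf : Continuous fun z : Z × K => f z.1 z.2) : Continuous f :=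
  Continuous.subtype_mk (ContinuousMap.continuous_of_continuous_uncurry _ hf) _

theorem src_eq (hπ : Function.Injective π.onStates) (γ : FiberwiseMap K π) (k k' : K) :
    Y.src (γ k) = Y.src (γ k') := hπ (by rw [← π.src_onPaths, ← π.src_onPaths, γ.2 k k'])

theorem tgt_eq (hπ : Function.Injective π.onStates) (γ : FiberwiseMap K π) (k k' : K) :
    Y.tgt (γ k) = Y.tgt (γ k') := hπ (by rw [← π.tgt_onPaths, ← π.tgt_onPaths, γ.2 k k'])

instance [LocallyCompactSpace K] : KHausdorffSpace (FiberwiseMap K π) where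
  isClosed_eq L f g := by
    simp only [FiberwiseMap.ext_iff, Set.ofPred_forall]
    exact isClosed_iInter fun k =>
      KHausdorffSpace.isClosed_eq_of_continuous (by fun_prop) (by fun_prop)

end FiberwiseMap

variable [CompactSpace K] [T2Space K] [Nonempty K] (hπ : Function.Injective π.onStates)

/-- The flow of fibrewise maps, with pointwise concatenation. As `π` is injective on states, the
paths in the image of a fibrewise map have the same source and target. -/
noncomputable def fiberwiseMaps : DirectedFlow.{u} :=
  PreFlow.toFlow
    { states := Y.states
      paths := FiberwiseMap K π
      src := fun γ => Y.src (γ (Classical.arbitrary K))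
      tgt := fun γ => Y.tgt (γ (Classical.arbitrary K))
      continuous_src := Y.continuous_src.comp (by fun_prop)
      continuous_tgt := Y.continuous_tgt.comp (by fun_prop)
      concat := fun γ δ h =>
        have hγδ : ∀ k, Y.tgt (γ k) = Y.src (δ k) := fun k =>
          (γ.tgt_eq hπ k _).trans (h.trans (δ.src_eq hπ _ k))
        ⟨⟨fun k => Y.concat (γ k) (δ k) (hγδ k),
            (Y.continuous_concat_of_continuous (Z := ULift.{u} K) (a := fun k => γ k.down)
              (b := fun k => δ k.down) (by fun_prop) (by fun_prop) fun k => hγδ k.down).comp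
              continuous_uliftUp⟩, fun k k' => by
          simp only [ContinuousMap.coe_mk, π.map_concat]
          exact B.concat_congr (γ.2 k k') (δ.2 k k') _⟩
      continuous_concat := fun L γ δ h => FiberwiseMap.continuous_of_uncurry <|
        Y.continuous_concat_of_continuous (Z := L × K) (by fun_prop) (by fun_prop) fun x =>
          ((γ x.1).tgt_eq hπ _ _).trans ((h x.1).trans ((δ x.1).src_eq hπ _ _))
      src_concat := fun _ _ _ => Y.src_concat _ _ _
      tgt_concat := fun _ _ _ => Y.tgt_concat _ _ _
      concat_assoc := fun _ _ _ _ _ => FiberwiseMap.ext fun _ => Y.concat_assoc _ _ _ _ _ }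

namespace fiberwiseMaps

variable {K π hπ}

/-- The fibrewise map underlying a path. -/
def toFiberwiseMap : C((fiberwiseMaps K π hπ).paths, FiberwiseMap K π) :=
  Kelleyfication.val (X := FiberwiseMap K π)

/-- The path given by a fibrewise map. -/
def ofFiberwiseMap (γ : FiberwiseMap K π) : (fiberwiseMaps K π hπ).paths :=
  Kelleyfication.of (X := FiberwiseMap K π) γ

theorem continuous_ofFiberwiseMap {Z : Type*} [TopologicalSpace Z]
    [UCompactlyGeneratedSpace.{u} Z] {f : Z → FiberwiseMap K π} (hf : Continuous f) :
    Continuous fun z => (ofFiberwiseMap (f z) : (fiberwiseMaps K π hπ).paths) :=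
  Kelleyfication.continuous_of_comp hf

variable (π hπ)

/-- Evaluation at a point. -/
noncomputable def eval (k : K) : fiberwiseMaps K π hπ ⟶ Y where
  onStates := id
  onPaths := ⟨fun γ => toFiberwiseMap γ k, by fun_prop⟩
  src_onPaths γ := (toFiberwiseMap γ).src_eq hπ _ _
  tgt_onPaths γ := (toFiberwiseMap γ).tgt_eq hπ _ _
  map_concat _ _ _ := rfl

variable {π hπ}

theorem paths_ext {γ δ : (fiberwiseMaps K π hπ).paths}
    (h : ∀ k, (eval π hπ k).onPaths γ = (eval π hπ k).onPaths δ) : γ = δ :=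
  Kelleyfication.ext (X := FiberwiseMap K π) (FiberwiseMap.ext h)

theorem hom_ext {f g : X ⟶ fiberwiseMaps K π hπ} (h : ∀ k, f ≫ eval π hπ k = g ≫ eval π hπ k) :
    f = g :=
  DirectedFlow.hom_ext (fun x => onStates_congr (h (Classical.arbitrary K)) x)
    fun x => paths_ext fun k => onPaths_congr (h k) x

theorem continuous_comp_eval (f : X ⟶ fiberwiseMaps K π hπ) :
    Continuous fun x : X.paths × K => (f ≫ eval π hπ x.2).onPaths x.1 := by
  change Continuous fun x : X.paths × K => toFiberwiseMap (f.onPaths x.1) x.2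
  fun_prop

theorem exists_comp_eval_eq (m : K → (X ⟶ Y)) (hm : ∀ k k', m k ≫ π = m k' ≫ π)
    (hc : Continuous fun x : X.paths × K => (m x.2).onPaths x.1) :
    ∃ f : X ⟶ fiberwiseMaps K π hπ, ∀ k, f ≫ eval π hπ k = m k := by
  have hst : ∀ k, (m (Classical.arbitrary K)).onStates = (m k).onStates := fun k =>
    funext fun x => hπ (onStates_congr (hm _ k) x)
  let c (x : X.paths) : FiberwiseMap K π :=
    ⟨⟨fun k => (m k).onPaths x, hc.comp (by fun_prop : Continuous fun k => (x, k))⟩,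
      fun k k' => onPaths_congr (hm k k') x⟩
  exact ⟨
    { onStates := (m (Classical.arbitrary K)).onStates
      onPaths := ⟨fun x => ofFiberwiseMap (c x),
        continuous_ofFiberwiseMap (FiberwiseMap.continuous_of_uncurry hc)⟩
      src_onPaths := (m _).src_onPaths
      tgt_onPaths := (m _).tgt_onPaths
      map_concat := fun x y h => paths_ext fun k => (m k).map_concat x y h },
    fun k => DirectedFlow.hom_ext (fun x => congrFun (hst k) x) fun _ => rfl⟩

section Restrict

variable {C : Set K} [CompactSpace C] [Nonempty C]

variable (π hπ C) in
/-- Restriction to a subspace. -/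
noncomputable def restrict : fiberwiseMaps K π hπ ⟶ fiberwiseMaps C π hπ where
  onStates := id
  onPaths := ⟨fun γ => ofFiberwiseMap
      ⟨⟨fun c => toFiberwiseMap γ c, by fun_prop⟩, fun c c' => (toFiberwiseMap γ).2 c c'⟩,
    continuous_ofFiberwiseMap (FiberwiseMap.continuous_of_uncurry (by
      change Continuous fun x : (fiberwiseMaps K π hπ).paths × C => toFiberwiseMap x.1 x.2
      fun_prop))⟩
  src_onPaths γ := (toFiberwiseMap γ).src_eq hπ _ _
  tgt_onPaths γ := (toFiberwiseMap γ).tgt_eq hπ _ _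
  map_concat _ _ _ := rfl

theorem restrict_comp_eval (c : C) : restrict π hπ C ≫ eval π hπ c = eval π hπ (c : K) := rfl

theorem isTrivialFibration_restrict
    (h : ∀ n, HasRelLift {x : K × Disk (EuclideanSpace ℝ (Fin n)) |
      x.1 ∈ C ∨ x.2 ∈ Disk.bdry (EuclideanSpace ℝ (Fin n))} π.onPaths) :
    IsTrivialFibration (restrict π hπ C) := by
  refine ⟨Function.bijective_id, fun n a b hab => ?_⟩
  have hC : IsClosed C := (isCompact_iff_compactSpace.2 ‹_›).isClosed
  let c₀ : C := Classical.arbitrary C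
  obtain ⟨f, hfb, hfa⟩ := exists_continuousMap_glue
    (X := {x : K × Disk (EuclideanSpace ℝ (Fin n)) |
      x.1 ∈ C ∨ x.2 ∈ Disk.bdry (EuclideanSpace ℝ (Fin n))})
    (A := {x | x.1.1 ∈ C}) (B := {x | x.1.2 ∈ Disk.bdry (EuclideanSpace ℝ (Fin n))})
    (hC.preimage (by fun_prop)) (Disk.isClosed_bdry.preimage (by fun_prop)) (fun x => x.2)
    ⟨fun x => toFiberwiseMap (b x.1.1.2) ⟨x.1.1.1, x.2⟩, by fun_prop⟩
    ⟨fun x => toFiberwiseMap (a ⟨x.1.1.2, x.2⟩) x.1.1.1, by fun_prop⟩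
    fun x hc hx => congrArg (fun γ => toFiberwiseMap γ ⟨x.1.1, hc⟩) (hab ⟨x.1.2, hx⟩).symm
  obtain ⟨L, hLf, hLb⟩ := h n f ⟨fun x => π.onPaths (toFiberwiseMap (b x.2) c₀), by fun_prop⟩ <| by
    rintro ⟨⟨k, y⟩, hk | hy⟩
    · rw [hfb ⟨⟨(k, y), Or.inl hk⟩, hk⟩]
      exact (toFiberwiseMap (b y)).2 ⟨k, hk⟩ c₀
    · rw [hfa ⟨⟨(k, y), Or.inr hy⟩, hy⟩]
      exact ((toFiberwiseMap (a ⟨y, hy⟩)).2 k c₀).trans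
        (congrArg (fun γ => π.onPaths (toFiberwiseMap γ c₀)) (hab ⟨y, hy⟩))
  let l (y : Disk (EuclideanSpace ℝ (Fin n))) : FiberwiseMap K π :=
    ⟨⟨fun k => L (k, y), by fun_prop⟩, fun k k' => (hLb (k, y)).trans (hLb (k', y)).symm⟩
  have hl : Continuous l := FiberwiseMap.continuous_of_uncurry <|
    show Continuous fun x : Disk (EuclideanSpace ℝ (Fin n)) × K => L (x.2, x.1) by fun_prop
  refine ⟨⟨fun y => ofFiberwiseMap (l y), continuous_ofFiberwiseMap hl⟩,
    fun y => paths_ext fun k => ?_, fun y => paths_ext fun c => ?_⟩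
  · exact (hLf ⟨(k, y), Or.inr y.2⟩).trans (hfa ⟨⟨(k, y), Or.inr y.2⟩, y.2⟩)
  · exact (hLf ⟨(c, y), Or.inl c.2⟩).trans (hfb ⟨⟨(c, y), Or.inl c.2⟩, c.2⟩)

end Restrict

end fiberwiseMaps

end FiberwiseMap

section Homotopy

variable {X Y Z : DirectedFlow.{u}} {f g : X ⟶ Y}

theorem hom_ext_toMap (h : ∀ x, toMap f x = toMap g x) : f = g :=
  hom_ext (fun x => Sum.inl_injective (h (Sum.inl x))) fun x => Sum.inr_injective (h (Sum.inr x))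

/-- S-homotopies are the continuous families of morphisms. -/
theorem sHomotopic_iff : SHomotopic f g ↔ ∃ m : unitInterval → (X ⟶ Y),
    (∀ t t', (m t).onStates = (m t').onStates) ∧
      (Continuous fun x : X.paths × unitInterval => (m x.2).onPaths x.1) ∧ m 0 = f ∧ m 1 = g := by
  constructor
  · rintro ⟨H, hH, h₀, h₁⟩
    choose m hm using hH
    refine ⟨m, fun t t' => funext fun x => ?_, ?_,
      hom_ext_toMap fun x => (hm 0 x).symm.trans (h₀ x),
      hom_ext_toMap fun x => (hm 1 x).symm.trans (h₁ x)⟩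
    · have hc : Continuous fun s => (m s).onStates x :=
        (IsEmbedding.inl (X := Y.states) (Y := Y.paths)).continuous_iff.2 <|
          (H.continuous.comp (by fun_prop : Continuous fun s : unitInterval =>
            (s, (Sum.inl x : X.Space)))).congr fun s => hm s (Sum.inl x)
      exact PreconnectedSpace.constant inferInstance hc
    · exact (IsEmbedding.inr (X := Y.states) (Y := Y.paths)).continuous_iff.2 <|
        (H.continuous.comp (by fun_prop : Continuous fun x : X.paths × unitInterval =>
          (x.2, (Sum.inr x.1 : X.Space)))).congr fun x => hm x.2 (Sum.inr x.1)
  · rintro ⟨m, hm, hc, rfl, rfl⟩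
    refine ⟨⟨fun x => toMap (m x.1) x.2, ?_⟩, fun t => ⟨m t, fun _ => rfl⟩, fun _ => rfl,
      fun _ => rfl⟩
    have hst : Continuous fun x : unitInterval × X.states => (m x.1).onStates x.2 := by
      simp only [hm _ 0]
      exact continuous_of_discreteTopology.comp continuous_snd
    have hsum := (hst.sumMap (hc.comp continuous_swap)).comp
      (Homeomorph.prodSumDistrib (X := unitInterval) (Y := X.states) (Z := X.paths)).continuous
    refine hsum.congr ?_
    rintro ⟨t, x | x⟩ <;> rfl

theorem SHomotopic.refl (f : X ⟶ Y) : SHomotopic f f :=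
  sHomotopic_iff.2 ⟨fun _ => f, fun _ _ => rfl, f.onPaths.continuous.comp continuous_fst, rfl, rfl⟩

theorem SHomotopic.comp (h : SHomotopic f g) (k : Y ⟶ Z) : SHomotopic (f ≫ k) (g ≫ k) := by
  obtain ⟨m, hm, hc, rfl, rfl⟩ := sHomotopic_iff.1 h
  exact sHomotopic_iff.2 ⟨fun t => m t ≫ k,
    fun t t' => congrArg (k.onStates ∘ ·) (hm t t'), k.onPaths.continuous.comp hc, rfl, rfl⟩

variable {π : Y ⟶ Z} {hπ : Function.Injective π.onStates}

theorem fiberwiseMaps.sHomotopic_comp_eval (h : X ⟶ fiberwiseMaps unitInterval π hπ) :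
    SHomotopic (h ≫ eval π hπ 0) (h ≫ eval π hπ 1) :=
  sHomotopic_iff.2 ⟨fun t => h ≫ eval π hπ t, fun _ _ => rfl, continuous_comp_eval h, rfl, rfl⟩

/-- The flow of paths of paths. -/
noncomputable abbrev pathFlow (Y : DirectedFlow.{u}) : DirectedFlow.{u} :=
  fiberwiseMaps unitInterval Y.toCodiscrete Y.injective_onStates_toCodiscrete

/-- Evaluation of paths of paths. -/
noncomputable abbrev pathEval (Y : DirectedFlow.{u}) (t : unitInterval) : pathFlow Y ⟶ Y :=
  fiberwiseMaps.eval _ _ t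

theorem SHomotopic.exists_pathFlow (h : SHomotopic f g) :
    ∃ k : X ⟶ pathFlow Y, k ≫ pathEval Y 0 = f ∧ k ≫ pathEval Y 1 = g := by
  obtain ⟨m, hm, hc, rfl, rfl⟩ := sHomotopic_iff.1 h
  have hcod : ∀ t t', m t ≫ Y.toCodiscrete = m t' ≫ Y.toCodiscrete := fun t t' =>
    hom_ext (congrFun (hm t t')) fun x => Prod.ext
      (((m t).src_onPaths x).trans ((congrFun (hm t t') _).trans ((m t').src_onPaths x).symm))
      (((m t).tgt_onPaths x).trans ((congrFun (hm t t') _).trans ((m t').tgt_onPaths x).symm))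
  obtain ⟨k, hk⟩ := fiberwiseMaps.exists_comp_eval_eq
    (hπ := Y.injective_onStates_toCodiscrete) m hcod hc
  exact ⟨k, hk 0, hk 1⟩

instance (S : Type u) [TopologicalSpace S] [DiscreteTopology S] :
    DiscreteTopology (codiscrete S).paths := inferInstanceAs (DiscreteTopology (S × S))

theorem isTrivialFibration_restrict_pathFlow (Y : DirectedFlow.{u}) :
    IsTrivialFibration (fiberwiseMaps.restrict Y.toCodiscrete Y.injective_onStates_toCodiscrete
      ({0} : Set unitInterval)) :=
  fiberwiseMaps.isTrivialFibration_restrict fun _ =>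
    (isSerreFibration_of_discreteTopology _).hasRelLift_box (Disk.isDiskBoundary_bdry _)

theorem IsTrivialFibration.isTrivialFibration_restrict_endpoints (h : IsTrivialFibration π) :
    IsTrivialFibration (fiberwiseMaps.restrict π h.1.injective ({0, 1} : Set unitInterval)) :=
  fiberwiseMaps.isTrivialFibration_restrict fun n => by
    simpa only [cylinderBoundary, Set.mem_insert_iff, Set.mem_singleton_iff, or_assoc] using
      h.2.hasRelLift (Disk.isDiskBoundary_bdry (EuclideanSpace ℝ (Fin n))).cylinderBoundary

theorem IsTrivialFibration.sHomotopic_of_comp_eq (hπ : IsTrivialFibration π) (hX : IsCofibrant X)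
    (h : f ≫ π = g ≫ π) : SHomotopic f g := by
  let m (t : ({0, 1} : Set unitInterval)) : X ⟶ Y := if t.1 = 0 then f else g
  obtain ⟨k, hk⟩ := fiberwiseMaps.exists_comp_eval_eq (hπ := hπ.1.injective) m
    (fun t t' => by dsimp only [m]; split_ifs <;> simp only [h])
    (continuous_prod_of_discrete_right.2 fun t => (m t).onPaths.continuous)
  have hlift := (cofibration_iff _).1 hX _
    (isTrivialFibration_iff_rlp.1 hπ.isTrivialFibration_restrict_endpoints)
  have sq : CommSq (Limits.initial.to _) (Limits.initial.to X)
    (fiberwiseMaps.restrict π hπ.1.injective {0, 1}) k := ⟨Subsingleton.elim _ _⟩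
  have hm (t : ({0, 1} : Set unitInterval)) :
      sq.lift ≫ fiberwiseMaps.eval π hπ.1.injective t = m t :=
    (congrArg (· ≫ fiberwiseMaps.eval π hπ.1.injective t) sq.fac_right).trans (hk t)
  have h₀ := hm ⟨0, Or.inl rfl⟩
  have h₁ := hm ⟨1, Or.inr rfl⟩
  simp only [m, ↓reduceIte, one_ne_zero] at h₀ h₁
  rw [← h₀, ← h₁]
  exact fiberwiseMaps.sHomotopic_comp_eval _

theorem LeftHomotopic.sHomotopic (hX : IsCofibrant X) (h : LeftHomotopic f g) :
    SHomotopic f g := by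
  obtain ⟨P, hP, ⟨H⟩⟩ := h
  have hπ : IsTrivialFibration P.π := isTrivialFibration_iff.2 ⟨hP.fibration_π, P.weakEquivalence_π⟩
  have hH := (hπ.sHomotopic_of_comp_eq hX (P.i₀_π.trans P.i₁_π.symm)).comp H.h
  rwa [H.h₀, H.h₁] at hH

theorem SHomotopic.nonempty_leftHomotopy (h : SHomotopic f g) (P : Cylinder X)
    (hP : Cofibration P.i) : Nonempty (P.LeftHomotopy f g) := by
  obtain ⟨k, hk₀, hk₁⟩ := h.exists_pathFlow
  obtain ⟨c, hc₀, hc₁⟩ := (SHomotopic.refl f).exists_pathFlow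
  let r := fiberwiseMaps.restrict Y.toCodiscrete Y.injective_onStates_toCodiscrete
    ({0} : Set unitInterval)
  have hr : c ≫ r = k ≫ r := fiberwiseMaps.hom_ext fun ⟨t, ht⟩ => by
    obtain rfl : t = 0 := ht
    rw [Category.assoc, Category.assoc, fiberwiseMaps.restrict_comp_eval]
    exact hc₀.trans hk₀.symm
  have hlift := (cofibration_iff _).1 hP _
    (isTrivialFibration_iff_rlp.1 (isTrivialFibration_restrict_pathFlow Y))
  have sq : CommSq (Limits.coprod.desc c k) P.i r (P.π ≫ c ≫ r) := ⟨by
    refine Limits.coprod.hom_ext ?_ ?_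
    · rw [Limits.coprod.inl_desc_assoc, P.inl_i_assoc, P.i₀_π_assoc]
    · rw [Limits.coprod.inr_desc_assoc, P.inr_i_assoc, P.i₁_π_assoc, hr]⟩
  have h₀ : P.i₀ ≫ sq.lift = c := by
    rw [← P.inl_i_assoc, sq.fac_left, Limits.coprod.inl_desc]
  have h₁ : P.i₁ ≫ sq.lift = k := by
    rw [← P.inr_i_assoc, sq.fac_left, Limits.coprod.inr_desc]
  exact ⟨⟨sq.lift ≫ pathEval Y 1, by rw [← Category.assoc, h₀, hc₁],
    by rw [← Category.assoc, h₁, hk₁]⟩⟩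

end Homotopy

/-! ### Extensions of a flow by generators and relations -/

/-- The formal concatenations of paths of `E` and of generators `z : G` from `src z` to `tgt z`. -/
inductive Word (E : DirectedFlow.{u}) {G : Type u} (src tgt : G → E.states) :
    E.states → E.states → Type u
  | path {a b : E.states} (x : E.paths) (ha : E.src x = a) (hb : E.tgt x = b) : Word E src tgt a b
  | gen {a b : E.states} (z : G) (ha : src z = a) (hb : tgt z = b) : Word E src tgt a b
  | mul {a b b' c : E.states} (v : Word E src tgt a b) (w : Word E src tgt b' c) (h : b = b') :
      Word E src tgt a c

/-- Generators and relations for a flow that extends `E` and has the same states. -/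
structure Extension (E : DirectedFlow.{u}) : Type (u + 1) where
  gens : Type u
  [topGens : TopologicalSpace gens]
  [compactlyGeneratedGens : CompactlyGeneratedSpace gens]
  src : gens → E.states
  tgt : gens → E.states
  continuous_src : Continuous src
  continuous_tgt : Continuous tgt
  /-- the pairs of words to be identified -/
  rel : ∀ {a b : E.states}, Word E src tgt a b → Word E src tgt a b → Prop

namespace Extension

attribute [instance] topGens compactlyGeneratedGens

variable {E U V : DirectedFlow.{u}} (P : E.Extension)

/-- An interpretation of the generators in a flow under `E`, subject to no relation. -/
structure Realization (U : DirectedFlow.{u}) where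
  /-- the morphism from `E` -/
  base : E ⟶ U
  onGens : C(P.gens, U.paths)
  src_onGens : ∀ z, U.src (onGens z) = base.onStates (P.src z)
  tgt_onGens : ∀ z, U.tgt (onGens z) = base.onStates (P.tgt z)

variable {P}

/-- The value of a word, bundled with its endpoints. -/
def Realization.eval (M : P.Realization U) {a b : E.states} :
    Word E P.src P.tgt a b →
      {x : U.paths // U.src x = M.base.onStates a ∧ U.tgt x = M.base.onStates b}
  | .path x ha hb => ⟨M.base.onPaths x, ha ▸ M.base.src_onPaths x, hb ▸ M.base.tgt_onPaths x⟩
  | .gen z ha hb => ⟨M.onGens z, ha ▸ M.src_onGens z, hb ▸ M.tgt_onGens z⟩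
  | .mul v w h =>
    ⟨U.concat (M.eval v) (M.eval w)
        ((M.eval v).2.2.trans ((congrArg _ h).trans (M.eval w).2.1.symm)),
      (U.src_concat _ _ _).trans (M.eval v).2.1, (U.tgt_concat _ _ _).trans (M.eval w).2.2⟩

variable (P) in
/-- An interpretation of the generators that satisfies the relations. -/
structure Model (U : DirectedFlow.{u}) extends P.Realization U where
  eval_eq : ∀ {a b : E.states} {v w : Word E P.src P.tgt a b}, P.rel v w →
    (toRealization.eval v).1 = (toRealization.eval w).1

variable (P) in
/-- The model that remembers the endpoints of words. -/
def endpoints : P.Model (codiscrete E.states) :=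
  let M : P.Realization (codiscrete E.states) :=
    { base := E.toCodiscrete
      onGens := ⟨fun z => (P.src z, P.tgt z), P.continuous_src.prodMk P.continuous_tgt⟩
      src_onGens := fun _ => rfl
      tgt_onGens := fun _ => rfl }
  { M with
    eval_eq := fun {_ _ v w} _ => Prod.ext ((M.eval v).2.1.trans (M.eval w).2.1.symm)
      ((M.eval v).2.2.trans (M.eval w).2.2.symm) }

variable (P) in
/-- Two words are identified if they have the same value in all models. Since the codiscrete flow
is a model, such words have the same endpoints. -/
def pathSetoid : Setoid (Σ a b : E.states, Word E P.src P.tgt a b) where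
  r v w := ∀ ⦃U : DirectedFlow.{u}⦄ (M : P.Model U), (M.eval v.2.2).1 = (M.eval w.2.2).1
  iseqv := ⟨fun _ _ _ => rfl, fun h _ M => (h M).symm, fun h h' _ M => (h M).trans (h' M)⟩

variable (P) in
/-- The paths of the extended flow, with the coarsest topology that makes their values in all
models continuous. -/
def Path : Type u := Quotient P.pathSetoid

namespace Path

/-- The path of a word. -/
def mk {a b : E.states} (w : Word E P.src P.tgt a b) : P.Path := Quotient.mk P.pathSetoid ⟨a, b, w⟩

/-- The value of a path in a model. -/
def eval (M : P.Model U) : P.Path → U.paths :=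
  Quotient.lift (fun w => (M.eval w.2.2).1) fun _ _ h => h M

/-- The source of a path. -/
def src (x : P.Path) : E.states := (x.eval P.endpoints).1

/-- The target of a path. -/
def tgt (x : P.Path) : E.states := (x.eval P.endpoints).2

theorem ext {x y : P.Path} (h : ∀ ⦃U : DirectedFlow.{u}⦄ (M : P.Model U), x.eval M = y.eval M) :
    x = y := by
  induction x, y using Quotient.inductionOn₂ with
  | h v w => exact Quotient.sound h

theorem src_mk {a b : E.states} (w : Word E P.src P.tgt a b) : (mk w).src = a :=
  (P.endpoints.eval w).2.1

theorem tgt_mk {a b : E.states} (w : Word E P.src P.tgt a b) : (mk w).tgt = b :=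
  (P.endpoints.eval w).2.2

theorem src_eval (M : P.Model U) (x : P.Path) : U.src (x.eval M) = M.base.onStates x.src := by
  induction x using Quotient.inductionOn with
  | h w => exact (M.eval w.2.2).2.1.trans (congrArg _ (src_mk w.2.2).symm)

theorem tgt_eval (M : P.Model U) (x : P.Path) : U.tgt (x.eval M) = M.base.onStates x.tgt := by
  induction x using Quotient.inductionOn with
  | h w => exact (M.eval w.2.2).2.2.trans (congrArg _ (tgt_mk w.2.2).symm)

theorem tgt_eval_eq_src_eval (M : P.Model U) {x y : P.Path} (h : x.tgt = y.src) :
    U.tgt (x.eval M) = U.src (y.eval M) := by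
  rw [tgt_eval, src_eval, h]

theorem mk_out (x : P.Path) : mk x.out.2.2 = x := x.out_eq

/-- Concatenation of paths. -/
noncomputable def concat (x y : P.Path) (h : x.tgt = y.src) : P.Path :=
  mk (x.out.2.2.mul y.out.2.2
    (by rw [← tgt_mk x.out.2.2, ← src_mk y.out.2.2, mk_out, mk_out, h]))

theorem eval_concat (M : P.Model U) (x y : P.Path) (h : x.tgt = y.src) :
    (concat x y h).eval M = U.concat (x.eval M) (y.eval M) (tgt_eval_eq_src_eval M h) :=
  U.concat_congr (congrArg (eval M) x.mk_out) (congrArg (eval M) y.mk_out) _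

theorem mk_mul {a b b' c : E.states} (v : Word E P.src P.tgt a b) (w : Word E P.src P.tgt b' c)
    (h : b = b') :
    mk (v.mul w h) = concat (mk v) (mk w) ((tgt_mk v).trans (h.trans (src_mk w).symm)) :=
  ext fun _ M => (eval_concat M (mk v) (mk w) _).symm

instance : TopologicalSpace P.Path :=
  ⨅ (U : DirectedFlow.{u}) (M : P.Model U), TopologicalSpace.induced (eval M) inferInstance

@[fun_prop]
theorem continuous_eval (M : P.Model U) : Continuous (eval M) :=
  continuous_iff_le_induced.2 (iInf₂_le U M)

theorem continuous_of_eval {Z : Type*} [TopologicalSpace Z] {f : Z → P.Path}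
    (h : ∀ ⦃U : DirectedFlow.{u}⦄ (M : P.Model U), Continuous fun z => (f z).eval M) :
    Continuous f :=
  continuous_iInf_rng.2 fun _ => continuous_iInf_rng.2 fun M => continuous_induced_rng.2 (h M)

instance : KHausdorffSpace P.Path where
  isClosed_eq K f g := by
    have : {k | f k = g k} =
        ⋂ (U : DirectedFlow.{u}) (M : P.Model U), {k | (f k).eval M = (g k).eval M} := by
      ext k
      simp only [Set.mem_ofPred_eq, Set.mem_iInter]
      exact ⟨fun h U M => congrArg _ h, Path.ext⟩
    rw [this]
    exact isClosed_iInter fun U => isClosed_iInter fun M =>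
      KHausdorffSpace.isClosed_eq_of_continuous (by fun_prop) (by fun_prop)

end Path

variable (P) in
/-- The flow generated by `E` and the generators, subject to the relations. -/
noncomputable def flow : DirectedFlow.{u} :=
  PreFlow.toFlow
    { states := E.states
      paths := P.Path
      src := Path.src
      tgt := Path.tgt
      continuous_src := continuous_fst.comp (Path.continuous_eval P.endpoints)
      continuous_tgt := continuous_snd.comp (Path.continuous_eval P.endpoints)
      concat := Path.concat
      continuous_concat := fun K a b h => Path.continuous_of_eval fun U M => by
        simp only [Path.eval_concat]
        exact U.continuous_concat_of_continuous (by fun_prop) (by fun_prop) _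
      src_concat := fun x y h => (congrArg Prod.fst (Path.eval_concat P.endpoints x y h) :)
      tgt_concat := fun x y h => (congrArg Prod.snd (Path.eval_concat P.endpoints x y h) :)
      concat_assoc := fun x y z hxy hyz => Path.ext fun U M => by
        simp only [Path.eval_concat]
        exact U.concat_assoc _ _ _ _ _ }

/-- The morphism out of the extended flow given by a model. -/
noncomputable def Model.desc (M : P.Model U) : P.flow ⟶ U where
  onStates := M.base.onStates
  onPaths := ⟨fun x => Path.eval M (Kelleyfication.val x),
    (Path.continuous_eval M).comp (map_continuous (Kelleyfication.val (X := P.Path)))⟩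
  src_onPaths x := Path.src_eval M (Kelleyfication.val x)
  tgt_onPaths x := Path.tgt_eval M (Kelleyfication.val x)
  map_concat x y h := Path.eval_concat M (Kelleyfication.val x) (Kelleyfication.val y) h

theorem paths_ext {x y : P.flow.paths}
    (h : ∀ ⦃U : DirectedFlow.{u}⦄ (M : P.Model U), M.desc.onPaths x = M.desc.onPaths y) : x = y :=
  Kelleyfication.ext (X := P.Path) (Path.ext h)

variable (P) in
/-- The path of the extended flow given by a word. -/
def ofWord {a b : E.states} (w : Word E P.src P.tgt a b) : P.flow.paths :=
  Kelleyfication.of (X := P.Path) (Path.mk w)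

variable (P) in
/-- The inclusion in the extended flow. -/
noncomputable def incl : E ⟶ P.flow where
  onStates := id
  onPaths := ⟨fun x => P.ofWord (.path x rfl rfl), Kelleyfication.continuous_of_comp
    (Path.continuous_of_eval fun _ M => M.base.onPaths.continuous)⟩
  src_onPaths _ := rfl
  tgt_onPaths _ := rfl
  map_concat x y h := paths_ext fun _ M => (M.base.map_concat x y h).trans
    (M.desc.map_concat (P.ofWord (.path x rfl rfl)) (P.ofWord (.path y rfl rfl)) h).symm

variable (P) in
/-- The generators as paths of the extended flow. -/
def gen : C(P.gens, P.flow.paths) where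
  toFun z := P.ofWord (.gen z rfl rfl)
  continuous_toFun := Kelleyfication.continuous_of_comp
    (Path.continuous_of_eval fun _ M => M.onGens.continuous)

theorem path_induction {motive : P.flow.paths → Prop} (hp : ∀ x, motive (P.incl.onPaths x))
    (hg : ∀ z, motive (P.gen z))
    (hm : ∀ x y h, motive x → motive y → motive (P.flow.concat x y h)) (x : P.flow.paths) :
    motive x := by
  obtain ⟨⟨a, b, w⟩⟩ := x
  change motive (P.ofWord w)
  induction w with
  | path x ha hb => subst ha hb; exact hp x
  | gen z ha hb => subst ha hb; exact hg z
  | mul v w h hv hw =>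
    have hmul : P.ofWord (v.mul w h) = P.flow.concat (P.ofWord v) (P.ofWord w)
        ((Path.tgt_mk v).trans (h.trans (Path.src_mk w).symm)) :=
      congrArg (Kelleyfication.of (X := P.Path)) (Path.mk_mul v w h)
    rw [hmul]
    exact hm _ _ _ hv hw

theorem hom_ext {f g : P.flow ⟶ U} (h : P.incl ≫ f = P.incl ≫ g)
    (hg : ∀ z, f.onPaths (P.gen z) = g.onPaths (P.gen z)) : f = g := by
  refine DirectedFlow.hom_ext (fun a => onStates_congr h a) fun x => ?_
  induction x using path_induction with
  | hp x => exact onPaths_congr h x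
  | hg z => exact hg z
  | hm x y hxy hx hy =>
    exact ((f.map_concat x y hxy).trans (U.concat_congr hx hy _)).trans
      (g.map_concat x y hxy).symm

end Extension

end DirectedFlow

/-! ### Cones and closed embeddings -/

theorem isClosedEmbedding_of_comp {A B C : Type u} [TopologicalSpace A] [TopologicalSpace B]
    [TopologicalSpace C] [CompactlyGeneratedSpace B] [KHausdorffSpace B] {j : A → B} {m : B → C}
    (hj : Continuous j) (hm : Continuous m) (h : IsClosedEmbedding (m ∘ j)) :
    IsClosedEmbedding j := by
  refine .of_continuous_injective_isClosedMap hj h.injective.of_comp fun D hD =>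
    CompactlyGeneratedSpace.isClosed' fun K _ _ _ g hg => ?_
  let L : Set K := {k | m (g k) ∈ (m ∘ j) '' D}
  have hL : IsClosed L := (h.isClosedMap D hD).preimage (hm.comp hg)
  have : CompactSpace L := isCompact_iff_compactSpace.1 hL.isCompact
  choose a haD ha using fun k : L => k.2
  have hac : Continuous a := h.isInducing.continuous_iff.2
    ((hm.comp (hg.comp continuous_subtype_val)).congr fun k => (ha k).symm)
  have hc : IsClosed {k : L | j (a k) = g k} :=
    KHausdorffSpace.isClosed_eq_of_continuous (hj.comp hac) (hg.comp continuous_subtype_val)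
  convert! hL.isClosedMap_subtype_val _ hc
  ext k
  constructor
  · rintro ⟨d, hd, hdk⟩
    have hk : k ∈ L := ⟨d, hd, congrArg m hdk⟩
    have had : a ⟨k, hk⟩ = d := h.injective ((ha ⟨k, hk⟩).trans (congrArg m hdk).symm)
    exact ⟨⟨k, hk⟩, (congrArg j had).trans hdk, rfl⟩
  · rintro ⟨k, hk, rfl⟩
    exact ⟨a k, haD k, hk⟩

namespace DirectedFlow

variable {E : DirectedFlow.{u}}

variable (E) in
/-- The points of the cones on the spaces of paths between two given states. The apex, at height
`1`, carries no path. -/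
structure ConePath : Type u where
  src : E.states
  tgt : E.states
  height : unitInterval
  body : height ≠ 1 → E.paths
  src_body : ∀ h, E.src (body h) = src
  tgt_body : ∀ h, E.tgt (body h) = tgt

namespace ConePath

theorem ext_iff {x y : ConePath E} : x = y ↔ x.src = y.src ∧ x.tgt = y.tgt ∧
    x.height = y.height ∧ ∀ hx hy, x.body hx = y.body hy := by
  constructor
  · rintro rfl
    exact ⟨rfl, rfl, rfl, fun _ _ => rfl⟩
  · obtain ⟨a, b, t, e, ha, hb⟩ := x
    obtain ⟨a', b', t', e', ha', hb'⟩ := y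
    rintro ⟨h₁, h₂, h₃, h⟩
    dsimp only at h₁ h₂ h₃
    subst h₁ h₂ h₃
    obtain rfl : e = e' := funext fun ht => h ht ht
    rfl

theorem ne_one_of_max_ne_one {s t : unitInterval} (h : max s t ≠ 1) : s ≠ 1 ∧ t ≠ 1 := by
  constructor <;> rintro rfl
  · exact h (max_eq_left unitInterval.le_one')
  · exact h (max_eq_right unitInterval.le_one')

/-- The neighbourhoods of the apex do not see the paths below it. -/
instance : TopologicalSpace (ConePath E) :=
  .induced (fun x => (x.src, x.tgt, x.height)) inferInstance ⊓
    .generateFrom {s | ∃ U : Set E.paths, IsOpen U ∧ s = {x | ∃ h, x.body h ∈ U}}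

section Continuous

variable {Z : Type*} [TopologicalSpace Z] {f g : Z → ConePath E}

theorem continuous_iff : Continuous f ↔ (Continuous fun z => (f z).src) ∧
    (Continuous fun z => (f z).tgt) ∧ (Continuous fun z => (f z).height) ∧
      Continuous fun z : {z // (f z).height ≠ 1} => (f z).body z.2 := by
  have hgen : Continuous[_, .generateFrom {s | ∃ U : Set E.paths, IsOpen U ∧
      s = {x : ConePath E | ∃ h, x.body h ∈ U}}] f ↔
      ∀ U : Set E.paths, IsOpen U → IsOpen {z | ∃ h, (f z).body h ∈ U} := by
    rw [continuous_generateFrom_iff]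
    exact ⟨fun h U hU => h _ ⟨U, hU, rfl⟩, by rintro h _ ⟨U, hU, rfl⟩; exact h U hU⟩
  refine (continuous_inf_rng.trans (and_congr continuous_induced_rng hgen)).trans ?_
  simp only [Function.comp_def, continuous_prodMk, and_assoc]
  refine and_congr_right fun _ => and_congr_right fun _ => and_congr_right fun ht => ?_
  have hopen : IsOpen {z | (f z).height ≠ 1} := isOpen_ne_fun ht continuous_const
  have himage (U : Set E.paths) : {z | ∃ h, (f z).body h ∈ U} =
      Subtype.val '' ((fun z : {z // (f z).height ≠ 1} => (f z).body z.2) ⁻¹' U) := by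
    ext z
    exact ⟨fun ⟨h, hU⟩ => ⟨⟨z, h⟩, hU, rfl⟩, by rintro ⟨⟨z, h⟩, hU, rfl⟩; exact ⟨h, hU⟩⟩
  simp only [continuous_def, himage, hopen.isOpenEmbedding_subtypeVal.isOpen_iff_image_isOpen]
  rfl

@[fun_prop]
theorem continuous_height (hf : Continuous f) : Continuous fun z => (f z).height :=
  (continuous_iff.1 hf).2.2.1

theorem continuous_body (hf : Continuous f) (h : ∀ z, (f z).height ≠ 1) :
    Continuous fun z => (f z).body (h z) :=
  (continuous_iff.1 hf).2.2.2.comp (continuous_id.subtype_mk h)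

end Continuous

instance : KHausdorffSpace (ConePath E) where
  isClosed_eq K f g := by
    obtain ⟨hfs, hft, hfh, -⟩ := continuous_iff.1 f.continuous
    obtain ⟨hgs, hgt, hgh, -⟩ := continuous_iff.1 g.continuous
    let U : Set K := {k | (f k).height ≠ 1 ∧ (g k).height ≠ 1}
    have hU : IsOpen U :=
      (isOpen_ne_fun hfh continuous_const).inter (isOpen_ne_fun hgh continuous_const)
    have : LocallyCompactSpace U := hU.locallyCompactSpace
    have hbody : IsClosed {k : U | (f k).body k.2.1 = (g k).body k.2.2} :=
      KHausdorffSpace.isClosed_eq_of_continuous (continuous_body (by fun_prop) _)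
        (continuous_body (by fun_prop) _)
    rw [← isOpen_compl_iff]
    convert ((isOpen_ne_fun hfs hgs).union (isOpen_ne_fun hft hgt)).union
      ((isOpen_ne_fun hfh hgh).union (hU.isOpenMap_subtype_val _ hbody.isOpen_compl)) using 1
    ext k
    simp only [ext_iff]
    have hval : k ∈ Subtype.val '' {k : U | (f k).body k.2.1 = (g k).body k.2.2}ᶜ ↔
        ∃ hx hy, (f k).body hx ≠ (g k).body hy :=
      ⟨by rintro ⟨⟨k, hx, hy⟩, hne, rfl⟩; exact ⟨hx, hy, hne⟩,
        fun ⟨hx, hy, hne⟩ => ⟨⟨k, hx, hy⟩, hne, rfl⟩⟩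
    rw [Set.mem_union, Set.mem_union, Set.mem_union, hval]
    simp only [Set.mem_compl_iff, Set.mem_ofPred_eq]
    grind

variable {x y : ConePath E}

/-- Concatenation below the apices, which are absorbing. -/
def concat (x y : ConePath E) (h : x.tgt = y.src) : ConePath E where
  src := x.src
  tgt := y.tgt
  height := max x.height y.height
  body hm := E.concat (x.body (ne_one_of_max_ne_one hm).1) (y.body (ne_one_of_max_ne_one hm).2)
    (by rw [tgt_body, src_body, h])
  src_body _ := by rw [E.src_concat, src_body]
  tgt_body _ := by rw [E.tgt_concat, tgt_body]

theorem continuous_concat (K : CompHaus.{u}) (f g : C(K, ConePath E))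
    (h : ∀ k, (f k).tgt = (g k).src) : Continuous fun k => concat (f k) (g k) (h k) := by
  have hmax : Continuous fun k => max (f k).height (g k).height := by fun_prop
  have : LocallyCompactSpace {k // max (f k).height (g k).height ≠ 1} :=
    (isOpen_ne_fun hmax continuous_const).locallyCompactSpace
  have hbody : Continuous fun k : {k // max (f k).height (g k).height ≠ 1} =>
      E.concat ((f k).body (ne_one_of_max_ne_one k.2).1) ((g k).body (ne_one_of_max_ne_one k.2).2)
        (by rw [tgt_body, src_body, h]) :=
    E.continuous_concat_of_continuous (continuous_body (by fun_prop) _)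
      (continuous_body (by fun_prop) _) _
  exact continuous_iff.2 ⟨(continuous_iff.1 f.continuous).1, (continuous_iff.1 g.continuous).2.1,
    hmax, hbody⟩

/-- The point of the base of the cone given by a path. -/
def base (e : E.paths) : ConePath E where
  src := E.src e
  tgt := E.tgt e
  height := 0
  body _ := e
  src_body _ := rfl
  tgt_body _ := rfl

theorem continuous_base : Continuous (base (E := E)) :=
  continuous_iff.2 ⟨E.continuous_src, E.continuous_tgt, continuous_const, continuous_subtype_val⟩

theorem height_base_ne_one (e : E.paths) : (base e).height ≠ 1 := zero_ne_one (α := unitInterval)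

theorem base_injective : Function.Injective (base (E := E)) := fun e e' h =>
  (ext_iff.1 h).2.2.2 (height_base_ne_one e) (height_base_ne_one e')

theorem base_body (h : x.height = 0) : base (x.body (h ▸ zero_ne_one)) = x :=
  ext_iff.2 ⟨x.src_body _, x.tgt_body _, h.symm, fun _ _ => rfl⟩

theorem base_concat (e e' : E.paths) (h : E.tgt e = E.src e') :
    base (E.concat e e' h) = concat (base e) (base e') h :=
  ext_iff.2 ⟨E.src_concat _ _ _, E.tgt_concat _ _ _, (max_self _).symm, fun _ _ => rfl⟩

/-- The apex of the cone on the paths from `a` to `b`. -/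
def apex (a b : E.states) : ConePath E where
  src := a
  tgt := b
  height := 1
  body h := absurd rfl h
  src_body h := absurd rfl h
  tgt_body h := absurd rfl h

/-- Raising a point of the cone to a height of at least `s`. -/
def raise (s : unitInterval) (x : ConePath E) : ConePath E where
  src := x.src
  tgt := x.tgt
  height := max s x.height
  body h := x.body (ne_one_of_max_ne_one h).2
  src_body _ := x.src_body _
  tgt_body _ := x.tgt_body _

theorem continuous_raise {Z : Type*} [TopologicalSpace Z] {s : Z → unitInterval}
    {f : Z → ConePath E} (hs : Continuous s) (hf : Continuous f) :
    Continuous fun z => raise (s z) (f z) :=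
  continuous_iff.2 ⟨(continuous_iff.1 hf).1, (continuous_iff.1 hf).2.1,
    hs.max (continuous_height hf), continuous_body (hf.comp continuous_subtype_val) _⟩

theorem raise_zero (x : ConePath E) : raise 0 x = x :=
  ext_iff.2 ⟨rfl, rfl, max_eq_right unitInterval.nonneg', fun _ _ => rfl⟩

theorem raise_one (x : ConePath E) : raise 1 x = apex x.src x.tgt :=
  ext_iff.2 ⟨rfl, rfl, max_eq_left unitInterval.le_one', fun _ h => absurd rfl h⟩

theorem exists_extension {V : Type*} [NormedAddCommGroup V] [NormedSpace ℝ V]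
    (f : C(Disk.bdry V, ConePath E)) (a b : E.states)
    (hf : ∀ y, (f y).src = a ∧ (f y).tgt = b) :
    ∃ l : C(Disk V, ConePath E), (∀ y : Disk.bdry V, l y = f y) ∧
      ∀ y, (l y).src = a ∧ (l y).tgt = b := by
  let P : Set (Disk V) := {y | 2 * ‖(y : V)‖ ≤ 1}
  let Q : Set (Disk V) := {y | 1 ≤ 2 * ‖(y : V)‖}
  have hPQ (y : Disk V) : y ∈ P ∨ y ∈ Q := le_total (2 * ‖(y : V)‖) 1
  have hclip (y : Q) : Disk.clip ((2 : ℝ) • (y : V)) ∈ Disk.bdry V :=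
    Disk.clip_mem_bdry (by rw [norm_smul, Real.norm_two]; exact y.2)
  let s (y : Disk V) : unitInterval := Set.projIcc 0 1 zero_le_one (2 - 2 * ‖(y : V)‖)
  have hs : Continuous s := continuous_projIcc.comp (by fun_prop)
  let g : C(Q, ConePath E) := ⟨fun y => raise (s y) (f ⟨_, hclip y⟩),
    continuous_raise (by fun_prop) (f.continuous.comp
      ((Disk.continuous_clip.comp (by fun_prop)).subtype_mk _))⟩
  obtain ⟨l, hlP, hlQ⟩ := exists_continuousMap_glue (A := P) (B := Q)
    (isClosed_le (by fun_prop) continuous_const) (isClosed_le continuous_const (by fun_prop)) hPQ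
    (.const P (apex a b)) g fun y hy hy' => by
      have hnorm : 2 * ‖(y : V)‖ = 1 := le_antisymm hy hy'
      have hs : s y = 1 := Set.projIcc_of_right_le _ (by linarith)
      change apex a b = raise (s y) _
      rw [hs, raise_one, (hf _).1, (hf _).2]
  refine ⟨l, fun y => ?_, fun y => ?_⟩
  · have hy : ‖(y.1 : V)‖ = 1 := y.2
    have hyQ : y.1 ∈ Q := show 1 ≤ 2 * ‖(y.1 : V)‖ by linarith
    have hs : s y = 0 := Set.projIcc_of_le_left _ (by linarith)
    have hclip_y : (⟨_, hclip ⟨y, hyQ⟩⟩ : Disk.bdry V) = y :=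
      Subtype.ext (Disk.clip_smul_of_mem_bdry one_le_two y.2)
    rw [(hlQ ⟨y, hyQ⟩ :)]
    change raise (s y) (f _) = _
    rw [hs, raise_zero, hclip_y]
  · rcases hPQ y with hy | hy
    · rw [(hlP ⟨y, hy⟩ :)]
      exact ⟨rfl, rfl⟩
    · rw [(hlQ ⟨y, hy⟩ :)]
      exact hf _

end ConePath

variable (E)

/-- The flow of cones on the spaces of paths of a flow. -/
def cone : DirectedFlow.{u} :=
  PreFlow.toFlow
    { states := E.states
      paths := ConePath E
      src := ConePath.src
      tgt := ConePath.tgt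
      continuous_src := (ConePath.continuous_iff.1 continuous_id).1
      continuous_tgt := (ConePath.continuous_iff.1 continuous_id).2.1
      concat := ConePath.concat
      continuous_concat := ConePath.continuous_concat
      src_concat := fun _ _ _ => rfl
      tgt_concat := fun _ _ _ => rfl
      concat_assoc := fun _ _ _ _ _ => ConePath.ext_iff.2
        ⟨rfl, rfl, max_assoc _ _ _, fun _ _ => E.concat_assoc _ _ _ _ _⟩ }

/-- The inclusion of the base of the cone. -/
def coneBase : E ⟶ cone E where
  onStates := id
  onPaths := ⟨fun e => Kelleyfication.of (ConePath.base e),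
    Kelleyfication.continuous_of_comp ConePath.continuous_base⟩
  src_onPaths _ := rfl
  tgt_onPaths _ := rfl
  map_concat x y h := Kelleyfication.ext (X := ConePath E) (ConePath.base_concat x y h)

theorem isClosedEmbedding_coneBase : IsClosedEmbedding (coneBase E).onPaths := by
  refine .of_continuous_injective_isClosedMap (map_continuous _)
    (fun e e' h => ConePath.base_injective (congrArg (Kelleyfication.val (X := ConePath E)) h))
    fun C hC => ?_
  let v : C((cone E).paths, ConePath E) := Kelleyfication.val (X := ConePath E)
  let Z : Set (cone E).paths := {x | (v x).height = 0}
  have hZ : IsClosed Z := isClosed_eq (ConePath.continuous_height v.continuous) continuous_const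
  have hne (z : Z) : (v z).height ≠ 1 := z.2.trans_ne zero_ne_one
  have hbody : Continuous fun z : Z => (v z).body (hne z) :=
    ConePath.continuous_body (by fun_prop) _
  convert! hZ.isClosedMap_subtype_val _ (hC.preimage hbody)
  ext x
  constructor
  · rintro ⟨e, he, rfl⟩
    exact ⟨⟨(coneBase E).onPaths e, rfl⟩, he, rfl⟩
  · rintro ⟨z, hz, rfl⟩
    exact ⟨_, hz, Kelleyfication.ext (X := ConePath E) (ConePath.base_body z.2)⟩

theorem isTrivialFibration_toCodiscrete_cone : IsTrivialFibration (cone E).toCodiscrete := by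
  refine ⟨Function.bijective_id, fun n f g hfg => ?_⟩
  let v : C((cone E).paths, ConePath E) := Kelleyfication.val (X := ConePath E)
  have hg (y y') : g y = g y' := PreconnectedSpace.constant inferInstance g.continuous
  let y₀ : Disk (EuclideanSpace ℝ (Fin n)) := Disk.clip 0
  have hf (y) : (v (f y)).src = (g y₀).1 ∧ (v (f y)).tgt = (g y₀).2 := by
    have := (hfg y).trans (hg y y₀)
    exact ⟨congrArg Prod.fst this, congrArg Prod.snd this⟩
  obtain ⟨l, hl, hlg⟩ := ConePath.exists_extension (v.comp f) (g y₀).1 (g y₀).2 hf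
  refine ⟨⟨fun y => Kelleyfication.of (l y), Kelleyfication.continuous_of_comp l.continuous⟩,
    fun y => Kelleyfication.ext (X := ConePath E) (hl y), fun y => ?_⟩
  exact (Prod.ext (hlg y).1 (hlg y).2).trans (hg y₀ y)

theorem isClosedEmbedding_onPaths_of_hasLiftingProperty {F : DirectedFlow.{u}} (j : E ⟶ F)
    [HasLiftingProperty j (cone E).toCodiscrete] (r : F ⟶ codiscrete (cone E).states)
    (hr : coneBase E ≫ (cone E).toCodiscrete = j ≫ r) : IsClosedEmbedding j.onPaths := by
  have sq : CommSq (coneBase E) j (cone E).toCodiscrete r := ⟨hr⟩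
  refine isClosedEmbedding_of_comp (map_continuous _) (map_continuous sq.lift.onPaths) ?_
  convert isClosedEmbedding_coneBase E
  exact funext (onPaths_congr sq.fac_left)

namespace Extension

variable {E U V : DirectedFlow.{u}} {P : E.Extension} {q : U ⟶ V}

/-- The realization of the generators by lifts of their images along a morphism that is injective
on states. -/
def liftRealization (hq : Function.Injective q.onStates) {f : E ⟶ U} {g : P.flow ⟶ V}
    (hfg : f ≫ q = P.incl ≫ g) (d : C(P.gens, U.paths))
    (hd : ∀ z, q.onPaths (d z) = g.onPaths (P.gen z)) : P.Realization U where
  base := f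
  onGens := d
  src_onGens z := hq <| by
    rw [← q.src_onPaths, hd, g.src_onPaths]
    exact (onStates_congr hfg (P.src z)).symm
  tgt_onGens z := hq <| by
    rw [← q.tgt_onPaths, hd, g.tgt_onPaths]
    exact (onStates_congr hfg (P.tgt z)).symm

theorem exists_lift (hq : Function.Injective q.onStates) {f : E ⟶ U} {g : P.flow ⟶ V}
    (hfg : f ≫ q = P.incl ≫ g) (d : C(P.gens, U.paths))
    (hd : ∀ z, q.onPaths (d z) = g.onPaths (P.gen z))
    (hrel : ∀ {a b : E.states} {v w : Word E P.src P.tgt a b}, P.rel v w →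
      ((liftRealization hq hfg d hd).eval v).1 = ((liftRealization hq hfg d hd).eval w).1) :
    ∃ l : P.flow ⟶ U, P.incl ≫ l = f ∧ (∀ z, l.onPaths (P.gen z) = d z) ∧ l ≫ q = g :=
  let M : P.Model U := { liftRealization hq hfg d hd with eval_eq := hrel }
  ⟨M.desc, rfl, fun _ => rfl, hom_ext hfg hd⟩

end Extension

section Double

variable (X : DirectedFlow.{u})

/-- The relations that make the generators of the double compatible with concatenation. -/
inductive DoubleRel : ∀ {a b : X.states}, Word X X.src X.tgt a b → Word X X.src X.tgt a b → Prop
  | concat (x y : X.paths) (h : X.tgt x = X.src y) :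
    DoubleRel (.gen (X.concat x y h) (X.src_concat x y h) (X.tgt_concat x y h))
      (.mul (.gen x rfl rfl) (.gen y rfl rfl) h)

/-- The double of a flow along its states: the extension of `X` by a second copy of its paths. -/
def doubleExtension : X.Extension where
  gens := X.paths
  src := X.src
  tgt := X.tgt
  continuous_src := X.continuous_src
  continuous_tgt := X.continuous_tgt
  rel := DoubleRel X

/-- The inclusion of the second copy. -/
noncomputable def doubleInr : X ⟶ (doubleExtension X).flow where
  onStates := id
  onPaths := (doubleExtension X).gen
  src_onPaths _ := rfl
  tgt_onPaths _ := rfl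
  map_concat x y h := Extension.paths_ext (P := doubleExtension X) fun _ M =>
    (M.eval_eq (DoubleRel.concat x y h)).trans
      (M.desc.map_concat ((doubleExtension X).gen x) ((doubleExtension X).gen y) h).symm

/-- The morphism out of the double that restricts to the identity of both copies. -/
noncomputable def doubleFold : (doubleExtension X).flow ⟶ X :=
  Extension.Model.desc
    { base := 𝟙 X
      onGens := .id _
      src_onGens := fun _ => rfl
      tgt_onGens := fun _ => rfl
      eval_eq := by rintro _ _ _ _ ⟨x, y, h⟩; rfl }

/-- The morphism from the coproduct to the double. -/
noncomputable def coprodToDouble : X ⨿ X ⟶ (doubleExtension X).flow :=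
  Limits.coprod.desc (doubleExtension X).incl (doubleInr X)

theorem coprodToDouble_fold :
    coprodToDouble X ≫ doubleFold X = Limits.coprod.desc (𝟙 X) (𝟙 X) := by
  ext1
  · rw [coprodToDouble, Limits.coprod.inl_desc_assoc, Limits.coprod.inl_desc]
    rfl
  · rw [coprodToDouble, Limits.coprod.inr_desc_assoc, Limits.coprod.inr_desc]
    rfl

theorem hasLiftingProperty_coprodToDouble {U V : DirectedFlow.{u}} {q : U ⟶ V}
    (hq : Function.Injective q.onStates) : HasLiftingProperty (coprodToDouble X) q where
  sq_hasLift {f g} sq := by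
    let f₁ := Limits.coprod.inl ≫ f
    let f₂ := Limits.coprod.inr ≫ f
    have h₁ : f₁ ≫ q = (doubleExtension X).incl ≫ g := by
      rw [Category.assoc, sq.w, coprodToDouble, Limits.coprod.inl_desc_assoc]
    have h₂ : f₂ ≫ q = doubleInr X ≫ g := by
      rw [Category.assoc, sq.w, coprodToDouble, Limits.coprod.inr_desc_assoc]
    have hf : f₁.onStates = f₂.onStates := funext fun a =>
      hq ((onStates_congr h₁ a).trans (onStates_congr h₂ a).symm)
    obtain ⟨l, hl₁, hl₂, hlg⟩ := Extension.exists_lift hq h₁ f₂.onPaths (onPaths_congr h₂) <| by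
      rintro _ _ _ _ ⟨x, y, h⟩
      exact f₂.map_concat x y h
    refine ⟨⟨l, ?_, hlg⟩⟩
    refine Limits.coprod.hom_ext ?_ ?_
    · rwa [coprodToDouble, Limits.coprod.inl_desc_assoc]
    · rw [coprodToDouble, Limits.coprod.inr_desc_assoc]
      exact hom_ext (fun a => (onStates_congr hl₁ a).trans (congrFun hf a)) hl₂

end Double

section Attach

variable {E B : DirectedFlow.{u}}

/-- A disk in the paths of the target of `p` with a lift of its boundary. -/
structure Cell (p : E ⟶ B) : Type u where
  dim : ℕ
  disk : C(Disk (EuclideanSpace ℝ (Fin dim)), B.paths)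
  bdry : C(Disk.bdry (EuclideanSpace ℝ (Fin dim)), E.paths)
  onPaths_bdry : ∀ y, p.onPaths (bdry y) = disk y

variable (p : E ⟶ B) (hp : Function.Bijective p.onStates)

/-- The points of the cells. -/
abbrev CellPoint : Type u := Σ c : Cell p, ULift.{u} (Disk (EuclideanSpace ℝ (Fin c.dim)))

/-- The path of `B` given by a point of a cell. -/
def cellPath : C(CellPoint p, B.paths) where
  toFun z := z.1.disk z.2.down
  continuous_toFun := continuous_sigma fun c => c.disk.continuous.comp continuous_uliftDown

/-- The source of a point of a cell, as a state of `E`. -/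
noncomputable def cellSrc (z : CellPoint p) : E.states :=
  (Equiv.ofBijective _ hp).symm (B.src (cellPath p z))

/-- The target of a point of a cell, as a state of `E`. -/
noncomputable def cellTgt (z : CellPoint p) : E.states :=
  (Equiv.ofBijective _ hp).symm (B.tgt (cellPath p z))

variable {p} in
theorem cellSrc_bdry (c : Cell p) (y : Disk.bdry (EuclideanSpace ℝ (Fin c.dim))) :
    cellSrc p hp ⟨c, ⟨y⟩⟩ = E.src (c.bdry y) :=
  (Equiv.symm_apply_eq _).2 ((congrArg B.src (c.onPaths_bdry y)).symm.trans (p.src_onPaths _))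

variable {p} in
theorem cellTgt_bdry (c : Cell p) (y : Disk.bdry (EuclideanSpace ℝ (Fin c.dim))) :
    cellTgt p hp ⟨c, ⟨y⟩⟩ = E.tgt (c.bdry y) :=
  (Equiv.symm_apply_eq _).2 ((congrArg B.tgt (c.onPaths_bdry y)).symm.trans (p.tgt_onPaths _))

/-- The relations that attach the cells to `E` along their boundaries. -/
inductive AttachRel : ∀ {a b : E.states}, Word E (cellSrc p hp) (cellTgt p hp) a b →
    Word E (cellSrc p hp) (cellTgt p hp) a b → Prop
  | bdry (c : Cell p) (y : Disk.bdry (EuclideanSpace ℝ (Fin c.dim))) :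
    AttachRel (.path (c.bdry y) rfl rfl)
      (.gen ⟨c, ⟨y⟩⟩ (cellSrc_bdry hp c y) (cellTgt_bdry hp c y))

/-- The extension of `E` by all cells. -/
noncomputable def attachExtension : E.Extension where
  gens := CellPoint p
  src := cellSrc p hp
  tgt := cellTgt p hp
  continuous_src := continuous_of_discreteTopology.comp
    (B.continuous_src.comp (cellPath p).continuous)
  continuous_tgt := continuous_of_discreteTopology.comp
    (B.continuous_tgt.comp (cellPath p).continuous)
  rel := AttachRel p hp

/-- The extension of `p` to the cells. -/
noncomputable def attachProj : (attachExtension p hp).flow ⟶ B :=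
  Extension.Model.desc
    { base := p
      onGens := cellPath p
      src_onGens := fun z => ((Equiv.ofBijective _ hp).apply_symm_apply (B.src (cellPath p z))).symm
      tgt_onGens := fun z => ((Equiv.ofBijective _ hp).apply_symm_apply (B.tgt (cellPath p z))).symm
      eval_eq := by rintro _ _ _ _ ⟨c, y⟩; exact c.onPaths_bdry y }

theorem incl_attachProj : (attachExtension p hp).incl ≫ attachProj p hp = p := rfl

/-- A cell as a disk in the paths of the extension. -/
noncomputable def cellMap (c : Cell p) :
    C(Disk (EuclideanSpace ℝ (Fin c.dim)), (attachExtension p hp).flow.paths) :=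
  (attachExtension p hp).gen.comp ⟨fun y => ⟨c, ⟨y⟩⟩, continuous_sigmaMk.comp continuous_uliftUp⟩

theorem cellMap_bdry (c : Cell p) (y : Disk.bdry (EuclideanSpace ℝ (Fin c.dim))) :
    cellMap p hp c y = (attachExtension p hp).incl.onPaths (c.bdry y) :=
  Extension.paths_ext (P := attachExtension p hp) fun _ M => (M.eval_eq (AttachRel.bdry c y)).symm

theorem attachProj_cellMap (c : Cell p) (y : Disk (EuclideanSpace ℝ (Fin c.dim))) :
    (attachProj p hp).onPaths (cellMap p hp c y) = c.disk y := rfl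

theorem hasLiftingProperty_attachExtension_incl {U V : DirectedFlow.{u}} {q : U ⟶ V}
    (hq : IsTrivialFibration q) : HasLiftingProperty (attachExtension p hp).incl q where
  sq_hasLift {f g} sq := by
    choose d hd_bdry hd using fun c : Cell p =>
      hq.2 c.dim (f.onPaths.comp c.bdry) (g.onPaths.comp (cellMap p hp c)) fun y =>
        (onPaths_congr sq.w (c.bdry y)).trans (congrArg g.onPaths (cellMap_bdry p hp c y)).symm
    obtain ⟨l, hlf, -, hlg⟩ := Extension.exists_lift hq.1.injective sq.w
      ⟨fun z => d z.1 z.2.down, continuous_sigma fun c =>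
        (d c).continuous.comp continuous_uliftDown⟩ (fun z => hd z.1 z.2.down) <| by
      rintro _ _ _ _ ⟨c, y⟩
      exact (hd_bdry c y).symm
    exact ⟨⟨l, hlf, hlg⟩⟩

theorem isClosedEmbedding_attachExtension_incl :
    IsClosedEmbedding (attachExtension p hp).incl.onPaths :=
  have := hasLiftingProperty_attachExtension_incl p hp (isTrivialFibration_toCodiscrete_cone E)
  isClosedEmbedding_onPaths_of_hasLiftingProperty E _ (attachExtension p hp).endpoints.desc rfl

end Attach

end DirectedFlow

/-! ### Sequential colimits -/

section DirectLimit

variable {ι : Type*} [Preorder ι] [IsDirectedOrder ι] {A : ι → Type*} [∀ i, TopologicalSpace (A i)]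
  {f : ∀ i j, i ≤ j → C(A i, A j)} [DirectedSystem A (f · · ·)]

theorem continuous_directLimit_iff {Z : Type*} [TopologicalSpace Z] {g : DirectLimit A f → Z} :
    Continuous g ↔ ∀ i, Continuous fun x : A i => g ⟦⟨i, x⟩⟧ :=
  isQuotientMap_quotient_mk'.continuous_iff.trans continuous_sigma_iff

theorem continuous_directLimit_mk (i : ι) :
    Continuous fun x : A i => (⟦⟨i, x⟩⟧ : DirectLimit A f) :=
  continuous_quotient_mk'.comp continuous_sigmaMk

theorem isClosed_directLimit_iff {s : Set (DirectLimit A f)} :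
    IsClosed s ↔ ∀ i, IsClosed {x : A i | (⟦⟨i, x⟩⟧ : DirectLimit A f) ∈ s} :=
  isQuotientMap_quotient_mk'.isClosed_preimage.symm.trans isClosed_sigma_iff

theorem isClosedEmbedding_directLimit_mk (hf : ∀ i j h, IsClosedEmbedding (f i j h)) (i : ι) :
    IsClosedEmbedding fun x : A i => (⟦⟨i, x⟩⟧ : DirectLimit A f) := by
  have hinj := DirectLimit.mk_injective f fun i j h => (hf i j h).injective
  refine .of_continuous_injective_isClosedMap (continuous_directLimit_mk i) (hinj i)
    fun s hs => isClosed_directLimit_iff.2 fun j => ?_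
  obtain ⟨k, hik, hjk⟩ := exists_ge_ge i j
  have hpre : {y : A j | (⟦⟨j, y⟩⟧ : DirectLimit A f) ∈ (fun x : A i => ⟦⟨i, x⟩⟧) '' s} =
      f j k hjk ⁻¹' (f i k hik '' s) := by
    ext y
    refine exists_congr fun x => and_congr_right fun _ => ?_
    rw [← (hinj k).eq_iff, DirectLimit.mk_apply, DirectLimit.mk_apply]
  rw [hpre]
  exact ((hf i k hik).isClosedMap s hs).preimage (f j k hjk).continuous

end DirectLimit

section Sequential

variable {A : ℕ → Type*} [∀ n, TopologicalSpace (A n)] [∀ n, T1Space (A n)]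
  {f : ∀ m n, m ≤ n → C(A m, A n)} [DirectedSystem A (f · · ·)]

theorem exists_forall_mem_range_directLimit_mk
    (hf : ∀ m n h, Function.Injective (f m n h)) {K : Type*}
    [TopologicalSpace K] [CompactSpace K] (g : C(K, DirectLimit A f)) :
    ∃ n, ∀ k, ∃ x : A n, ⟦⟨n, x⟩⟧ = g k := by
  by_contra! h
  choose k hk using h
  -- Each stage meets the sequence `g (k n)` in a finite set, so its tails are closed.
  let C : ℕ → Set (DirectLimit A f) := fun n => (fun m => g (k m)) '' Set.Ici n
  have hC (n : ℕ) : IsClosed (C n) := by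
    refine isClosed_directLimit_iff.2 fun l => Set.Finite.isClosed ?_
    refine .of_finite_image (f := fun x : A l => (⟦⟨l, x⟩⟧ : DirectLimit A f))
      (((Set.finite_lt_nat l).image fun m => g (k m)).subset ?_)
      (DirectLimit.mk_injective f hf l).injOn
    rintro _ ⟨x, ⟨m, -, hm⟩, rfl⟩
    refine ⟨m, lt_of_not_ge fun hlm => hk m (f l m hlm x) ?_, hm⟩
    exact (DirectLimit.mk_apply l m x hlm).trans hm.symm
  obtain ⟨x, hx⟩ := IsCompact.nonempty_iInter_of_sequence_nonempty_isCompact_isClosed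
    (fun n => g ⁻¹' C n)
    (fun n => Set.preimage_mono (Set.image_mono (Set.Ici_subset_Ici.2 n.le_succ)))
    (fun n => ⟨k n, n, le_refl n, rfl⟩) ((hC 0).preimage g.continuous).isCompact
    fun n => (hC n).preimage g.continuous
  obtain ⟨n, y, hy⟩ := DirectLimit.exists_eq_mk f (g x)
  obtain ⟨m, hm, hxm⟩ := Set.mem_iInter.1 hx n
  exact hk m (f n m hm y) ((DirectLimit.mk_apply n m y hm).trans (hy.symm.trans hxm.symm))

theorem exists_directLimit_factor (hf : ∀ m n h, IsClosedEmbedding (f m n h)) {K : Type*}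
    [TopologicalSpace K] [CompactSpace K] (g : C(K, DirectLimit A f)) :
    ∃ (n : ℕ) (g' : C(K, A n)), ∀ k, ⟦⟨n, g' k⟩⟧ = g k := by
  obtain ⟨n, hn⟩ :=
    exists_forall_mem_range_directLimit_mk (fun m n h => (hf m n h).injective) g
  choose g' hg' using hn
  have hg'c : Continuous g' :=
    (isClosedEmbedding_directLimit_mk hf n).isInducing.continuous_iff.2
      (g.continuous.congr fun k => (hg' k).symm)
  exact ⟨n, ⟨g', hg'c⟩, hg'⟩

end Sequential

namespace DirectedFlow

/-- A sequence of flows over `X` with the states of `X` and with closed embeddings of path spaces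
as transition maps: the sequences whose colimit the small object argument needs. -/
structure Tower (X : DirectedFlow.{u}) : Type (u + 1) where
  functor : ℕ ⥤ Over X
  bijective_onStates (n : ℕ) : Function.Bijective (functor.obj n).hom.onStates
  isClosedEmbedding_succ (n : ℕ) :
    IsClosedEmbedding (functor.map (homOfLE n.le_succ)).left.onPaths

namespace Tower

variable {X : DirectedFlow.{u}} (T : Tower X)

/-- The stages of a tower. -/
abbrev stage (n : ℕ) : DirectedFlow.{u} := (T.functor.obj n).left

/-- The projections of a tower. -/
abbrev proj (n : ℕ) : T.stage n ⟶ X := (T.functor.obj n).hom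

/-- The transition maps of a tower. -/
abbrev trans {m n : ℕ} (h : m ≤ n) : T.stage m ⟶ T.stage n := (T.functor.map (homOfLE h)).left

theorem isClosedEmbedding_trans {m n : ℕ} (h : m ≤ n) : IsClosedEmbedding (T.trans h).onPaths := by
  induction n, h using Nat.le_induction with
  | base => rw [trans, show homOfLE (le_refl m) = 𝟙 m from rfl, T.functor.map_id]; exact .id
  | succ n h ih =>
    rw [trans, ← homOfLE_comp h n.le_succ, T.functor.map_comp]
    exact (T.isClosedEmbedding_succ n).comp ih

/-- The transition maps on path spaces. -/
def transPaths (m n : ℕ) (h : m ≤ n) : C((T.stage m).paths, (T.stage n).paths) :=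
  (T.trans h).onPaths

instance : DirectedSystem (fun n => (T.stage n).paths) (T.transPaths · · ·) where
  map_self n x := onPaths_congr (congrArg Over.Hom.left (T.functor.map_id n)) x
  map_map _ _ _ h h' x :=
    onPaths_congr (congrArg Over.Hom.left (T.functor.map_comp (homOfLE h) (homOfLE h'))).symm x

/-- The colimit of the path spaces. -/
abbrev Paths : Type u := DirectLimit (fun n => (T.stage n).paths) T.transPaths

/-- The inclusion of the paths of a stage. -/
def ofStage (n : ℕ) : C((T.stage n).paths, T.Paths) :=
  ⟨fun x => ⟦⟨n, x⟩⟧, continuous_directLimit_mk (f := T.transPaths) n⟩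

variable {T}

theorem ofStage_trans {m n : ℕ} (h : m ≤ n) (x : (T.stage m).paths) :
    T.ofStage n ((T.trans h).onPaths x) = T.ofStage m x :=
  DirectLimit.mk_apply (F := fun n => (T.stage n).paths) (f := T.transPaths) m n x h

theorem ofStage_injective (n : ℕ) : Function.Injective (T.ofStage n) :=
  DirectLimit.mk_injective T.transPaths (fun _ _ h => (T.isClosedEmbedding_trans h).injective) n

theorem exists_ofStage (x : T.Paths) : ∃ n a, T.ofStage n a = x := by
  obtain ⟨n, a, rfl⟩ := DirectLimit.exists_eq_mk T.transPaths x
  exact ⟨n, a, rfl⟩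

theorem exists_ofStage₂ (x y : T.Paths) : ∃ n a b, T.ofStage n a = x ∧ T.ofStage n b = y := by
  obtain ⟨n, a, b, rfl, rfl⟩ := DirectLimit.exists_eq_mk₂ T.transPaths x y
  exact ⟨n, a, b, rfl, rfl⟩

theorem exists_ofStage₃ (x y z : T.Paths) :
    ∃ n a b c, T.ofStage n a = x ∧ T.ofStage n b = y ∧ T.ofStage n c = z := by
  obtain ⟨n, a, b, c, rfl, rfl, rfl⟩ := DirectLimit.exists_eq_mk₃ T.transPaths x y z
  exact ⟨n, a, b, c, rfl, rfl, rfl⟩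

theorem exists_factor {K : Type*} [TopologicalSpace K] [CompactSpace K] (g : C(K, T.Paths)) :
    ∃ (n : ℕ) (g' : C(K, (T.stage n).paths)), ∀ k, T.ofStage n (g' k) = g k :=
  exists_directLimit_factor (f := T.transPaths) (fun _ _ h => T.isClosedEmbedding_trans h) g

theorem exists_factor₂ {K : Type*} [TopologicalSpace K] [CompactSpace K] (g₁ g₂ : C(K, T.Paths)) :
    ∃ (n : ℕ) (g₁' g₂' : C(K, (T.stage n).paths)),
      (∀ k, T.ofStage n (g₁' k) = g₁ k) ∧ ∀ k, T.ofStage n (g₂' k) = g₂ k := by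
  obtain ⟨m, a, ha⟩ := exists_factor g₁
  obtain ⟨n, b, hb⟩ := exists_factor g₂
  exact ⟨max m n, (T.trans (le_max_left m n)).onPaths.comp a,
    (T.trans (le_max_right m n)).onPaths.comp b, fun k => (ofStage_trans _ _).trans (ha k),
    fun k => (ofStage_trans _ _).trans (hb k)⟩

instance : KHausdorffSpace T.Paths where
  isClosed_eq K g₁ g₂ := by
    obtain ⟨n, a, b, ha, hb⟩ := exists_factor₂ g₁ g₂
    simp only [← ha, ← hb, (ofStage_injective n).eq_iff]
    exact KHausdorffSpace.isClosed_eq K a b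

variable (T) in
/-- The morphisms on path spaces induced by a cocone. -/
def descPaths (c : Limits.Cocone (T.functor ⋙ Over.forget X)) : C(T.Paths, c.pt.paths) where
  toFun := DirectLimit.lift T.transPaths (fun n => (c.ι.app n).onPaths) fun _ _ h x =>
    (onPaths_congr (c.w (homOfLE h)) x).symm
  continuous_toFun := continuous_directLimit_iff.2 fun n => (c.ι.app n).onPaths.continuous

variable (T) in
/-- The projection of the colimit of the path spaces. -/
def projPaths : C(T.Paths, X.paths) := T.descPaths (Over.forgetCocone X |>.whisker T.functor)

theorem tgt_eq_src {n : ℕ} {a b : (T.stage n).paths}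
    (h : X.tgt (T.projPaths (T.ofStage n a)) = X.src (T.projPaths (T.ofStage n b))) :
    (T.stage n).tgt a = (T.stage n).src b :=
  (T.bijective_onStates n).injective
    (((T.proj n).tgt_onPaths a).symm.trans (h.trans ((T.proj n).src_onPaths b)))

theorem exists_concat (x y : T.Paths) (h : X.tgt (T.projPaths x) = X.src (T.projPaths y)) :
    ∃ z : T.Paths, ∀ n a b (ha : T.ofStage n a = x) (hb : T.ofStage n b = y),
      z = T.ofStage n ((T.stage n).concat a b (tgt_eq_src (by rw [ha, hb, h]))) := by
  obtain ⟨m, a, b, rfl, rfl⟩ := exists_ofStage₂ x y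
  refine ⟨T.ofStage m ((T.stage m).concat a b (tgt_eq_src h)), fun n a' b' ha hb => ?_⟩
  rw [← ofStage_trans (le_max_left m n), ← ofStage_trans (le_max_right m n), Hom.map_concat,
    Hom.map_concat]
  refine congrArg _ (concat_congr _ (ofStage_injective _ ?_) (ofStage_injective _ ?_) _)
  · rw [ofStage_trans, ofStage_trans, ha]
  · rw [ofStage_trans, ofStage_trans, hb]

/-- Concatenation in the colimit, computed at any stage that contains both paths. -/
noncomputable def concat (x y : T.Paths) (h : X.tgt (T.projPaths x) = X.src (T.projPaths y)) :
    T.Paths :=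
  Classical.choose (exists_concat x y h)

theorem concat_eq {x y : T.Paths} (h : X.tgt (T.projPaths x) = X.src (T.projPaths y)) {n : ℕ}
    {a b : (T.stage n).paths} (ha : T.ofStage n a = x) (hb : T.ofStage n b = y) :
    concat x y h = T.ofStage n ((T.stage n).concat a b (tgt_eq_src (by rw [ha, hb, h]))) :=
  Classical.choose_spec (exists_concat x y h) n a b ha hb

theorem projPaths_concat (x y : T.Paths) (h : X.tgt (T.projPaths x) = X.src (T.projPaths y)) :
    T.projPaths (concat x y h) = X.concat (T.projPaths x) (T.projPaths y) h := by
  obtain ⟨n, a, b, rfl, rfl⟩ := exists_ofStage₂ x y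
  rw [concat_eq h rfl rfl]
  exact (T.proj n).map_concat a b _

theorem concat_assoc (x y z : T.Paths) (hxy : X.tgt (T.projPaths x) = X.src (T.projPaths y))
    (hyz : X.tgt (T.projPaths y) = X.src (T.projPaths z)) :
    concat (concat x y hxy) z (by rw [projPaths_concat, X.tgt_concat, hyz]) =
      concat x (concat y z hyz) (by rw [projPaths_concat, X.src_concat, hxy]) := by
  obtain ⟨n, a, b, c, rfl, rfl, rfl⟩ := exists_ofStage₃ x y z
  rw [concat_eq _ (concat_eq hxy rfl rfl).symm rfl, concat_eq _ rfl (concat_eq hyz rfl rfl).symm,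
    (T.stage n).concat_assoc]

variable (T) in
/-- The colimit of a tower. -/
noncomputable def colim : DirectedFlow.{u} :=
  PreFlow.toFlow
    { states := X.states
      paths := T.Paths
      src := X.src ∘ T.projPaths
      tgt := X.tgt ∘ T.projPaths
      continuous_src := X.continuous_src.comp T.projPaths.continuous
      continuous_tgt := X.continuous_tgt.comp T.projPaths.continuous
      concat := concat
      continuous_concat := fun K x y h => by
        obtain ⟨n, a, b, ha, hb⟩ := exists_factor₂ x y
        refine ((T.ofStage n).continuous.comp ((T.stage n).continuous_concat_comp a.continuous
          b.continuous fun k => tgt_eq_src ?_)).congr fun k => (concat_eq (h k) (ha k) (hb k)).symm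
        rw [ha, hb]
        exact h k
      src_concat := fun x y h =>
        (congrArg X.src (projPaths_concat x y h)).trans (X.src_concat _ _ _)
      tgt_concat := fun x y h =>
        (congrArg X.tgt (projPaths_concat x y h)).trans (X.tgt_concat _ _ _)
      concat_assoc := concat_assoc }

variable (T) in
/-- The projection of the colimit. -/
noncomputable def colimProj : T.colim ⟶ X where
  onStates := id
  onPaths := T.projPaths.comp (Kelleyfication.val (X := T.Paths))
  src_onPaths _ := rfl
  tgt_onPaths _ := rfl
  map_concat _ _ _ := projPaths_concat _ _ _

variable (T) in
/-- The inclusions of the stages in the colimit. -/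
noncomputable def colimIncl (n : ℕ) : T.stage n ⟶ T.colim where
  onStates := (T.proj n).onStates
  onPaths := ⟨fun x => Kelleyfication.of (T.ofStage n x),
    Kelleyfication.continuous_of_comp (T.ofStage n).continuous⟩
  src_onPaths x := (T.proj n).src_onPaths x
  tgt_onPaths x := (T.proj n).tgt_onPaths x
  map_concat x y h := Kelleyfication.ext (X := T.Paths) (concat_eq (n := n) (a := x) (b := y)
    (((T.proj n).tgt_onPaths x).trans ((congrArg _ h).trans ((T.proj n).src_onPaths y).symm))
    rfl rfl).symm

theorem trans_colimIncl {m n : ℕ} (h : m ≤ n) : T.trans h ≫ T.colimIncl n = T.colimIncl m :=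
  hom_ext (fun a => onStates_congr (Over.w (T.functor.map (homOfLE h))) a) fun x =>
    Kelleyfication.ext (X := T.Paths) (ofStage_trans h x)

variable (T) in
/-- The colimit of a tower as a cocone. -/
noncomputable def cocone : Limits.Cocone (T.functor ⋙ Over.forget X) where
  pt := T.colim
  ι :=
    { app := T.colimIncl
      naturality := fun _ _ h => trans_colimIncl (leOfHom h) }

theorem exists_colimIncl (x : T.colim.paths) : ∃ n a, (T.colimIncl n).onPaths a = x := by
  obtain ⟨n, a, h⟩ := exists_ofStage (Kelleyfication.val (X := T.Paths) x)
  exact ⟨n, a, Kelleyfication.ext (X := T.Paths) h⟩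

theorem exists_colimIncl₂ (x y : T.colim.paths) :
    ∃ n a b, (T.colimIncl n).onPaths a = x ∧ (T.colimIncl n).onPaths b = y := by
  obtain ⟨n, a, b, ha, hb⟩ := exists_ofStage₂ (Kelleyfication.val (X := T.Paths) x)
    (Kelleyfication.val (X := T.Paths) y)
  exact ⟨n, a, b, Kelleyfication.ext (X := T.Paths) ha, Kelleyfication.ext (X := T.Paths) hb⟩

theorem colim_hom_ext {U : DirectedFlow.{u}} {f g : T.colim ⟶ U}
    (h : ∀ n, T.colimIncl n ≫ f = T.colimIncl n ≫ g) : f = g := by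
  refine hom_ext (fun a => ?_) fun x => ?_
  · obtain ⟨b, rfl⟩ := (T.bijective_onStates 0).surjective a
    exact onStates_congr (h 0) b
  · obtain ⟨n, y, rfl⟩ := exists_colimIncl x
    exact onPaths_congr (h n) y

variable (T) in
/-- The map on states induced by a cocone. -/
noncomputable def descStates (c : Limits.Cocone (T.functor ⋙ Over.forget X)) :
    X.states → c.pt.states :=
  (c.ι.app 0).onStates ∘ (Equiv.ofBijective _ (T.bijective_onStates 0)).symm

theorem descStates_proj (c : Limits.Cocone (T.functor ⋙ Over.forget X)) (n : ℕ)
    (a : (T.stage n).states) :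
    T.descStates c ((T.proj n).onStates a) = (c.ι.app n).onStates a := by
  let e := Equiv.ofBijective _ (T.bijective_onStates 0)
  obtain ⟨b, rfl⟩ : ∃ b, (T.trans n.zero_le).onStates b = a := by
    obtain ⟨b, hb⟩ := (T.bijective_onStates 0).surjective ((T.proj n).onStates a)
    exact ⟨b, (T.bijective_onStates n).injective
      ((onStates_congr (Over.w (T.functor.map (homOfLE n.zero_le))) b).trans hb)⟩
  calc T.descStates c ((T.proj n).onStates ((T.trans n.zero_le).onStates b))
      = T.descStates c (e b) :=
        congrArg _ (onStates_congr (Over.w (T.functor.map (homOfLE n.zero_le))) b)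
    _ = (c.ι.app 0).onStates b := congrArg _ (e.symm_apply_apply b)
    _ = (c.ι.app n).onStates ((T.trans n.zero_le).onStates b) :=
        (onStates_congr (c.w (homOfLE n.zero_le)) b).symm

variable (T) in
/-- The morphism out of the colimit given by a cocone. -/
noncomputable def colimDesc (c : Limits.Cocone (T.functor ⋙ Over.forget X)) : T.colim ⟶ c.pt where
  onStates := T.descStates c
  onPaths := (T.descPaths c).comp (Kelleyfication.val (X := T.Paths))
  src_onPaths x := by
    obtain ⟨n, y, rfl⟩ := exists_colimIncl x
    exact ((c.ι.app n).src_onPaths y).trans ((descStates_proj c n _).symm.trans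
      (congrArg (T.descStates c) ((T.proj n).src_onPaths y).symm))
  tgt_onPaths x := by
    obtain ⟨n, y, rfl⟩ := exists_colimIncl x
    exact ((c.ι.app n).tgt_onPaths y).trans ((descStates_proj c n _).symm.trans
      (congrArg (T.descStates c) ((T.proj n).tgt_onPaths y).symm))
  map_concat x y h := by
    obtain ⟨n, a, b, rfl, rfl⟩ := exists_colimIncl₂ x y
    exact (congrArg (T.descPaths c) (concat_eq (a := a) (b := b) h rfl rfl)).trans
      ((c.ι.app n).map_concat a b _)

theorem colimIncl_colimDesc (c : Limits.Cocone (T.functor ⋙ Over.forget X)) (n : ℕ) :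
    T.colimIncl n ≫ T.colimDesc c = c.ι.app n :=
  hom_ext (descStates_proj c n) fun _ => rfl

variable (T) in
/-- The universal property of the colimit. -/
noncomputable def isColimitCocone : Limits.IsColimit T.cocone where
  desc c := T.colimDesc c
  fac c n := colimIncl_colimDesc c n
  uniq c _ hf := colim_hom_ext fun n => (hf n).trans (colimIncl_colimDesc c n).symm

end Tower

/-! ### The small object argument -/

section SmallObject

variable {S X : DirectedFlow.{u}} (p : S ⟶ X) (hp : Function.Bijective p.onStates)

/-- The flows over `X` obtained from `p` by attaching all cells `n` times. -/
noncomputable def iterateAttach : ℕ → {A : Over X // Function.Bijective A.hom.onStates}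
  | 0 => ⟨Over.mk p, hp⟩
  | n + 1 =>
    ⟨Over.mk (attachProj (iterateAttach n).1.hom (iterateAttach n).2), (iterateAttach n).2⟩

/-- The tower obtained from `p` by attaching all cells again and again. -/
noncomputable def attachTower : Tower X where
  functor := Functor.ofSequence (X := fun n => (iterateAttach p hp n).1) fun n =>
    Over.homMk (attachExtension _ (iterateAttach p hp n).2).incl
      (incl_attachProj _ (iterateAttach p hp n).2)
  bijective_onStates n := (iterateAttach p hp n).2
  isClosedEmbedding_succ n := by
    rw [Functor.ofSequence_map_homOfLE_succ]
    exact isClosedEmbedding_attachExtension_incl _ (iterateAttach p hp n).2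

theorem attachTower_map_succ (n : ℕ) : (attachTower p hp).trans n.le_succ =
    (attachExtension _ (iterateAttach p hp n).2).incl :=
  congrArg Over.Hom.left (Functor.ofSequence_map_homOfLE_succ _ n)

theorem isTrivialFibration_attachTower_colimProj :
    IsTrivialFibration (attachTower p hp).colimProj := by
  let T := attachTower p hp
  refine ⟨Function.bijective_id, fun n a b hab => ?_⟩
  have : CompactSpace (Disk.bdry (EuclideanSpace ℝ (Fin n))) :=
    isCompact_iff_compactSpace.1 Disk.isClosed_bdry.isCompact
  obtain ⟨m, a', ha'⟩ :=
    Tower.exists_factor (T := T) ((Kelleyfication.val (X := T.Paths)).comp a)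
  have ha (y) : (T.colimIncl m).onPaths (a' y) = a y := Kelleyfication.ext (X := T.Paths) (ha' y)
  have hm := (iterateAttach p hp m).2
  let c : Cell (T.proj m) :=
    ⟨n, b, a', fun y => (congrArg T.colimProj.onPaths (ha y)).trans (hab y)⟩
  refine ⟨(T.colimIncl (m + 1)).onPaths.comp (cellMap _ hm c), fun y => ?_, fun y => ?_⟩
  · calc (T.colimIncl (m + 1)).onPaths (cellMap _ hm c y)
        = (T.colimIncl (m + 1)).onPaths ((T.trans m.le_succ).onPaths (a' y)) :=
          congrArg _ ((cellMap_bdry _ hm c y).trans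
            (onPaths_congr (attachTower_map_succ p hp m) (a' y)).symm)
      _ = a y := (onPaths_congr (T.trans_colimIncl m.le_succ) (a' y)).trans (ha y)
  · exact attachProj_cellMap _ hm c y

theorem hasLiftingProperty_attachTower_colimIncl {U V : DirectedFlow.{u}} {q : U ⟶ V}
    (hq : IsTrivialFibration q) : HasLiftingProperty ((attachTower p hp).colimIncl 0) q :=
  HasLiftingProperty.transfiniteComposition.hasLiftingProperty_ι_app_bot
    (attachTower p hp).isColimitCocone fun n _ => by
      change HasLiftingProperty ((attachTower p hp).trans n.le_succ) q
      rw [attachTower_map_succ]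
      exact hasLiftingProperty_attachExtension_incl _ _ hq

end SmallObject

theorem exists_factorization {S X : DirectedFlow.{u}} (p : S ⟶ X)
    (hp : Function.Bijective p.onStates) : ∃ (E : DirectedFlow.{u}) (i : S ⟶ E) (r : E ⟶ X),
    generatingCofibrations.rlp.llp i ∧ IsTrivialFibration r ∧ i ≫ r = p :=
  ⟨(attachTower p hp).colim, (attachTower p hp).colimIncl 0, (attachTower p hp).colimProj,
    fun _ _ _ hq =>
      hasLiftingProperty_attachTower_colimIncl p hp (isTrivialFibration_iff_rlp.2 hq),
    isTrivialFibration_attachTower_colimProj p hp, rfl⟩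

theorem exists_isVeryGood_cylinder (X : DirectedFlow.{u}) : ∃ P : Cylinder X, P.IsVeryGood := by
  obtain ⟨E, i, r, hi, hr, hir⟩ := exists_factorization (doubleFold X) Function.bijective_id
  have hcof : generatingCofibrations.rlp.llp (coprodToDouble X ≫ i) :=
    MorphismProperty.comp_mem _ _ _ (fun _ _ _ hq => hasLiftingProperty_coprodToDouble X
      (isTrivialFibration_iff_rlp.2 hq).1.injective) hi
  obtain ⟨hfib, hweq⟩ := isTrivialFibration_iff.1 hr
  have hfac : (coprodToDouble X ≫ i) ≫ r = Limits.coprod.desc (𝟙 X) (𝟙 X) := by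
    rw [Category.assoc, hir, coprodToDouble_fold]
  let P : Cylinder X :=
    { I := E
      i₀ := Limits.coprod.inl ≫ coprodToDouble X ≫ i
      i₁ := Limits.coprod.inr ≫ coprodToDouble X ≫ i
      π := r
      i₀_π := by rw [Category.assoc, hfac, Limits.coprod.inl_desc]
      i₁_π := by rw [Category.assoc, hfac, Limits.coprod.inr_desc]
      weakEquivalence_π := hweq }
  have hPi : P.i = coprodToDouble X ≫ i := Limits.coprod.hom_ext P.inl_i P.inr_i
  exact ⟨P, { cofibration_i := (cofibration_iff _).2 (hPi ▸ hcof), fibration_π := hfib }⟩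

theorem leftHomotopic_iff_sHomotopic {X Y : DirectedFlow.{u}} (hX : IsCofibrant X) {f g : X ⟶ Y} :
    LeftHomotopic f g ↔ SHomotopic f g := by
  refine ⟨LeftHomotopic.sHomotopic hX, fun h => ?_⟩
  obtain ⟨P, hP⟩ := X.exists_isVeryGood_cylinder
  exact ⟨P, hP, h.nonempty_leftHomotopy P hP.cofibration_i⟩

end DirectedFlow

theorem mainTheorem2 (X Y : DirectedFlow.{u}) (hX : IsCofibrant X) (hY : IsCofibrant Y) :
    DirectedFlow.LeftHomotopyEquivalent X Y ↔ DirectedFlow.SHomotopyEquivalent X Y := by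
  simp only [DirectedFlow.LeftHomotopyEquivalent, DirectedFlow.SHomotopyEquivalent,
    DirectedFlow.leftHomotopic_iff_sHomotopic hX, DirectedFlow.leftHomotopic_iff_sHomotopic hY]
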